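/- Let $K$ be a semiring with an involution $*$ (the identity in the real, rational or Boolean case, conjugation in the complex case); a square matrix $M$ over $K$ is called orthogonal if $M^{*}M=MM^{*}=I$, where $M^{*}$ is the transpose of $M$ with $*$ applied to every entry. Fix a finite alphabet $\Gamma$ and an injective encoding, by words over $\Gamma$, of the elements of a set $S\subseteq K$ that contains $0$ and $1$. A gate array $C$ on $n\ge 1$ wires has $d\ge 1$ levels. Each level consists of gates acting on disjoint non-empty tuples of (not necessarily adjacent) wires; a gate acting on $k$ wires is given by a $2^k\times 2^k$ matrix over $K$, whose rows and columns correspond to the bit vectors $0\cdots 00,0\cdots 01,\dots,1\cdots 11$. For $x\in\{0,1\}^n$ let $C(x)\in K^{2^n}$ be the column vector obtained from the basis vector of $x$ by applying the levels of $C$ from the first to the last. (If $K$ is not commutative, products of entries of gates on one level are taken in the order in which the gates are listed.) The array is encoded by a word that lists $n$ in unary and, for each level, the gates with their wires in unary and their matrices in full. Tensor formulas over $K$ are built from matrices over $K$ (the atomic formulas) by the binary operations $+$, $\cdot$ and $\otimes$ (Kronecker product), subject to the usual conditions on the orders of the matrices; they are encoded as fully parenthesized words with their matrices written in full. The depth of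 a tensor formula is the maximal distance from the root to a leaf of its tree, and $\mathrm{val}(F)$ is the matrix denoted by $F$. Then there are a logspace computable function $f$ on words (computed by a deterministic Turing machine with read-only input, write-only output and $O(\log)$ work space) and a constant $c$ such that the following holds. For every gate array $C$ on $n$ wires and $d$ levels whose gates have orthogonal matrices with entries in $S$, the function $f$ maps the encoding of $C$ to the encoding of a tensor formula $F(C)$ of order $2^n\times 2^n$ over $K$, with the entries of its atomic matrices in $S$, of depth at most $c\,(\log_2(nd)+1)$, such that for every $x=(x_1,\dots,x_n)\in\{0,1\}^n$ $$C(x)=\mathrm{val}\bigl(F(C)\cdot d_x\bigr),\qquad d_x=\bigotimes_{i=1}^n\chi_i,$$ where $\chi_i=\begin{pmatrix}1\\0\end{pmatrix}$ if $x_i=0$ and $\chi_i=\begin{pmatrix}0\\1\end{pmatrix}$ if $x_i=1$. -/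

import Mathlib

open scoped Matrix

/-! ### Logspace computable functions -/

namespace Logspace

/-- What the read-only input head can see: an end marker or a symbol of the input word. -/
inductive InputCell (α : Type*) where
  | leftEnd
  | symbol (a : α)
  | rightEnd

/-- The moves of a tape head. -/
inductive Move where
  | left
  | stay
  | right

/-- What a machine does in one step: enter a state, move the input head, write and move on each
of its `t` work tapes, and possibly append one symbol to its output. -/
structure Action (Q W β : Type*) (t : ℕ) where
  next : Q
  inputMove : Move
  write : Fin t → W
  workMove : Fin t → Move
  emit : Option β

/-- A deterministic Turing machine with a two-way read-only input tape over the finite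
alphabet `α`, a fixed number of one-way infinite read-write work tapes over a finite alphabet, and
a one-way write-only output tape over the finite alphabet `β`. The machine halts
when `transition` returns `none`. -/
structure Transducer (α β : Type*) [Finite α] [Finite β] where
  State : Type
  finite_state : Finite State
  Work : Type
  finite_work : Finite Work
  blank : Work
  tapes : ℕ
  start : State
  transition : State → InputCell α → (Fin tapes → Work) → Option (Action State Work β tapes)

namespace Transducer

variable {α β : Type*} [Finite α] [Finite β]

/-- A configuration; the input word itself is not part of it, as it never changes. -/
structure Config (M : Transducer α β) where
  state : M.State
  inputPos : ℕ
  tape : Fin M.tapes → ℕ → M.Work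
  head : Fin M.tapes → ℕ
  output : List β

/-- The input tape for the word `w`: position `0` holds the left end marker, positions
`1, …, |w|` hold `w`, and position `|w| + 1` holds the right end marker. -/
def scan (w : List α) : ℕ → InputCell α
  | 0 => .leftEnd
  | p + 1 => match w[p]? with
    | some a => .symbol a
    | none => .rightEnd

/-- The input head never leaves the positions `0, …, |w| + 1`. -/
def moveInput (w : List α) (p : ℕ) : Move → ℕ
  | .left => p - 1
  | .stay => p
  | .right => min (p + 1) (w.length + 1)

/-- The cells of a work tape are numbered by `ℕ`; a left move from cell `0` has no effect. -/
def moveWork (p : ℕ) : Move → ℕ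
  | .left => p - 1
  | .stay => p
  | .right => p + 1

/-- The initial configuration: blank work tapes, all heads at position `0`, empty output. -/
def init (M : Transducer α β) : M.Config where
  state := M.start
  inputPos := 0
  tape := fun _ _ => M.blank
  head := fun _ => 0
  output := []

/-- One step of `M` on the input word `w`; `none` if `M` halts. -/
def step (M : Transducer α β) (w : List α) (c : M.Config) : Option M.Config :=
  (M.transition c.state (scan w c.inputPos) (fun i => c.tape i (c.head i))).map fun a =>
    { state := a.next
      inputPos := moveInput w c.inputPos a.inputMove
      tape := fun i => Function.update (c.tape i) (c.head i) (a.write i)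
      head := fun i => moveWork (c.head i) (a.workMove i)
      output := c.output ++ a.emit.toList }

/-- `c` occurs in the computation of `M` on the input word `w`. -/
def Reachable (M : Transducer α β) (w : List α) (c : M.Config) : Prop :=
  StateTransition.Reaches (M.step w) M.init c

/-- On every input word `w`, `M` halts with output `f w`. -/
def Computes (M : Transducer α β) (f : List α → List β) : Prop :=
  ∀ w, ∃ c, M.Reachable w c ∧ M.step w c = none ∧ c.output = f w

/-- On every input word, `M` visits at most the first `O(log |w|)` cells of each work tape. -/
def RunsInLogspace (M : Transducer α β) : Prop :=
  ∃ k : ℕ, ∀ w c, M.Reachable w c → ∀ i, c.head i < k * (Nat.log 2 w.length + 1)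

end Transducer

/-- `f` is computed by a deterministic Turing machine in logarithmic work space. -/
def LogspaceComputable {α β : Type*} [Finite α] [Finite β] (f : List α → List β) : Prop :=
  ∃ M : Transducer α β, M.Computes f ∧ M.RunsInLogspace

end Logspace

/-! ### Encodings of semiring elements and matrices -/

/-- An encoding, by words over the alphabet `Γ`, of certain elements of `K`, among them
`0` and `1`; the value of `encode` outside `carrier` is irrelevant. -/
structure ElementEncoding (K : Type*) [Zero K] [One K] (Γ : Type*) where
  carrier : Set K
  zero_mem : 0 ∈ carrier
  one_mem : 1 ∈ carrier
  encode : K → List Γ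
  injOn_encode : Set.InjOn encode carrier

/-- The delimiters and operation symbols used to write tensor formulas. -/
inductive Delimiter where
  | lbracket
  | rbracket
  | lparen
  | rparen
  | plus
  | times
  | otimes

instance : Finite Delimiter :=
  Finite.of_surjective
    ![Delimiter.lbracket, .rbracket, .lparen, .rparen, .plus, .times, .otimes] fun d => by
    cases d
    exacts [⟨0, rfl⟩, ⟨1, rfl⟩, ⟨2, rfl⟩, ⟨3, rfl⟩, ⟨4, rfl⟩, ⟨5, rfl⟩, ⟨6, rfl⟩]

/-- The alphabet for tensor formulas: `Γ ∪ {[, ], (, ), +, ·, ⊗}`. -/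
abbrev FormulaSymbol (Γ : Type*) : Type _ := Γ ⊕ Delimiter

/-- The word `[w]`. -/
def bracket {Γ : Type*} (w : List (FormulaSymbol Γ)) : List (FormulaSymbol Γ) :=
  .inr .lbracket :: w ++ [.inr .rbracket]

/-- A matrix is written as the list of its rows, a row as the list of its entries, each list
and the code of each entry being enclosed in brackets. -/
def matrixCode {K Γ : Type*} (enc : K → List Γ) {k l : ℕ} (A : Matrix (Fin k) (Fin l) K) :
    List (FormulaSymbol Γ) :=
  bracket <| (List.finRange k).flatMap fun i =>
    bracket <| (List.finRange l).flatMap fun j => bracket <| (enc (A i j)).map Sum.inl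

/-! ### Tensor formulas -/

/-- `TensorFormula K k l` is the type of tensor formulas over `K` of order `k × l`. -/
inductive TensorFormula (K : Type*) : ℕ → ℕ → Type _ where
  | atom {k l : ℕ} (hk : 0 < k) (hl : 0 < l) (A : Matrix (Fin k) (Fin l) K) : TensorFormula K k l
  | add {k l : ℕ} (F G : TensorFormula K k l) : TensorFormula K k l
  | mul {k m l : ℕ} (F : TensorFormula K k m) (G : TensorFormula K m l) : TensorFormula K k l
  | tensor {k l m n : ℕ} (F : TensorFormula K k l) (G : TensorFormula K m n) :
      TensorFormula K (k * m) (l * n)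

namespace TensorFormula

variable {K : Type*}

/-- The value of a tensor formula. The bijection `finProdFinEquiv` sends `(q, s)`, for
`s : Fin m`, to `m * q + s`, as in the usual block form of the Kronecker product. -/
def value [Semiring K] {k l : ℕ} : TensorFormula K k l → Matrix (Fin k) (Fin l) K
  | .atom _ _ A => A
  | .add F G => F.value + G.value
  | .mul F G => F.value * G.value
  | .tensor F G =>
      (Matrix.kroneckerMap (· * ·) F.value G.value).submatrix
        finProdFinEquiv.symm finProdFinEquiv.symm

/-- The maximal distance between the root and a leaf. -/
def depth {k l : ℕ} : TensorFormula K k l → ℕ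
  | .atom _ _ _ => 0
  | .add F G => max F.depth G.depth + 1
  | .mul F G => max F.depth G.depth + 1
  | .tensor F G => max F.depth G.depth + 1

/-- All entries of the atomic subformulas belong to `S`. -/
def EntriesIn (S : Set K) {k l : ℕ} : TensorFormula K k l → Prop
  | .atom _ _ A => ∀ i j, A i j ∈ S
  | .add F G => F.EntriesIn S ∧ G.EntriesIn S
  | .mul F G => F.EntriesIn S ∧ G.EntriesIn S
  | .tensor F G => F.EntriesIn S ∧ G.EntriesIn S

/-- The word `(u ∘ v)`. -/
def binaryCode {Γ : Type*} (op : Delimiter) (u v : List (FormulaSymbol Γ)) :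
    List (FormulaSymbol Γ) :=
  .inr .lparen :: u ++ .inr op :: v ++ [.inr .rparen]

/-- The fully parenthesized word that describes a tensor formula. -/
def code {Γ : Type*} (enc : K → List Γ) {k l : ℕ} :
    TensorFormula K k l → List (FormulaSymbol Γ)
  | .atom _ _ A => matrixCode enc A
  | .add F G => binaryCode .plus (F.code enc) (G.code enc)
  | .mul F G => binaryCode .times (F.code enc) (G.code enc)
  | .tensor F G => binaryCode .otimes (F.code enc) (G.code enc)

/-- The `2 × 1` column vector whose entry at (zero-based) position `b` is `1`,
the other one being `0`. -/
def bitVector [Semiring K] (b : Fin 2) : TensorFormula K 2 1 :=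
  .atom Nat.two_pos Nat.one_pos (fun i _ => if i = b then 1 else 0)

/-- The tensor product `χ₁ ⊗ ⋯ ⊗ χₙ` of the vectors `bitVector (x i)`, the empty tensor
product being the `1 × 1` identity matrix. -/
def basisVector [Semiring K] : (n : ℕ) → (Fin n → Fin 2) → TensorFormula K (2 ^ n) 1
  | 0, _ => .atom Nat.one_pos Nat.one_pos 1
  | n + 1, x => .tensor (basisVector n fun i => x i.castSucc) (bitVector (x (Fin.last n)))

end TensorFormula

/-! ### Gate arrays -/

/-- The position of a bit vector in the list `0⋯00, 0⋯01, …, 1⋯11`: the first bit is the most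
significant one. -/
def bitIndex (k : ℕ) : (Fin k → Fin 2) ≃ Fin (2 ^ k) :=
  (Equiv.arrowCongr Fin.revPerm (Equiv.refl (Fin 2))).trans finFunctionFinEquiv

/-- A gate on a level of an array of `n` wires: it involves the distinct wires
`wires 0, wires 1, …`, which need not be adjacent, and the rows and columns of its matrix are
indexed by the bit vectors on these wires, in the order `0⋯00, 0⋯01, …, 1⋯11`. -/
structure Gate (K : Type*) (n : ℕ) where
  arity : ℕ
  arity_pos : 0 < arity
  wires : Fin arity ↪ Fin n
  matrix : Matrix (Fin (2 ^ arity)) (Fin (2 ^ arity)) K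

/-- A gate array on `n` wires, given by its levels from left to right. The gates on a level act
on disjoint sets of wires; a wire involved in no gate of a level is left unchanged there. -/
structure GateArray (K : Type*) (n : ℕ) where
  width_pos : 0 < n
  levels : List (List (Gate K n))
  levels_ne_nil : levels ≠ []
  disjoint : ∀ L ∈ levels,
    L.Pairwise fun g h => Disjoint (Set.range g.wires) (Set.range h.wires)

/-- Orthogonality with respect to the involution `star` on `K`: for the identity involution the
condition is `Mᵀ M = M Mᵀ = 1`, for complex conjugation it says that `M` is unitary. -/
def IsOrthogonalMatrix {K : Type*} [Semiring K] [InvolutiveStar K] {ι : Type*} [Fintype ι]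
    [DecidableEq ι] (M : Matrix ι ι K) : Prop :=
  Mᴴ * M = 1 ∧ M * Mᴴ = 1

open Classical in
/-- The action of a level on the `n` wires. The entry for `y`, `z` is the product of the
corresponding entries of the gates, and is `0` if `y` and `z` differ on an unused wire.
(If `K` is not commutative, the product is taken in the order in which the gates are listed.) -/
noncomputable def levelMatrix {K : Type*} [Semiring K] {n : ℕ} (L : List (Gate K n)) :
    Matrix (Fin n → Fin 2) (Fin n → Fin 2) K := fun y z =>
  if ∀ i, (∀ g ∈ L, i ∉ Set.range g.wires) → y i = z i then
    (L.map fun g => g.matrix (bitIndex _ (y ∘ g.wires)) (bitIndex _ (z ∘ g.wires))).prod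
  else 0

/-- The alphabet for gate arrays: that of tensor formulas, and a symbol for unary numbers. -/
abbrev ArraySymbol (Γ : Type*) : Type _ := FormulaSymbol Γ ⊕ Unit

/-- The number `m` in unary. -/
def unary {Γ : Type*} (m : ℕ) : List (ArraySymbol Γ) := List.replicate m (.inr ())

/-- A gate is written as `(w₁)`, the list of its wires, followed by its matrix; each wire is
written as `[m]`, where `m` is its (zero-based) number in unary. -/
def Gate.code {K Γ : Type*} (enc : K → List Γ) {n : ℕ} (g : Gate K n) : List (ArraySymbol Γ) :=
  .inl (.inr .lparen) ::
    ((List.finRange g.arity).flatMap fun j =>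
      .inl (.inr .lbracket) :: unary (g.wires j : ℕ) ++ [.inl (.inr .rbracket)]) ++
    .inl (.inr .rparen) :: (matrixCode enc g.matrix).map Sum.inl

namespace GateArray

variable {K : Type*} {n : ℕ}

/-- The number of entries of the array: wires times levels. -/
def size (C : GateArray K n) : ℕ := n * C.levels.length

/-- The amplitudes of the output bit vectors when the array is run, from its first level to its
last, on the input bits `x`. -/
noncomputable def amplitude [Semiring K] (C : GateArray K n) (x : Fin n → Fin 2) :
    (Fin n → Fin 2) → K :=
  C.levels.foldl (fun v L => levelMatrix L *ᵥ v) (Pi.single x 1)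

/-- The output `C(x)` as a column vector of size `2 ^ n`. -/
noncomputable def output [Semiring K] (C : GateArray K n) (x : Fin n → Fin 2) :
    Matrix (Fin (2 ^ n)) (Fin 1) K :=
  fun i _ => C.amplitude x ((bitIndex n).symm i)

/-- All gates of the array have orthogonal matrices. -/
def IsOrthogonal [Semiring K] [InvolutiveStar K] (C : GateArray K n) : Prop :=
  ∀ L ∈ C.levels, ∀ g ∈ L, IsOrthogonalMatrix g.matrix

/-- All entries of the gates of the array belong to `S`. -/
def EntriesIn (S : Set K) (C : GateArray K n) : Prop :=
  ∀ L ∈ C.levels, ∀ g ∈ L, ∀ i j, g.matrix i j ∈ S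

/-- The word that describes a gate array: the number of wires in unary, followed by the levels,
each being written as the bracketed list of its gates. -/
def code {Γ : Type*} (enc : K → List Γ) (C : GateArray K n) : List (ArraySymbol Γ) :=
  unary n ++ C.levels.flatMap fun L =>
    .inl (.inr .lbracket) :: L.flatMap (Gate.code enc) ++ [.inl (.inr .rbracket)]

end GateArray

set_option linter.unusedVariables false
set_option linter.unusedSectionVars false

/-! The proof has an algebraic half, a shallow formula for the array, and a computational half, a
logspace machine that writes this formula.

The formula. A gate with matrix `G` on the wires `w` acts on `n` bits by the matrix with entries `G
(y ∘ w) (z ∘ w)` times the indicator that `y` and `z` agree off `w`. To avoid permuting wires, `k`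
auxiliary bits are put in front of the `n` bits, where `k` is the arity. Let `link` be the diagonal
0/1 matrix that selects the vectors whose auxiliary bit number `j` equals bit `w j`, for all `j`; it
is a product of `k` factors of the form `P₀ ⊗ P₀ + P₁ ⊗ P₁`, where `P_b` projects one chosen bit to
the value `b`. If `row` and `col` consist of ones, `(row ⊗ I) · link` is the graph of `y ↦ (y ∘ w,
y)`, and `link · (col ⊗ I)` is its transpose. Between them stands `G ⊗ fresh`, where `fresh` is a
tensor product of `2 × 2` matrices: identities off `w` and all-ones matrices on `w`. The result is
the matrix of the gate (`denotes_gateWord`). In the sums that occur in these products and in the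
splitting of a level only one term can survive, and factors are never interchanged; so the argument
works over every semiring and needs no entries besides `0`, `1` and those of the gates.

The gates on one level have disjoint wires, so a level is the product of its gates in the listed
order (`levelMatrix_cons`), and the array is the product of all its gates, the last level standing
first. All products and tensor products are written as complete binary trees of one height `h`,
filled up with identities or with the `1 × 1` matrix `1`. Here `2 ^ h` is at most about twice the
number of wires plus the number of gates, and a level has at most `n` gates; so `h` is `log (n d) +
O(1)`, and the total depth is at most `3 h + 6` (`denotes_productWord`).

The machine. The word of a complete tree can be written leaf by leaf without a stack: between leaf
`i` and the next one stand `t` closing parentheses, the operation and `t` opening ones, where `t` is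
the number of trailing ones of `i` in binary (`treeWord_eq`). All else consists of nested loops over
positions and counters, in which parts of the input are found again whenever they are needed, by
counting brackets (`exec_bracketScan`). These loops are expressed in a small language, `Program`,
whose registers are the tracks of one work tape of width `ℓ`; `compile_goes` proves its translation
into machines correct, and `measure` finds a width that is logarithmic in the input length.
`exec_main` identifies the output with the word of the formula. -/

namespace Logspace

open Transducer

/-! ### Machine fragments -/

/-- The contents of a cell of the work tape: blank, or a column with one bit for each register
(`none` is a scratch register), together with a mark that distinguishes the first cell. -/
abbrev TapeCell (R : Type) := Option (Bool × (Option R → Bool))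

/-- The flag carries one bit from a fragment to the next: tests return their answer in it, and
increments report overflow. -/
structure FragmentAction (P R : Type) (β : Type*) where
  pc : Option P
  flag : Bool
  inputMove : Move
  write : TapeCell R
  workMove : Move
  emit : Option β

/-- A part of a machine with one work tape: it has one entry point, and it is left when the
program counter becomes `none`. -/
structure Fragment (R : Type) (α β : Type*) where
  PC : Type
  finite_pc : Finite PC
  entry : PC
  next : PC → Bool → InputCell α → TapeCell R → FragmentAction PC R β

structure FragmentConfig (P R : Type) (β : Type*) where
  pc : Option P
  flag : Bool
  pos : ℕ
  tape : ℕ → TapeCell R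
  head : ℕ
  out : List β

variable {R : Type} {α β : Type*} [Finite α] [Finite β]

namespace Fragment

def step (F : Fragment R α β) (w : List α) (c : FragmentConfig F.PC R β) :
    Option (FragmentConfig F.PC R β) :=
  c.pc.map fun p =>
    let a := F.next p c.flag (scan w c.pos) (c.tape c.head)
    { pc := a.pc
      flag := a.flag
      pos := moveInput w c.pos a.inputMove
      tape := Function.update c.tape c.head a.write
      head := moveWork c.head a.workMove
      out := c.out ++ a.emit.toList }

/-- A computation during which the work tape head stays in the cells `0, …, B`. -/
def Path (F : Fragment R α β) (w : List α) (B : ℕ) :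
    FragmentConfig F.PC R β → FragmentConfig F.PC R β → Prop :=
  Relation.ReflTransGen fun c c' => F.step w c = some c' ∧ c.head ≤ B

/-- Simulation along a translation `e` of program counters. The exit `none` of `F` may be sent into
the interior of `G`, and `e` depends on the flag because a loop decides by the flag, when its body
is left, whether to start again. -/
theorem Path.lift {F G : Fragment R α β} (e : Option F.PC → Bool → Option G.PC)
    (he : ∀ p b x t, ∃ p', e (some p) b = some p' ∧
      G.next p' b x t =
        { pc := e (F.next p b x t).pc (F.next p b x t).flag
          flag := (F.next p b x t).flag
          inputMove := (F.next p b x t).inputMove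
          write := (F.next p b x t).write
          workMove := (F.next p b x t).workMove
          emit := (F.next p b x t).emit })
    {w : List α} {B : ℕ} {c c' : FragmentConfig F.PC R β} (h : F.Path w B c c') :
    G.Path w B ⟨e c.pc c.flag, c.flag, c.pos, c.tape, c.head, c.out⟩
      ⟨e c'.pc c'.flag, c'.flag, c'.pos, c'.tape, c'.head, c'.out⟩ := by
  refine Relation.ReflTransGen.lift (fun c : FragmentConfig F.PC R β =>
    (⟨e c.pc c.flag, c.flag, c.pos, c.tape, c.head, c.out⟩ : FragmentConfig G.PC R β)) ?_ _ _ h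
  rintro ⟨pc, flag, pos, tape, head, out⟩ c₂ ⟨hs, hB⟩
  cases pc with
  | none => simp [step] at hs
  | some p =>
    obtain ⟨p', h1, h2⟩ := he p flag (scan w pos) (tape head)
    simp only [step, Option.map_some, Option.some.injEq] at hs
    subst hs
    refine ⟨?_, hB⟩
    simp only [step, h1, h2, Option.map_some]

theorem Path.trans {F : Fragment R α β} {w : List α} {B : ℕ}
    {c₁ c₂ c₃ : FragmentConfig F.PC R β} (h : F.Path w B c₁ c₂) (h' : F.Path w B c₂ c₃) :
    F.Path w B c₁ c₃ :=
  Relation.ReflTransGen.trans h h'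

theorem Path.head {F : Fragment R α β} {w : List α} {B : ℕ}
    {c₁ c₂ c₃ : FragmentConfig F.PC R β} (h : F.step w c₁ = some c₂) (hB : c₁.head ≤ B)
    (h' : F.Path w B c₂ c₃) : F.Path w B c₁ c₃ :=
  Relation.ReflTransGen.head ⟨h, hB⟩ h'

theorem Path.single {F : Fragment R α β} {w : List α} {B : ℕ} {c c' : FragmentConfig F.PC R β}
    (h : F.step w c = some c') (hB : c.head ≤ B) : F.Path w B c c' :=
  Relation.ReflTransGen.single ⟨h, hB⟩

end Fragment

/-! ### Stores -/

/-- What a fragment works on, apart from the width of the tape. -/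
structure Store (R : Type) (β : Type*) where
  flag : Bool
  pos : ℕ
  reg : Option R → ℕ
  out : List β

/-- The tape of width `ℓ` whose tracks hold the binary expansions of the registers. -/
def tapeOf (ℓ : ℕ) (reg : Option R → ℕ) (i : ℕ) : TapeCell R :=
  if i < ℓ then some (decide (i = 0), fun r => (reg r).testBit i) else none

namespace Fragment

/-- Between fragments the work head rests on cell `0` and the tape has the normal form `tapeOf`, so
fragments compose as soon as their stores and widths agree. -/
def config (F : Fragment R α β) (pc : Option F.PC) (ℓ : ℕ) (s : Store R β) :
    FragmentConfig F.PC R β :=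
  ⟨pc, s.flag, s.pos, tapeOf ℓ s.reg, 0, s.out⟩

/-- The fragment transforms the store `s` into the store `s'`. -/
def Goes (F : Fragment R α β) (w : List α) (B ℓ : ℕ) (s : Store R β) (ℓ' : ℕ) (s' : Store R β) :
    Prop :=
  F.Path w B (F.config (some F.entry) ℓ s) (F.config none ℓ' s')

/-! ### Combinators -/

def seq (F G : Fragment R α β) : Fragment R α β where
  PC := F.PC ⊕ G.PC
  finite_pc := have := F.finite_pc; have := G.finite_pc; inferInstance
  entry := .inl F.entry
  next p b x t := match p with
    | .inl p =>
      let a := F.next p b x t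
      ⟨some (a.pc.elim (.inr G.entry) .inl), a.flag, a.inputMove, a.write, a.workMove, a.emit⟩
    | .inr p =>
      let a := G.next p b x t
      ⟨a.pc.map .inr, a.flag, a.inputMove, a.write, a.workMove, a.emit⟩

theorem seq_path_left (F G : Fragment R α β) {w : List α} {B : ℕ}
    {c c' : FragmentConfig F.PC R β} (h : F.Path w B c c') :
    (F.seq G).Path w B
      ⟨some (c.pc.elim (.inr G.entry) .inl), c.flag, c.pos, c.tape, c.head, c.out⟩
      ⟨some (c'.pc.elim (.inr G.entry) .inl), c'.flag, c'.pos, c'.tape, c'.head, c'.out⟩ :=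
  h.lift (G := F.seq G) (fun p _ => some (p.elim (.inr G.entry) .inl)) fun p b x t =>
    ⟨.inl p, rfl, rfl⟩

theorem seq_path_right (F G : Fragment R α β) {w : List α} {B : ℕ}
    {c c' : FragmentConfig G.PC R β} (h : G.Path w B c c') :
    (F.seq G).Path w B ⟨c.pc.map .inr, c.flag, c.pos, c.tape, c.head, c.out⟩
      ⟨c'.pc.map .inr, c'.flag, c'.pos, c'.tape, c'.head, c'.out⟩ :=
  h.lift (G := F.seq G) (fun p _ => p.map .inr) fun p b x t => ⟨.inr p, rfl, rfl⟩

theorem Goes.seq {F G : Fragment R α β} {w : List α} {B ℓ₁ ℓ₂ ℓ₃ : ℕ} {s₁ s₂ s₃ : Store R β}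
    (hF : F.Goes w B ℓ₁ s₁ ℓ₂ s₂) (hG : G.Goes w B ℓ₂ s₂ ℓ₃ s₃) :
    (F.seq G).Goes w B ℓ₁ s₁ ℓ₃ s₃ :=
  Path.trans (seq_path_left F G hF) (seq_path_right F G hG)

/-- Continue with `F` if the flag is set, and with `G` otherwise. -/
def cond (F G : Fragment R α β) : Fragment R α β where
  PC := Option (F.PC ⊕ G.PC)
  finite_pc := have := F.finite_pc; have := G.finite_pc; inferInstance
  entry := none
  next p b x t := match p with
    | none => ⟨some (some (if b then .inl F.entry else .inr G.entry)), b, .stay, t, .stay, none⟩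
    | some (.inl p) =>
      let a := F.next p b x t
      ⟨a.pc.map fun p => some (.inl p), a.flag, a.inputMove, a.write, a.workMove, a.emit⟩
    | some (.inr p) =>
      let a := G.next p b x t
      ⟨a.pc.map fun p => some (.inr p), a.flag, a.inputMove, a.write, a.workMove, a.emit⟩

theorem Goes.cond_true {F G : Fragment R α β} {w : List α} {B ℓ₁ ℓ₂ : ℕ} {s₁ s₂ : Store R β}
    (hb : s₁.flag = true) (hF : F.Goes w B ℓ₁ s₁ ℓ₂ s₂) :
    (F.cond G).Goes w B ℓ₁ s₁ ℓ₂ s₂ := by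
  refine Path.head ?_ (Nat.zero_le _)
    (Path.lift (G := F.cond G) (fun p _ => p.map fun p => some (.inl p))
      (fun p b x t => ⟨some (.inl p), rfl, rfl⟩) hF)
  simp [step, config, cond, hb, moveInput, moveWork]

theorem Goes.cond_false {F G : Fragment R α β} {w : List α} {B ℓ₁ ℓ₂ : ℕ} {s₁ s₂ : Store R β}
    (hb : s₁.flag = false) (hG : G.Goes w B ℓ₁ s₁ ℓ₂ s₂) :
    (F.cond G).Goes w B ℓ₁ s₁ ℓ₂ s₂ := by
  refine Path.head ?_ (Nat.zero_le _)
    (Path.lift (G := F.cond G) (fun p _ => p.map fun p => some (.inr p))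
      (fun p b x t => ⟨some (.inr p), rfl, rfl⟩) hG)
  simp [step, config, cond, hb, moveInput, moveWork]

/-- Repeat `F` until the flag is set. -/
def loopUntil (F : Fragment R α β) : Fragment R α β where
  PC := F.PC
  finite_pc := F.finite_pc
  entry := F.entry
  next p b x t :=
    let a := F.next p b x t
    ⟨a.pc.elim (if a.flag then none else some F.entry) some,
      a.flag, a.inputMove, a.write, a.workMove, a.emit⟩

theorem until_path (F : Fragment R α β) {w : List α} {B : ℕ}
    {c c' : FragmentConfig F.PC R β} (h : F.Path w B c c') :
    F.loopUntil.Path w B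
      ⟨c.pc.elim (if c.flag then none else some F.entry) some,
        c.flag, c.pos, c.tape, c.head, c.out⟩
      ⟨c'.pc.elim (if c'.flag then none else some F.entry) some,
        c'.flag, c'.pos, c'.tape, c'.head, c'.out⟩ :=
  Path.lift (F := F) (G := F.loopUntil) (fun p b => p.elim (if b then none else some F.entry) some)
    (fun p b x t => ⟨p, rfl, rfl⟩) h

theorem Goes.until_true {F : Fragment R α β} {w : List α} {B ℓ₁ ℓ₂ : ℕ} {s₁ s₂ : Store R β}
    (hF : F.Goes w B ℓ₁ s₁ ℓ₂ s₂) (hb : s₂.flag = true) : F.loopUntil.Goes w B ℓ₁ s₁ ℓ₂ s₂ := by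
  obtain ⟨flag, pos, reg, out⟩ := s₂
  obtain rfl : flag = true := hb
  exact until_path F hF

theorem Goes.until_false {F : Fragment R α β} {w : List α} {B ℓ₁ ℓ₂ ℓ₃ : ℕ}
    {s₁ s₂ s₃ : Store R β} (hF : F.Goes w B ℓ₁ s₁ ℓ₂ s₂) (hb : s₂.flag = false)
    (h : F.loopUntil.Goes w B ℓ₂ s₂ ℓ₃ s₃) : F.loopUntil.Goes w B ℓ₁ s₁ ℓ₃ s₃ := by
  obtain ⟨flag, pos, reg, out⟩ := s₂
  obtain rfl : flag = false := hb
  exact Path.trans (until_path F hF) h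

/-! ### Elementary fragments -/

def act (f : Bool → InputCell α → Bool × Move × Option β) : Fragment R α β where
  PC := Unit
  finite_pc := inferInstance
  entry := ()
  next _ b x t := ⟨none, (f b x).1, (f b x).2.1, t, .stay, (f b x).2.2⟩

theorem act_goes (f : Bool → InputCell α → Bool × Move × Option β) (w : List α) (B ℓ : ℕ)
    (s : Store R β) :
    (act f).Goes w B ℓ s ℓ
      ⟨(f s.flag (scan w s.pos)).1, moveInput w s.pos (f s.flag (scan w s.pos)).2.1, s.reg,
        s.out ++ (f s.flag (scan w s.pos)).2.2.toList⟩ := by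
  refine Path.single ?_ (Nat.zero_le _)
  simp [step, config, act, moveWork]

/-- Move to the first cell of the work tape. -/
def rewind : Fragment R α β where
  PC := Unit
  finite_pc := inferInstance
  entry := ()
  next _ b _ t := match t with
    | some (false, _) => ⟨some (), b, .stay, t, .left, none⟩
    | _ => ⟨none, b, .stay, t, .stay, none⟩

theorem rewind_path (w : List α) {B ℓ i : ℕ} (hi : i < ℓ) (hB : ℓ ≤ B) (s : Store R β) :
    (rewind (R := R) (α := α)).Path w B ⟨some (), s.flag, s.pos, tapeOf ℓ s.reg, i, s.out⟩
      (rewind.config none ℓ s) := by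
  induction i with
  | zero =>
    refine Path.single ?_ (Nat.zero_le _)
    simp [step, config, rewind, tapeOf, hi, moveInput, moveWork]
  | succ i ih =>
    refine Path.head ?_ (by dsimp only; omega) (ih (by omega))
    simp [step, rewind, tapeOf, hi, moveInput, moveWork]

/-- Run over the work tape, from the first cell to the first blank one, and rewrite register `d`. -/
def sweepRight [DecidableEq R] (d : Option R)
    (f : Bool → (Option R → Bool) → Bool × Bool × Option β) : Fragment R α β where
  PC := Unit
  finite_pc := inferInstance
  entry := ()
  next _ b _ t := match t with
    | some (m, v) =>
      ⟨some (), (f b v).1, .stay, some (m, Function.update v d (f b v).2.1), .right, (f b v).2.2⟩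
    | none => ⟨none, b, .stay, none, .left, none⟩

/-- The final flag, the new value of the rewritten register, and the output of a sweep. -/
def _root_.Logspace.sweepResult {ι : Type*} {β : Type*}
    (f : Bool → (ι → Bool) → Bool × Bool × Option β) :
    ℕ → Bool → (ι → ℕ) → Bool × ℕ × List β
  | 0, b, _ => (b, 0, [])
  | ℓ + 1, b, reg =>
    let a := f b fun r => (reg r).testBit 0
    let c := sweepResult f ℓ a.1 fun r => reg r / 2
    (c.1, Nat.bit a.2.1 c.2.1, a.2.2.toList ++ c.2.2)

theorem _root_.Logspace.sweepResult_lt {ι : Type*}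
    (f : Bool → (ι → Bool) → Bool × Bool × Option β) (ℓ : ℕ) (b : Bool) (reg : ι → ℕ) : (sweepResult f ℓ b reg).2.1 < 2 ^ ℓ := by
  induction ℓ generalizing b reg with
  | zero => simp [sweepResult]
  | succ ℓ ih =>
    simp only [sweepResult, pow_succ, Nat.bit_val]
    have h := ih (f b fun r => (reg r).testBit 0).1 fun r => reg r / 2
    have h1 : (f b fun r => (reg r).testBit 0).2.1.toNat ≤ 1 := Bool.toNat_le _
    omega

/-- Cell `j` holds the bits of weight `2 ^ j`, so a sweep meets the least significant bits first.
Induction on the number `m` of cells still to be read: from cell `i` on the tape is untouched, and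
what will be written there depends only on the quotients by `2 ^ i`. Below `i` the tape `T` is
arbitrary, as it has been rewritten already. -/
theorem sweepRight_path [DecidableEq R] (d : Option R)
    (f : Bool → (Option R → Bool) → Bool × Bool × Option β) (w : List α) {B ℓ : ℕ}
    (reg : Option R → ℕ) (hB : ℓ ≤ B) (pos m i : ℕ) (hi : i + m = ℓ) (b : Bool)
    (T : ℕ → TapeCell R) (hT : ∀ j, i ≤ j → T j = tapeOf ℓ reg j) (out : List β) :
    (sweepRight (R := R) (α := α) d f).Path w B ⟨some (), b, pos, T, i, out⟩
      ⟨none, (sweepResult f m b fun r => reg r / 2 ^ i).1, pos,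
        fun j => if j < i then T j else if j < ℓ then
          some (decide (j = 0), Function.update (fun r => (reg r).testBit j) d
            ((sweepResult f m b fun r => reg r / 2 ^ i).2.1.testBit (j - i))) else none,
        ℓ - 1, out ++ (sweepResult f m b fun r => reg r / 2 ^ i).2.2⟩ := by
  induction m generalizing i b T out with
  | zero =>
    obtain rfl : i = ℓ := by omega
    refine Path.single ?_ hB
    have h0 : T i = none := by rw [hT _ le_rfl]; simp [tapeOf]
    simp only [step, sweepRight, h0, Option.map_some, sweepResult, moveInput, moveWork,
      Option.toList_none, Option.some.injEq, FragmentConfig.mk.injEq, true_and, and_true]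
    funext j
    by_cases hj : j < i
    · simp [hj, Function.update_of_ne hj.ne]
    · rcases eq_or_ne j i with rfl | hne
      · simp
      · rw [Function.update_of_ne hne, hT _ (by omega)]; simp [tapeOf, hj]
  | succ m ih =>
    have hiℓ : i < ℓ := by omega
    have h0 : T i = some (decide (i = 0), fun r => (reg r).testBit i) := by
      rw [hT _ le_rfl]; simp [tapeOf, hiℓ]
    set a := f b fun r => (reg r).testBit i with ha
    have hbit : (fun r => (reg r / 2 ^ i).testBit 0) = fun r => (reg r).testBit i := by
      funext r; rw [Nat.testBit_div_two_pow, Nat.zero_add]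
    have hdiv : (fun r => reg r / 2 ^ i / 2) = fun r => reg r / 2 ^ (i + 1) := by
      funext r; rw [Nat.div_div_eq_div_mul, pow_succ]
    refine Path.head (c₂ := ⟨some (), a.1, pos, Function.update T i
      (some (decide (i = 0), Function.update (fun r => (reg r).testBit i) d a.2.1)), i + 1,
      out ++ a.2.2.toList⟩) ?_ (by dsimp only; omega) ?_
    · simp [step, sweepRight, h0, moveInput, moveWork, ha]
    · have := ih (i + 1) (by omega) a.1 (Function.update T i
        (some (decide (i = 0), Function.update (fun r => (reg r).testBit i) d a.2.1)))
        (fun j hj => by rw [Function.update_of_ne (by omega), hT _ (by omega)])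
        (out ++ a.2.2.toList)
      convert this using 2
      · simp only [sweepResult, hbit, hdiv, ha]
      · funext j
        simp only [sweepResult, hbit, hdiv, ← ha]
        rcases lt_trichotomy j i with hj | rfl | hj
        · simp [hj, hj.trans (Nat.lt_succ_self i), Function.update_of_ne hj.ne]
        · simp [hiℓ]
        · have e : j - i = (j - (i + 1)) + 1 := by omega
          simp only [show ¬ j < i by omega, show ¬ j < i + 1 by omega, if_false, e,
            Nat.testBit_bit_succ]
      · simp only [sweepResult, hbit, hdiv, ← ha, List.append_assoc]

def sweep [DecidableEq R] (d : Option R)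
    (f : Bool → (Option R → Bool) → Bool × Bool × Option β) : Fragment R α β :=
  (sweepRight d f).seq rewind

theorem sweep_goes [DecidableEq R] (d : Option R)
    (f : Bool → (Option R → Bool) → Bool × Bool × Option β) (w : List α) {B ℓ : ℕ} (hℓ : 0 < ℓ)
    (hB : ℓ ≤ B) (s : Store R β) :
    (sweep (α := α) d f).Goes w B ℓ s ℓ
      ⟨(sweepResult f ℓ s.flag s.reg).1, s.pos,
        Function.update s.reg d (sweepResult f ℓ s.flag s.reg).2.1,
        s.out ++ (sweepResult f ℓ s.flag s.reg).2.2⟩ := by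
  have h1 := sweepRight_path (α := α) d f w s.reg hB s.pos ℓ 0 (by omega) s.flag
    (tapeOf ℓ s.reg) (fun _ _ => rfl) s.out
  have h2 := rewind_path (α := α) w (i := ℓ - 1) (by omega) hB
    ⟨(sweepResult f ℓ s.flag s.reg).1, s.pos,
        Function.update s.reg d (sweepResult f ℓ s.flag s.reg).2.1,
        s.out ++ (sweepResult f ℓ s.flag s.reg).2.2⟩
  simp only [pow_zero, Nat.div_one] at h1
  have e : (fun j => if j < 0 then tapeOf ℓ s.reg j else if j < ℓ then
      some (decide (j = 0), Function.update (fun r => (s.reg r).testBit j) d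
        ((sweepResult f ℓ s.flag s.reg).2.1.testBit (j - 0))) else none) =
      tapeOf ℓ (Function.update s.reg d (sweepResult f ℓ s.flag s.reg).2.1) := by
    funext j
    simp only [tapeOf, Nat.not_lt_zero, if_false, Nat.sub_zero]
    refine if_congr Iff.rfl (congrArg some (Prod.ext rfl ?_)) rfl
    funext r
    rcases eq_or_ne r d with rfl | hr
    · simp
    · simp [Function.update_of_ne hr]
  rw [e] at h1
  exact Path.trans (seq_path_left (sweepRight d f) rewind h1)
    (seq_path_right (sweepRight d f) rewind h2)

/-- Start the work tape with a single cell. -/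
def mark : Fragment R α β where
  PC := Unit
  finite_pc := inferInstance
  entry := ()
  next _ b _ _ := ⟨none, b, .stay, some (true, fun _ => false), .stay, none⟩

theorem mark_goes (w : List α) (B : ℕ) (s : Store R β) (hs : s.reg = fun _ => 0) :
    (mark (R := R) (α := α)).Goes w B 0 s 1 s := by
  refine Path.single ?_ (Nat.zero_le _)
  simp only [step, config, mark, moveInput, moveWork, Option.map_some, Option.toList_none,
    List.append_nil, Option.some.injEq, FragmentConfig.mk.injEq, true_and, and_true, hs]
  funext j
  rcases eq_or_ne j 0 with rfl | hj
  · simp [tapeOf]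
  · rw [Function.update_of_ne hj]; simp [tapeOf, hj]

def growRight : Fragment R α β where
  PC := Unit
  finite_pc := inferInstance
  entry := ()
  next _ b _ t := match t with
    | some v => ⟨some (), b, .stay, some v, .right, none⟩
    | none => ⟨none, b, .stay, some (false, fun _ => false), .left, none⟩

/-- The new cell is zero on all tracks. These are the right bits of weight `2 ^ ℓ`, because all
registers are below `2 ^ ℓ`; and since `0 < ℓ`, the new cell must not carry the mark. -/
theorem growRight_path (w : List α) {B ℓ : ℕ} (hℓ : 0 < ℓ) (hB : ℓ ≤ B) (s : Store R β)
    (hs : ∀ r, s.reg r < 2 ^ ℓ) (m i : ℕ) (hi : i + m = ℓ) :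
    (growRight (R := R) (α := α)).Path w B ⟨some (), s.flag, s.pos, tapeOf ℓ s.reg, i, s.out⟩
      ⟨none, s.flag, s.pos, tapeOf (ℓ + 1) s.reg, ℓ - 1, s.out⟩ := by
  induction m generalizing i with
  | zero =>
    obtain rfl : i = ℓ := by omega
    refine Path.single ?_ hB
    have h0 : tapeOf i s.reg i = none := by simp [tapeOf]
    simp only [step, growRight, h0, moveInput, moveWork, Option.map_some, Option.toList_none,
      List.append_nil, Option.some.injEq, FragmentConfig.mk.injEq, true_and, and_true]
    funext j
    rcases eq_or_ne j i with rfl | hj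
    · simp only [Function.update_self, tapeOf, Nat.lt_succ_self, if_true]
      refine congrArg some (Prod.ext (by simp; omega) ?_)
      funext r
      exact (Nat.testBit_lt_two_pow (hs r)).symm
    · rw [Function.update_of_ne hj]
      simp only [tapeOf]
      exact if_congr (by omega) rfl rfl
  | succ m ih =>
    refine Path.head ?_ (by dsimp only; omega) (ih (i + 1) (by omega))
    have h0 : tapeOf ℓ s.reg i = some (decide (i = 0), fun r => (s.reg r).testBit i) := by
      simp [tapeOf, show i < ℓ by omega]
    simp only [step, growRight, h0, moveInput, moveWork, Option.map_some, Option.toList_none,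
      List.append_nil, Option.some.injEq, FragmentConfig.mk.injEq, true_and, and_true]
    rw [← h0, Function.update_eq_self]

/-- Extend the tape by one cell. -/
def grow : Fragment R α β := growRight.seq rewind

theorem grow_goes (w : List α) {B ℓ : ℕ} (hℓ : 0 < ℓ) (hB : ℓ < B) (s : Store R β)
    (hs : ∀ r, s.reg r < 2 ^ ℓ) : (grow (R := R) (α := α)).Goes w B ℓ s (ℓ + 1) s :=
  Path.trans
    (seq_path_left growRight rewind (growRight_path w hℓ hB.le s hs ℓ 0 (by omega)))
    (seq_path_right growRight rewind (rewind_path w (i := ℓ - 1) (by omega) hB s))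

/-! ### From fragments to machines -/

/-- The machine that runs a fragment and then halts. -/
def toTransducer [Finite R] (F : Fragment R α β) : Transducer α β where
  State := Option F.PC × Bool
  finite_state := have := F.finite_pc; inferInstance
  Work := TapeCell R
  finite_work := inferInstance
  blank := none
  tapes := 1
  start := (some F.entry, false)
  transition q x t := q.1.map fun p =>
    let a := F.next p q.2 x (t 0)
    ⟨(a.pc, a.flag), a.inputMove, fun _ => a.write, fun _ => a.workMove, a.emit⟩

def toConfig [Finite R] (F : Fragment R α β) (c : FragmentConfig F.PC R β) :
    F.toTransducer.Config where
  state := (c.pc, c.flag)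
  inputPos := c.pos
  tape := fun _ => c.tape
  head := fun _ => c.head
  output := c.out

theorem toTransducer_step [Finite R] (F : Fragment R α β) (w : List α)
    (c : FragmentConfig F.PC R β) :
    F.toTransducer.step w (F.toConfig c) = (F.step w c).map F.toConfig := by
  rcases c with ⟨_ | p, flag, pos, tape, head, out⟩ <;> rfl

/-- Determinism: the path ends in a halted configuration, so whatever is reachable from its start
lies on it. A space bound for this one run therefore holds for all reachable configurations. -/
theorem reachable_head_le [Finite R] {F : Fragment R α β} {w : List α} {B : ℕ}
    {c c' : FragmentConfig F.PC R β} (h : F.Path w B c c') (hc : c'.pc = none)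
    (hB : c'.head ≤ B) {d : F.toTransducer.Config}
    (hd : StateTransition.Reaches (F.toTransducer.step w) (F.toConfig c) d) (i) :
    d.head i ≤ B := by
  induction h using Relation.ReflTransGen.head_induction_on with
  | refl =>
    rcases Relation.ReflTransGen.cases_head hd with rfl | ⟨e, he, -⟩
    · exact hB
    · rw [Option.mem_def, toTransducer_step] at he
      simp [step, hc] at he
  | head h1 _ ih =>
    rcases Relation.ReflTransGen.cases_head hd with rfl | ⟨e, he, hed⟩
    · exact h1.2
    · rw [Option.mem_def, toTransducer_step, h1.1, Option.map_some, Option.some.injEq] at he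
      subst he
      exact ih hed

/-- The bound in `Path` is not strict and the one in `RunsInLogspace` is; hence the `- 1`. -/
theorem logspaceComputable_of_goes [Finite R] (F : Fragment R α β) (f : List α → List β) (k : ℕ)
    (h : ∀ w, ∃ ℓ s, F.Goes w (k * (Nat.log 2 w.length + 1) - 1) 0 ⟨false, 0, fun _ => 0, []⟩ ℓ s ∧
      s.out = f w) (hk : 0 < k) : LogspaceComputable f := by
  have hinit : F.toTransducer.init =
      F.toConfig (F.config (some F.entry) 0 ⟨false, 0, fun _ => 0, []⟩) := by
    simp only [init, toConfig, config, toTransducer]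
    congr
  refine ⟨F.toTransducer, fun w => ?_, k, fun w c hc i => ?_⟩
  · obtain ⟨ℓ, s, hs, ho⟩ := h w
    refine ⟨F.toConfig (F.config none ℓ s), ?_, ?_, ho⟩
    · rw [Reachable, hinit]
      refine Relation.ReflTransGen.lift F.toConfig (fun a b hab => ?_) _ _ hs
      change _ = _
      rw [toTransducer_step, hab.1, Option.map_some]
    · rw [toTransducer_step]; rfl
  · obtain ⟨ℓ, s, hs, -⟩ := h w
    rw [Reachable, hinit] at hc
    have := reachable_head_le hs rfl (Nat.zero_le _) hc i
    have : 0 < k * (Nat.log 2 w.length + 1) := by positivity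
    omega

end Fragment

end Logspace

namespace Logspace

open Transducer

/-! ### Sweeps as arithmetic operations -/

section Sweeps

variable {ι : Type*} {β : Type*}

theorem exists_bit (x : ℕ) : ∃ b y, x = Nat.bit b y ∧ x.testBit 0 = b ∧ x / 2 = y :=
  ⟨x.testBit 0, x / 2, by rw [Nat.bit_val, Nat.testBit_zero]; by_cases h : x % 2 = 1 <;> simp [h] <;> omega,
    rfl, rfl⟩

theorem bit_lt_two_pow_succ {b : Bool} {x ℓ : ℕ} : Nat.bit b x < 2 ^ (ℓ + 1) ↔ x < 2 ^ ℓ := by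
  rw [Nat.bit_val, pow_succ]; cases b <;> simp <;> omega

/-- Ripple-carry addition: the flag is the carry, which travels from low to high bits, and the final
flag is the overflow. -/
theorem sweepResult_incr (d : ι) (ℓ : ℕ) (c : Bool) (reg : ι → ℕ) (h : reg d < 2 ^ ℓ) :
    sweepResult (β := β) (fun c col => (c && col d, xor c (col d), none)) ℓ c reg =
      (decide (reg d + c.toNat = 2 ^ ℓ), (reg d + c.toNat) % 2 ^ ℓ, []) := by
  induction ℓ generalizing c reg with
  | zero =>
    have h0 : reg d = 0 := by simpa using h
    cases c <;> simp [sweepResult, h0, Nat.mod_one]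
  | succ ℓ ih =>
    obtain ⟨b, y, h1, h2, h3⟩ := exists_bit (reg d)
    have hy : y < 2 ^ ℓ := by rwa [h1, bit_lt_two_pow_succ] at h
    simp only [sweepResult, h2]
    rw [ih _ _ (by rw [h3]; exact hy), h3, h1]
    have hp : 2 ^ (ℓ + 1) = 2 * 2 ^ ℓ := by rw [pow_succ, mul_comm]
    have key : ∀ z, Nat.bit false z % 2 ^ (ℓ + 1) = Nat.bit false (z % 2 ^ ℓ) := by
      intro z; simp only [hp, Nat.bit_false, Nat.mul_mod_mul_left]
    refine Prod.ext ?_ (Prod.ext ?_ rfl)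
    · cases b <;> cases c <;> simp [Nat.bit_val, hp] <;> omega
    · have hmod : ∀ z, z < 2 ^ ℓ → z % 2 ^ ℓ = z := fun z hz => Nat.mod_eq_of_lt hz
      cases b <;> cases c <;> simp only [Bool.and_false, Bool.and_true, Bool.true_and,
        Bool.false_and, Bool.toNat_false, Bool.toNat_true, add_zero, Bool.xor_false, Bool.xor_true,
        Bool.not_false, Bool.not_true, hmod y hy]
      · rw [Nat.mod_eq_of_lt (bit_lt_two_pow_succ.2 hy)]
      · rw [show Nat.bit false y + 1 = Nat.bit true y by simp [Nat.bit_val],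
          Nat.mod_eq_of_lt (bit_lt_two_pow_succ.2 hy)]
      · rw [Nat.mod_eq_of_lt (bit_lt_two_pow_succ.2 hy)]
      · rw [show Nat.bit true y + 1 = Nat.bit false (y + 1) by simp [Nat.bit_val]; ring, key]

theorem sweepResult_zero (ℓ : ℕ) (c : Bool) (reg : ι → ℕ) :
    sweepResult (β := β) (fun c _ => (c, false, none)) ℓ c reg = (c, 0, []) := by
  induction ℓ generalizing c reg with
  | zero => rfl
  | succ ℓ ih => simp [sweepResult, ih]

/-- The final state of a finite automaton that reads the columns of the tape. -/
def foldBits (f : Bool → (ι → Bool) → Bool) : ℕ → Bool → (ι → ℕ) → Bool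
  | 0, b, _ => b
  | ℓ + 1, b, reg => foldBits f ℓ (f b fun r => (reg r).testBit 0) fun r => reg r / 2

theorem sweepResult_fold (f : Bool → (ι → Bool) → Bool) (ℓ : ℕ) (b : Bool) (reg : ι → ℕ) :
    sweepResult (β := β) (fun c col => (f c col, false, none)) ℓ b reg =
      (foldBits f ℓ b reg, 0, []) := by
  induction ℓ generalizing b reg with
  | zero => rfl
  | succ ℓ ih => simp [sweepResult, ih, foldBits]

/-- Used with `e = some`: the machine has one track more than the program has registers, and program
sweeps do not look at the scratch track. -/
theorem sweepResult_comp {κ : Type*} (e : κ → ι)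
    (f : Bool → (κ → Bool) → Bool × Bool × Option β) (ℓ : ℕ) (b : Bool) (reg : ι → ℕ) :
    sweepResult (fun c col => f c fun k => col (e k)) ℓ b reg =
      sweepResult f ℓ b fun k => reg (e k) := by
  induction ℓ generalizing b reg with
  | zero => rfl
  | succ ℓ ih => simp only [sweepResult, ih]

theorem foldBits_comp {κ : Type*} (e : κ → ι) (f : Bool → (κ → Bool) → Bool) (ℓ : ℕ) (b : Bool)
    (reg : ι → ℕ) :
    foldBits (fun c col => f c fun k => col (e k)) ℓ b reg = foldBits f ℓ b fun k => reg (e k) := by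
  induction ℓ generalizing b reg with
  | zero => rfl
  | succ ℓ ih => simp only [foldBits, ih]

theorem foldBits_eq (a d : ι) (ℓ : ℕ) (c : Bool) (reg : ι → ℕ) (ha : reg a < 2 ^ ℓ)
    (hd : reg d < 2 ^ ℓ) :
    foldBits (fun c col => c && (col a == col d)) ℓ c reg = (c && decide (reg a = reg d)) := by
  induction ℓ generalizing c reg with
  | zero =>
    have h0 : reg a = 0 := by simpa using ha
    have h1 : reg d = 0 := by simpa using hd
    simp [foldBits, h0, h1]
  | succ ℓ ih =>
    obtain ⟨b, y, h1, h2, h3⟩ := exists_bit (reg a)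
    obtain ⟨b', y', h1', h2', h3'⟩ := exists_bit (reg d)
    simp only [foldBits, h2, h2']
    rw [ih _ _ (by rw [h3]; rwa [h1, bit_lt_two_pow_succ] at ha)
      (by rw [h3']; rwa [h1', bit_lt_two_pow_succ] at hd), h3, h3', h1, h1']
    cases c <;> cases b <;> cases b' <;> simp [Nat.bit_val] <;> omega

end Sweeps

variable {R : Type} {α β : Type*} [Finite α] [Finite β] [DecidableEq R]

/-! ### Fragments for register arithmetic -/

namespace Fragment

def setFlag (b : Bool) : Fragment R α β := act fun _ _ => (b, .stay, none)

theorem setFlag_goes (b : Bool) (w : List α) (B ℓ : ℕ) (s : Store R β) :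
    (setFlag (α := α) b).Goes w B ℓ s ℓ ⟨b, s.pos, s.reg, s.out⟩ := by
  simpa [moveInput, setFlag] using act_goes (fun _ _ => (b, .stay, none)) w B ℓ s

/-- A sweep that starts with a given flag. -/
def sweepFrom (d : Option R) (b : Bool) (f : Bool → (Option R → Bool) → Bool × Bool × Option β) :
    Fragment R α β :=
  (setFlag b).seq (sweep d f)

theorem sweepFrom_goes (d : Option R) (b : Bool)
    (f : Bool → (Option R → Bool) → Bool × Bool × Option β) (w : List α) {B ℓ : ℕ} (hℓ : 0 < ℓ)
    (hB : ℓ ≤ B) (s : Store R β) :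
    (sweepFrom (α := α) d b f).Goes w B ℓ s ℓ
      ⟨(sweepResult f ℓ b s.reg).1, s.pos,
        Function.update s.reg d (sweepResult f ℓ b s.reg).2.1,
        s.out ++ (sweepResult f ℓ b s.reg).2.2⟩ :=
  (setFlag_goes b w B ℓ s).seq (sweep_goes d f w hℓ hB _)

def incr (d : Option R) : Fragment R α β :=
  sweepFrom d true fun c col => (c && col d, xor c (col d), none)

/-- The overflow flag is used twice: it ends a loop over all values of a register, and it makes the
tape grow during the measurement of the input. -/
theorem incr_goes (d : Option R) (w : List α) {B ℓ : ℕ} (hℓ : 0 < ℓ) (hB : ℓ ≤ B)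
    (s : Store R β) (h : s.reg d < 2 ^ ℓ) :
    (incr (α := α) d).Goes w B ℓ s ℓ ⟨decide (s.reg d + 1 = 2 ^ ℓ), s.pos,
      Function.update s.reg d ((s.reg d + 1) % 2 ^ ℓ), s.out⟩ := by
  have := sweepFrom_goes (α := α) d true (fun c col => (c && col d, xor c (col d), none)) w hℓ hB s
  rw [sweepResult_incr d ℓ true s.reg h] at this
  simpa [incr] using this

def clear (d : Option R) : Fragment R α β := sweepFrom d true fun c _ => (c, false, none)

theorem clear_goes (d : Option R) (w : List α) {B ℓ : ℕ} (hℓ : 0 < ℓ) (hB : ℓ ≤ B)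
    (s : Store R β) :
    (clear (α := α) d).Goes w B ℓ s ℓ ⟨true, s.pos, Function.update s.reg d 0, s.out⟩ := by
  have := sweepFrom_goes (α := α) d true (fun c _ => (c, false, none)) w hℓ hB s
  rw [sweepResult_zero] at this
  simpa [clear] using this

/-- Compare a register with the scratch register. -/
def eqScratch (r : R) : Fragment R α β :=
  sweepFrom none true fun c col => (c && (col none == col (some r)), col none, none)

/-- A sweep always rewrites some register; writing back what was read turns it into a pure test. -/
theorem sweepResult_id {ι : Type*} {β : Type*} (f : Bool → (ι → Bool) → Bool) (d : ι) (ℓ : ℕ)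
    (b : Bool) (reg : ι → ℕ) (h : reg d < 2 ^ ℓ) :
    sweepResult (β := β) (fun c col => (f c col, col d, none)) ℓ b reg =
      (foldBits f ℓ b reg, reg d, []) := by
  induction ℓ generalizing b reg with
  | zero => simp at h; simp [sweepResult, foldBits, h]
  | succ ℓ ih =>
    obtain ⟨b, y, h1, h2, h3⟩ := exists_bit (reg d)
    simp only [sweepResult, h2, foldBits]
    rw [ih _ _ (by rw [h3]; rwa [h1, bit_lt_two_pow_succ] at h), h3]
    simp [h1]

theorem eqScratch_goes (r : R) (w : List α) {B ℓ : ℕ} (hℓ : 0 < ℓ) (hB : ℓ ≤ B)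
    (s : Store R β) (h : s.reg none < 2 ^ ℓ) (hr : s.reg (some r) < 2 ^ ℓ) :
    (eqScratch (α := α) r).Goes w B ℓ s ℓ
      ⟨decide (s.reg none = s.reg (some r)), s.pos, s.reg, s.out⟩ := by
  have := sweepFrom_goes (α := α) none true
    (fun c col => (c && (col none == col (some r)), col none, none)) w hℓ hB s
  rw [sweepResult_id _ _ _ _ _ h, foldBits_eq none (some r) ℓ true s.reg h hr] at this
  simpa [eqScratch] using this

/-! ### Reading the input at the position given by a register -/

def _root_.Logspace.InputCell.isLeftEnd : InputCell α → Bool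
  | .leftEnd => true
  | _ => false

def _root_.Logspace.InputCell.isRightEnd : InputCell α → Bool
  | .rightEnd => true
  | _ => false

def seekStart : Fragment R α β := loopUntil (act fun _ x => (x.isLeftEnd, .left, none))

/-- The marker is recognized in the same step as the left move, which is harmless because a left
move from position `0` has no effect. -/
theorem seekStart_goes (w : List α) (B ℓ : ℕ) (s : Store R β) :
    (seekStart (α := α)).Goes w B ℓ s ℓ ⟨true, 0, s.reg, s.out⟩ := by
  obtain ⟨flag, pos, reg, out⟩ := s
  induction pos generalizing flag with
  | zero =>
    have := act_goes (fun _ (x : InputCell α) => (x.isLeftEnd, .left, none)) w B ℓ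
      ⟨flag, 0, reg, out⟩
    refine Goes.until_true ?_ rfl
    simpa [scan, InputCell.isLeftEnd, moveInput] using this
  | succ p ih =>
    have := act_goes (fun _ (x : InputCell α) => (x.isLeftEnd, .left, none)) w B ℓ
      ⟨flag, p + 1, reg, out⟩
    have hf : (scan w (p + 1)).isLeftEnd = false := by
      simp only [scan]; split <;> rfl
    simp only [hf, moveInput, Nat.add_sub_cancel, Option.toList_none, List.append_nil] at this
    exact Goes.until_false this rfl (ih false)

/-- The scratch register counts the moves of the input head until it agrees with `r`. -/
def seekBody (r : R) : Fragment R α β :=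
  (eqScratch r).seq (cond (act fun b _ => (b, .stay, none))
    ((incr none).seq (act fun _ _ => (false, .right, none))))

/-- Induction on the distance `m` still to go. The head is held back by the right end marker while
the count goes on, hence the minimum: a register beyond the input reads the end marker. -/
theorem seek_goes (r : R) (w : List α) {B ℓ : ℕ} (hℓ : 0 < ℓ) (hB : ℓ ≤ B)
    (m : ℕ) (s : Store R β) (hr : s.reg (some r) < 2 ^ ℓ) (hm : s.reg none + m = s.reg (some r))
    (hp : s.pos = min (s.reg none) (w.length + 1)) :
    (loopUntil (seekBody (α := α) r)).Goes w B ℓ s ℓ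
      ⟨true, min (s.reg (some r)) (w.length + 1), Function.update s.reg none (s.reg (some r)),
        s.out⟩ := by
  induction m generalizing s with
  | zero =>
    refine Goes.until_true ((eqScratch_goes r w hℓ hB s (by omega) hr).seq
      (Goes.cond_true (by simpa using hm) ?_)) rfl
    have := act_goes (fun b (_ : InputCell α) => (b, .stay, none)) w B ℓ
      ⟨decide (s.reg none = s.reg (some r)), s.pos, s.reg, s.out⟩
    have e : s.reg none = s.reg (some r) := by simpa using hm
    simpa [moveInput, ← e, hp, Function.update_eq_self] using this
  | succ m ih =>
    have h1 := eqScratch_goes r w hℓ hB s (by omega) hr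
    have h2 := incr_goes (α := α) none w hℓ hB
      ⟨decide (s.reg none = s.reg (some r)), s.pos, s.reg, s.out⟩ (by simp only; omega)
    have h3 := act_goes (fun _ (_ : InputCell α) => (false, .right, none)) w B ℓ
      ⟨decide (s.reg none + 1 = 2 ^ ℓ), s.pos,
        Function.update s.reg none ((s.reg none + 1) % 2 ^ ℓ), s.out⟩
    refine Goes.until_false (h1.seq (Goes.cond_false (by simp; omega) (h2.seq h3))) rfl ?_
    have hmod : (s.reg none + 1) % 2 ^ ℓ = s.reg none + 1 := Nat.mod_eq_of_lt (by omega)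
    have := ih ⟨false, min (s.pos + 1) (w.length + 1),
      Function.update s.reg none (s.reg none + 1), s.out⟩ (by simpa using hr)
      (by simp; omega) (by simp [hp])
    simpa [hmod, moveInput] using this

def readAt (r : R) (f : InputCell α → Bool × Option β) : Fragment R α β :=
  seekStart.seq ((clear none).seq ((loopUntil (seekBody r)).seq
    (act fun _ x => ((f x).1, .stay, (f x).2))))

theorem scan_min (w : List α) (p : ℕ) : scan w (min p (w.length + 1)) = scan w p := by
  rcases le_total p (w.length + 1) with h | h
  · rw [min_eq_left h]
  · rw [min_eq_right h]
    obtain ⟨p, rfl⟩ : ∃ q, p = q + 1 := ⟨p - 1, by omega⟩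
    simp [scan, List.getElem?_eq_none (show w.length ≤ p by omega)]

theorem readAt_goes (r : R) (f : InputCell α → Bool × Option β) (w : List α) {B ℓ : ℕ}
    (hℓ : 0 < ℓ) (hB : ℓ ≤ B) (s : Store R β) (hr : s.reg (some r) < 2 ^ ℓ) :
    (readAt r f).Goes w B ℓ s ℓ
      ⟨(f (scan w (s.reg (some r)))).1, min (s.reg (some r)) (w.length + 1),
        Function.update s.reg none (s.reg (some r)),
        s.out ++ (f (scan w (s.reg (some r)))).2.toList⟩ := by
  refine (seekStart_goes w B ℓ s).seq ((clear_goes none w hℓ hB _).seq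
    ((seek_goes r w hℓ hB (s.reg (some r)) _ (by simpa using hr) (by simp) (by simp)).seq ?_))
  have := act_goes (fun _ x => ((f x).1, .stay, (f x).2)) w B ℓ
    ⟨true, min (s.reg (some r)) (w.length + 1), Function.update s.reg none (s.reg (some r)), s.out⟩
  simpa [moveInput, scan_min] using this

end Fragment

/-! ### A language for logspace computations -/

/-- The registers and the output during a computation. -/
structure Memory (R : Type) (β : Type*) where
  reg : R → ℕ
  out : List β

def Memory.set (s : Memory R β) (r : R) (x : ℕ) : Memory R β := ⟨Function.update s.reg r x, s.out⟩

inductive Test (R : Type) (α : Type*) where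
  | bits (b : Bool) (f : Bool → (R → Bool) → Bool)
  | cell (r : R) (f : InputCell α → Bool)

def Test.eval (w : List α) (ℓ : ℕ) (reg : R → ℕ) : Test R α → Bool
  | .bits b f => foldBits f ℓ b reg
  | .cell r f => f (scan w (reg r))

/-- Programs with a fixed number of registers of width `ℓ`. The body of `loop r p` is run for all
values `0, …, 2 ^ ℓ - 1` of the register `r`. -/
inductive Program (R : Type) (α β : Type*) where
  | skip
  | emit (x : β)
  | emitCell (r : R) (f : InputCell α → Option β)
  | sweep (d : R) (b : Bool) (f : Bool → (R → Bool) → Bool × Bool × Option β)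
  | seq (p q : Program R α β)
  | ite (t : Test R α) (p q : Program R α β)
  | loop (r : R) (p : Program R α β)

namespace Program

/-- A loop register ends with `0` because, in the machine, the increment that terminates the loop
overflows. -/
def exec (w : List α) (ℓ : ℕ) : Program R α β → Memory R β → Memory R β
  | .skip, s => s
  | .emit x, s => ⟨s.reg, s.out ++ [x]⟩
  | .emitCell r f, s => ⟨s.reg, s.out ++ (f (scan w (s.reg r))).toList⟩
  | .sweep d b f, s =>
    ⟨Function.update s.reg d (sweepResult f ℓ b s.reg).2.1, s.out ++ (sweepResult f ℓ b s.reg).2.2⟩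
  | .seq p q, s => q.exec w ℓ (p.exec w ℓ s)
  | .ite t p q, s => if t.eval w ℓ s.reg then p.exec w ℓ s else q.exec w ℓ s
  | .loop r p, s =>
    ((List.range' 0 (2 ^ ℓ)).foldl (fun s i => p.exec w ℓ (s.set r i)) s).set r 0

/-- The program may change the register `r`. -/
def Writes : Program R α β → R → Prop
  | .skip, _ => False
  | .emit _, _ => False
  | .emitCell _ _, _ => False
  | .sweep d _ _, r => r = d
  | .seq p q, r => p.Writes r ∨ q.Writes r
  | .ite _ p q, r => p.Writes r ∨ q.Writes r
  | .loop i p, r => r = i ∨ p.Writes r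

/-- No loop changes its own loop variable. -/
def WellFormed : Program R α β → Prop
  | .skip => True
  | .emit _ => True
  | .emitCell _ _ => True
  | .sweep _ _ _ => True
  | .seq p q => p.WellFormed ∧ q.WellFormed
  | .ite _ p q => p.WellFormed ∧ q.WellFormed
  | .loop i p => ¬ p.Writes i ∧ p.WellFormed

theorem exec_reg {w : List α} {ℓ : ℕ} {p : Program R α β} {r : R} (h : ¬ p.Writes r)
    (s : Memory R β) : (p.exec w ℓ s).reg r = s.reg r := by
  induction p generalizing s with
  | skip => rfl
  | emit x => rfl
  | emitCell r f => rfl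
  | sweep d b f => exact Function.update_of_ne h _ _
  | seq p q ihp ihq =>
    rw [Writes, not_or] at h
    simp only [exec, ihp h.1, ihq h.2]
  | ite t p q ihp ihq =>
    rw [Writes, not_or] at h
    simp only [exec]
    split
    · exact ihp h.1 s
    · exact ihq h.2 s
  | loop i p ih =>
    rw [Writes, not_or] at h
    simp only [exec, Memory.set, Function.update_of_ne h.1]
    induction List.range' 0 (2 ^ ℓ) generalizing s with
    | nil => rfl
    | cons a l ihl => rw [List.foldl_cons, ihl, ih h.2]; exact Function.update_of_ne h.1 _ _

-- Tests use the scratch track as the target of their sweeps, so the registers of the program are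
-- not disturbed.
open Fragment in
def _root_.Logspace.Test.compile : Test R α → Fragment R α β
  | .bits b f => sweepFrom none b fun c col => (f c fun r => col (some r), false, none)
  | .cell r f => readAt r fun x => (f x, none)

open Fragment in
def compile : Program R α β → Fragment R α β
  | .skip => setFlag true
  | .emit x => act fun _ _ => (true, .stay, some x)
  | .emitCell r f => readAt r fun x => (true, f x)
  | .sweep d b f => sweepFrom (some d) b fun c col => f c fun r => col (some r)
  | .seq p q => p.compile.seq q.compile
  | .ite t p q => t.compile.seq (p.compile.cond q.compile)
  | .loop r p => (clear (some r)).seq (loopUntil (p.compile.seq (incr (some r))))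

/-- The machine's store agrees with the memory of the program. -/
structure _root_.Logspace.Represents (ℓ : ℕ) (s : Store R β) (σ : Memory R β) : Prop where
  reg : ∀ r, s.reg (some r) = σ.reg r
  out : s.out = σ.out
  lt : ∀ r, s.reg r < 2 ^ ℓ

theorem _root_.Logspace.Test.compile_goes (t : Test R α) (w : List α) {B ℓ : ℕ} (hℓ : 0 < ℓ)
    (hB : ℓ ≤ B) {s : Store R β} {σ : Memory R β} (h : Represents ℓ s σ) :
    ∃ s', (t.compile (β := β)).Goes w B ℓ s ℓ s' ∧ Represents ℓ s' σ ∧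
      s'.flag = t.eval w ℓ σ.reg := by
  have hreg : (fun r => s.reg (some r)) = σ.reg := funext h.reg
  cases t with
  | bits b f =>
    refine ⟨_, Fragment.sweepFrom_goes none b _ w hℓ hB s, ⟨fun r => ?_, ?_, fun r => ?_⟩, ?_⟩
    · simpa using h.reg r
    · simpa [sweepResult_fold] using h.out
    · cases r <;> simp [sweepResult_fold, h.lt]
    · simp only [sweepResult_fold, Test.eval, ← hreg]
      exact foldBits_comp some f ℓ b s.reg
  | cell r f =>
    refine ⟨_, Fragment.readAt_goes r _ w hℓ hB s (h.lt _), ⟨fun r => ?_, ?_, fun r => ?_⟩, ?_⟩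
    · simpa using h.reg r
    · simpa using h.out
    · cases r <;> simp [h.lt]
    · simp [Test.eval, h.reg]

theorem compile_goes (p : Program R α β) (hp : p.WellFormed) (w : List α) {B ℓ : ℕ} (hℓ : 0 < ℓ)
    (hB : ℓ ≤ B) {s : Store R β} {σ : Memory R β} (h : Represents ℓ s σ) :
    ∃ s', p.compile.Goes w B ℓ s ℓ s' ∧ Represents ℓ s' (p.exec w ℓ σ) := by
  induction p generalizing s σ with
  | skip => exact ⟨_, Fragment.setFlag_goes true w B ℓ s, h.reg, h.out, h.lt⟩
  | emit x =>
    refine ⟨_, Fragment.act_goes _ w B ℓ s, h.reg, ?_, h.lt⟩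
    simp [exec, h.out]
  | emitCell r f =>
    refine ⟨_, Fragment.readAt_goes r _ w hℓ hB s (h.lt _), fun r => ?_, ?_, fun r => ?_⟩
    · simpa [exec] using h.reg r
    · simp [exec, h.out, h.reg]
    · cases r <;> simp [h.lt]
  | sweep d b f =>
    have hreg : (fun r => s.reg (some r)) = σ.reg := funext h.reg
    refine ⟨_, Fragment.sweepFrom_goes (some d) b _ w hℓ hB s, fun r => ?_, ?_, fun r => ?_⟩
    · simp only [sweepResult_comp some f, hreg, exec]
      rcases eq_or_ne r d with rfl | hr
      · simp
      · simp [Function.update_of_ne hr, h.reg, hr]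
    · simp only [sweepResult_comp some f, hreg, exec, h.out]
    · rcases eq_or_ne r (some d) with rfl | hr
      · simp [sweepResult_lt]
      · simp [Function.update_of_ne hr, h.lt]
  | seq p q ihp ihq =>
    obtain ⟨s₁, h1, h1'⟩ := ihp hp.1 h
    obtain ⟨s₂, h2, h2'⟩ := ihq hp.2 h1'
    exact ⟨s₂, h1.seq h2, h2'⟩
  | ite t p q ihp ihq =>
    obtain ⟨s₁, h1, h1', hf⟩ := t.compile_goes w hℓ hB h
    simp only [exec]
    split
    case isTrue ht =>
      obtain ⟨s₂, h2, h2'⟩ := ihp hp.1 h1'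
      exact ⟨s₂, h1.seq (h2.cond_true (hf.trans ht)), h2'⟩
    case isFalse ht =>
      obtain ⟨s₂, h2, h2'⟩ := ihq hp.2 h1'
      exact ⟨s₂, h1.seq (h2.cond_false (hf.trans (by simpa using ht))), h2'⟩
  | loop r p ih =>
    -- Induction on the number of rounds that are left. The body preserves the loop register by
    -- `exec_reg` and well-formedness, so the increment overflows exactly in the round with `i + 1 =
    -- 2 ^ ℓ`.
    have key : ∀ m i, i + (m + 1) = 2 ^ ℓ → ∀ (s : Store R β) (σ : Memory R β),
        Represents ℓ s (σ.set r i) →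
        ∃ s', (Fragment.loopUntil (p.compile.seq (Fragment.incr (some r)))).Goes w B ℓ s ℓ s' ∧
          Represents ℓ s'
            (((List.range' i (m + 1)).foldl (fun s i => p.exec w ℓ (s.set r i)) σ).set r 0) := by
      intro m
      induction m with
      | zero =>
        intro i hi s σ h
        obtain ⟨s₁, h1, h1'⟩ := ih hp.2 h
        have hr : s₁.reg (some r) = i := by
          rw [h1'.reg, exec_reg hp.1]; simp [Memory.set]
        have h2 := Fragment.incr_goes (some r) w hℓ hB s₁ (h1'.lt _)
        refine ⟨_, Fragment.Goes.until_true (h1.seq h2) (by simp [hr]; omega), fun r' => ?_, ?_,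
          fun r' => ?_⟩
        · rcases eq_or_ne r' r with rfl | hne
          · simp [hr, Memory.set, hi]
          · simp [hne, Memory.set, h1'.reg, List.range']
        · simp [h1'.out, Memory.set, List.range']
        · rcases eq_or_ne r' (some r) with rfl | hne
          · simp [Nat.mod_lt]
          · simp [hne, h1'.lt]
      | succ m ihm =>
        intro i hi s σ h
        obtain ⟨s₁, h1, h1'⟩ := ih hp.2 h
        have hr : s₁.reg (some r) = i := by
          rw [h1'.reg, exec_reg hp.1]; simp [Memory.set]
        have h2 := Fragment.incr_goes (some r) w hℓ hB s₁ (h1'.lt _)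
        have hmod : (i + 1) % 2 ^ ℓ = i + 1 := Nat.mod_eq_of_lt (by omega)
        obtain ⟨s₃, h3, h3'⟩ := ihm (i + 1) (by omega)
          ⟨decide (s₁.reg (some r) + 1 = 2 ^ ℓ), s₁.pos,
            Function.update s₁.reg (some r) ((s₁.reg (some r) + 1) % 2 ^ ℓ), s₁.out⟩ (p.exec w ℓ (σ.set r i))
          ⟨fun r' => by
            rcases eq_or_ne r' r with rfl | hne
            · simp [hr, Memory.set, hmod]
            · simp [hne, Memory.set, h1'.reg],
          h1'.out, fun r' => by
            rcases eq_or_ne r' (some r) with rfl | hne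
            · simp [Nat.mod_lt]
            · simp [hne, h1'.lt]⟩
        refine ⟨s₃, Fragment.Goes.until_false (h1.seq h2) (by simp [hr]; omega) h3, ?_⟩
        rw [List.range'_succ, List.foldl_cons]
        exact h3'
    have hpos : 0 < 2 ^ ℓ := by positivity
    obtain ⟨s', h1, h1'⟩ := key (2 ^ ℓ - 1) 0 (by omega)
      ⟨true, s.pos, Function.update s.reg (some r) 0, s.out⟩ σ
      ⟨fun r' => by
        rcases eq_or_ne r' r with rfl | hne
        · simp [Memory.set]
        · simp [hne, Memory.set, h.reg],
      h.out, fun r' => by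
        rcases eq_or_ne r' (some r) with rfl | hne
        · simp
        · simp [hne, h.lt]⟩
    refine ⟨s', (Fragment.clear_goes (some r) w hℓ hB s).seq h1, ?_⟩
    rw [show 2 ^ ℓ - 1 + 1 = 2 ^ ℓ by omega] at h1'
    exact h1'

/-! ### Choosing the width of the tape -/

-- The cells of the input are counted in the scratch register, and on overflow the tape gets one
-- more cell. An overflow takes the register from `2 ^ ℓ - 1` to `0` and the width from `ℓ` to `ℓ +
-- 1`, so the sum of the register and `2 ^ ℓ` grows by one in every round, whether or not there is
-- an overflow. This sum stays equal to the number of rounds plus `2`.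
open Fragment in
def _root_.Logspace.Fragment.measure : Fragment R α β :=
  loopUntil ((incr none).seq ((cond grow (setFlag true)).seq
    (act fun _ x => (x.isRightEnd, .right, none))))

theorem _root_.Logspace.Fragment.measure_step (w : List α) {B : ℕ}
    (hB : ∀ ℓ, 2 ^ ℓ ≤ w.length + 4 → ℓ ≤ B) {ℓ : ℕ} (hℓ : 0 < ℓ) (s : Store R β)
    (hs : ∀ r, s.reg r < 2 ^ ℓ) (hm : s.pos ≤ w.length + 1)
    (h : s.reg none + 2 ^ ℓ = s.pos + 2) :
    ∃ ℓ₁ reg₁, ((Fragment.incr none).seq ((Fragment.cond Fragment.grow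
      (Fragment.setFlag true)).seq
      (Fragment.act fun _ x => (x.isRightEnd, .right, none)))).Goes w B ℓ s ℓ₁
      ⟨(scan w s.pos).isRightEnd, min (s.pos + 1) (w.length + 1), reg₁, s.out⟩ ∧
      (∀ r, reg₁ r < 2 ^ ℓ₁) ∧ reg₁ none + 2 ^ ℓ₁ = s.pos + 3 ∧ 0 < ℓ₁ ∧
      ∀ r, reg₁ (some r) = s.reg (some r) := by
  have h0 := hs none
  have h1 := Fragment.incr_goes (α := α) none w hℓ (hB ℓ (by omega)) s (hs none)
  by_cases hov : s.reg none + 1 = 2 ^ ℓ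
  · have hp : 2 ^ (ℓ + 1) = 2 * 2 ^ ℓ := by rw [pow_succ, mul_comm]
    have hlt : ∀ r, Function.update s.reg none ((s.reg none + 1) % 2 ^ ℓ) r < 2 ^ ℓ := by
      intro r; cases r <;> simp [hs, Nat.mod_lt]
    have h2 := Fragment.grow_goes (α := α) w hℓ (hB (ℓ + 1) (by omega))
      ⟨decide (s.reg none + 1 = 2 ^ ℓ), s.pos,
        Function.update s.reg none ((s.reg none + 1) % 2 ^ ℓ), s.out⟩ hlt
    have h3 := Fragment.act_goes (fun _ (x : InputCell α) => (x.isRightEnd, .right, none)) w B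
      (ℓ + 1) ⟨decide (s.reg none + 1 = 2 ^ ℓ), s.pos,
        Function.update s.reg none ((s.reg none + 1) % 2 ^ ℓ), s.out⟩
    simp only [Option.toList_none, List.append_nil, moveInput] at h3
    refine ⟨ℓ + 1, _, h1.seq ((h2.cond_true (by simpa using hov)).seq h3), fun r => ?_, ?_,
      by omega, fun r => by simp⟩
    · have := hlt r
      omega
    · simp [hov]; omega
  · have h2 := Fragment.setFlag_goes true w B ℓ
      ⟨decide (s.reg none + 1 = 2 ^ ℓ), s.pos,
        Function.update s.reg none ((s.reg none + 1) % 2 ^ ℓ), s.out⟩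
    have h3 := Fragment.act_goes (fun _ (x : InputCell α) => (x.isRightEnd, .right, none)) w B
      ℓ ⟨true, s.pos, Function.update s.reg none ((s.reg none + 1) % 2 ^ ℓ), s.out⟩
    simp only [Option.toList_none, List.append_nil, moveInput] at h3
    refine ⟨ℓ, _, h1.seq ((h2.cond_false (by simpa using hov)).seq h3), fun r => ?_, ?_,
      by omega, fun r => by simp⟩
    · cases r <;> simp [hs, Nat.mod_lt]
    · rw [Function.update_self, Nat.mod_eq_of_lt (by omega)]; omega

/-- In the end the register plus `2 ^ ℓ'` is `w.length + 4`, and the register is below `2 ^ ℓ'`;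
this gives both bounds on the width. -/
theorem _root_.Logspace.Fragment.measure_goes (w : List α) {B : ℕ}
    (hB : ∀ ℓ, 2 ^ ℓ ≤ w.length + 4 → ℓ ≤ B) (m : ℕ) {ℓ : ℕ} (hℓ : 0 < ℓ) (s : Store R β)
    (hs : ∀ r, s.reg r < 2 ^ ℓ) (hm : s.pos + m = w.length + 1)
    (h : s.reg none + 2 ^ ℓ = s.pos + 2) :
    ∃ ℓ' s', (Fragment.measure (α := α)).Goes w B ℓ s ℓ' s' ∧ 2 ^ ℓ' ≤ w.length + 4 ∧
      w.length + 4 < 2 * 2 ^ ℓ' ∧ 0 < ℓ' ∧ (∀ r, s'.reg (some r) = s.reg (some r)) ∧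
      (∀ r, s'.reg r < 2 ^ ℓ') ∧ s'.out = s.out := by
  induction m generalizing ℓ s with
  | zero =>
    obtain ⟨ℓ₁, reg₁, h1, h2, h3, h4, h5⟩ := Fragment.measure_step w hB hℓ s hs (by omega) h
    have hp : s.pos = w.length + 1 := by omega
    refine ⟨ℓ₁, _, Fragment.Goes.until_true h1 ?_, by omega, ?_, h4, h5, h2, rfl⟩
    · simp [hp, scan, InputCell.isRightEnd]
    · have := h2 none
      omega
  | succ m ih =>
    obtain ⟨ℓ₁, reg₁, h1, h2, h3, h4, h5⟩ := Fragment.measure_step w hB hℓ s hs (by omega) h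
    have hr : (scan w s.pos).isRightEnd = false := by
      cases hpos : s.pos with
      | zero => rfl
      | succ p => simp [scan, List.getElem?_eq_getElem (show p < w.length by omega),
          InputCell.isRightEnd]
    obtain ⟨ℓ', s', g1, g2, g3, g4, g5, g6, g7⟩ := ih h4
      ⟨(scan w s.pos).isRightEnd, min (s.pos + 1) (w.length + 1), reg₁, s.out⟩ h2
      (by simp only; omega) (by simp only; omega)
    exact ⟨ℓ', s', Fragment.Goes.until_false h1 hr g1, g2, g3, g4,
      fun r => (g5 r).trans (h5 r), g6, g7⟩

theorem _root_.Logspace.Represents.mono {ℓ ℓ' : ℕ} (h : ℓ ≤ ℓ') {s : Store R β} {σ : Memory R β}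
    (hs : Represents ℓ s σ) : Represents ℓ' s σ :=
  ⟨hs.reg, hs.out, fun r => (hs.lt r).trans_le (Nat.pow_le_pow_right two_pos h)⟩

-- The function is defined as what the machine writes, which makes it total: loops are bounded, so
-- the machine halts on words that encode nothing, too. After the measurement four more cells are
-- added, so that `2 ^ ℓ` exceeds the input length by a factor that leaves room for all positions
-- and counts.
open Fragment in
theorem logspaceComputable [Finite R] (p : Program R α β) (hp : p.WellFormed) :
    ∃ f : List α → List β, LogspaceComputable f ∧
      ∀ w, ∃ ℓ, 8 * (w.length + 1) ≤ 2 ^ ℓ ∧ f w = (p.exec w ℓ ⟨fun _ => 0, []⟩).out := by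
  have main : ∀ w : List α, ∃ ℓ s, (mark.seq (measure.seq (grow.seq (grow.seq (grow.seq
      (grow.seq p.compile)))))).Goes w (8 * (Nat.log 2 w.length + 1) - 1) 0 ⟨false, 0, fun _ => 0, []⟩ ℓ s ∧
      8 * (w.length + 1) ≤ 2 ^ ℓ ∧ s.out = (p.exec w ℓ ⟨fun _ => 0, []⟩).out := by
    intro w
    -- The measured width is at most `log + 3`, the final one at most `log + 7`, and this is at most
    -- `8 * (log + 1) - 1`: hence the constant `8`.
    have hlog : ∀ ℓ, 2 ^ ℓ ≤ w.length + 4 → ℓ ≤ Nat.log 2 w.length + 3 := by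
      intro ℓ hℓ
      rcases Nat.eq_zero_or_pos w.length with h0 | hpos
      · rw [h0] at hℓ
        have : 2 ^ ℓ < 2 ^ 3 := by omega
        have := (Nat.pow_lt_pow_iff_right one_lt_two).1 this
        omega
      · have h1 := Nat.lt_pow_succ_log_self one_lt_two w.length
        have : 2 ^ ℓ < 2 ^ (Nat.log 2 w.length + 4) := by
          rw [pow_succ] at h1; rw [pow_add]; omega
        have := (Nat.pow_lt_pow_iff_right one_lt_two).1 this
        omega
    obtain ⟨ℓ, s, g1, g2, g3, g4, g5, g6, g7⟩ := measure_goes (R := R) (β := β) w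
      (B := 8 * (Nat.log 2 w.length + 1) - 1) (fun ℓ hℓ => by have := hlog ℓ hℓ; omega)
      (w.length + 1) one_pos ⟨false, 0, fun _ => 0, []⟩ (by simp) (by simp) (by simp)
    have hr : Represents ℓ s ⟨fun _ => 0, []⟩ := ⟨g5, g7, g6⟩
    have hℓ := hlog ℓ g2
    obtain ⟨s', h1, h1'⟩ := p.compile_goes hp w (B := 8 * (Nat.log 2 w.length + 1) - 1)
      (by omega) (by omega) (hr.mono (show ℓ ≤ ℓ + 1 + 1 + 1 + 1 by omega))
    refine ⟨_, s', (mark_goes w _ _ rfl).seq (g1.seq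
      ((grow_goes w g4 (by omega) s hr.lt).seq
      ((grow_goes w (by omega) (by omega) s (hr.mono (by omega)).lt).seq
      ((grow_goes w (by omega) (by omega) s (hr.mono (by omega)).lt).seq
      ((grow_goes w (by omega) (by omega) s (hr.mono (by omega)).lt).seq h1))))), ?_, h1'.out⟩
    rw [pow_succ, pow_succ, pow_succ, pow_succ]
    omega
  choose ℓ s h1 h2 h3 using main
  exact ⟨fun w => (s w).out,
    logspaceComputable_of_goes _ _ 8 (fun w => ⟨ℓ w, s w, h1 w, rfl⟩) (by norm_num),
    fun w => ⟨ℓ w, h2 w, h3 w⟩⟩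

end Program

end Logspace

namespace Logspace

open Transducer

/-! ### Arithmetic of further sweeps -/

section Sweeps

variable {ι : Type*} {β : Type*}

/-- For sweeps that act on each bit of `r` separately; `g` is their arithmetic effect. It depends on
the width for the sake of the complement `2 ^ ℓ - 1 - x`. -/
theorem sweepResult_copy (f : (ι → Bool) → Bool) (g : ℕ → ℕ → ℕ) (r : ι)
    (hg : ∀ ℓ b x, x < 2 ^ ℓ → g (ℓ + 1) (Nat.bit b x) = Nat.bit (f fun _ => b) (g ℓ x))
    (h0 : g 0 0 = 0) (hf : ∀ col, f col = f fun _ => col r) (ℓ : ℕ) (c : Bool) (reg : ι → ℕ)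
    (h : reg r < 2 ^ ℓ) :
    sweepResult (β := β) (fun c col => (c, f col, none)) ℓ c reg = (c, g ℓ (reg r), []) := by
  induction ℓ generalizing reg with
  | zero =>
    have : reg r = 0 := by simpa using h
    simp [sweepResult, this, h0]
  | succ ℓ ih =>
    obtain ⟨b, y, h1, h2, h3⟩ := exists_bit (reg r)
    rw [h1, bit_lt_two_pow_succ] at h
    simp only [sweepResult]
    rw [ih _ (by rw [h3]; exact h), h3, hf, h2, h1, hg _ _ _ h]
    rfl

/-- The flag delays each bit by one cell. The initial flag becomes the lowest bit, and the highest
bit drops out. -/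
theorem sweepResult_double (d : ι) (ℓ : ℕ) (c : Bool) (reg : ι → ℕ) :
    (sweepResult (β := β) (fun c col => (col d, c, none)) ℓ c reg).2 =
      ((2 * reg d + c.toNat) % 2 ^ ℓ, []) := by
  induction ℓ generalizing c reg with
  | zero => simp [sweepResult, Nat.mod_one]
  | succ ℓ ih =>
    obtain ⟨b, y, h1, h2, h3⟩ := exists_bit (reg d)
    simp only [sweepResult, h2, ih, h3, Option.toList_none, List.nil_append, Prod.mk.injEq,
      and_true, h1, Nat.bit_val, pow_succ]
    rw [mul_comm (2 ^ ℓ) 2]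
    have h1 : c.toNat ≤ 1 := Bool.toNat_le c
    set a := 2 * y + b.toNat
    have e1 : (2 * a + c.toNat) / 2 = a := by omega
    have e2 : (2 * a + c.toNat) % 2 = c.toNat := by omega
    have e3 : 2 * (a / 2) + (a.testBit 0).toNat = a := by
      rw [Nat.testBit_zero]
      rcases Nat.mod_two_eq_zero_or_one a with h | h <;> simp [h] <;> omega
    conv_rhs => rw [Nat.mod_mul, e1, e2]
    simp only [e3]
    ring

/-- In binary `2 ^ h - 1` consists of `h` ones, so a register with this value is a unary `h` laid
out on the tape, and a single sweep can write `h` symbols. -/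
theorem sweepResult_emitBits (r : ι) (x : β) (h ℓ : ℕ) (hℓ : h ≤ ℓ) (c : Bool) (reg : ι → ℕ)
    (hr : reg r = 2 ^ h - 1) :
    sweepResult (fun c col => (c, false, if col r then some x else none)) ℓ c reg =
      (c, 0, List.replicate h x) := by
  induction ℓ generalizing h reg with
  | zero =>
    obtain rfl : h = 0 := by omega
    simp [sweepResult]
  | succ ℓ ih =>
    cases h with
    | zero =>
      have h0 : reg r = 0 := by simpa using hr
      simp only [sweepResult, h0, Nat.zero_testBit]
      rw [ih 0 (Nat.zero_le _) _ (by simp [h0])]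
      simp
    | succ h =>
      have hp : 0 < 2 ^ h := by positivity
      have e0 : (reg r).testBit 0 = true := by
        rw [hr, pow_succ, Nat.testBit_zero]; simp; omega
      have e1 : reg r / 2 = 2 ^ h - 1 := by rw [hr, pow_succ]; omega
      simp only [sweepResult, e0]
      rw [ih h (by omega) _ e1]
      simp [List.replicate_succ]

/-- The length of the last block of ones in the binary expansion. -/
def trailingOnes (n : ℕ) : ℕ :=
  if h : n % 2 = 1 then trailingOnes (n / 2) + 1 else 0
decreasing_by omega

theorem trailingOnes_bit_false (n : ℕ) : trailingOnes (2 * n) = 0 := by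
  rw [trailingOnes]; simp

theorem trailingOnes_bit_true (n : ℕ) : trailingOnes (2 * n + 1) = trailingOnes n + 1 := by
  rw [trailingOnes, dif_pos (by omega), show (2 * n + 1) / 2 = n by omega]

/-- The flag remains set only as long as nothing but ones has been read from the lowest bit on. -/
theorem sweepResult_emitTail (r : ι) (x : β) (ℓ : ℕ) (c : Bool) (reg : ι → ℕ)
    (hr : reg r < 2 ^ ℓ) :
    (sweepResult (fun c col => (c && col r, false, if c && col r then some x else none)) ℓ c
      reg).2 = (0, if c then List.replicate (trailingOnes (reg r)) x else []) := by
  induction ℓ generalizing c reg with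
  | zero =>
    have h0 : reg r = 0 := by simpa using hr
    have : trailingOnes 0 = 0 := trailingOnes_bit_false 0
    simp [sweepResult, h0, this]
  | succ ℓ ih =>
    obtain ⟨b, y, h1, h2, h3⟩ := exists_bit (reg r)
    rw [h1, bit_lt_two_pow_succ] at hr
    simp only [sweepResult, h2]
    rw [ih _ _ (by rw [h3]; exact hr), h3, h1]
    cases b <;> cases c <;> simp [trailingOnes_bit_false, trailingOnes_bit_true,
      List.replicate_succ]

theorem foldBits_isZero (a : ι) (ℓ : ℕ) (c : Bool) (reg : ι → ℕ) (ha : reg a < 2 ^ ℓ) :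
    foldBits (fun c col => c && (col a == false)) ℓ c reg = (c && decide (reg a = 0)) := by
  induction ℓ generalizing c reg with
  | zero =>
    have h0 : reg a = 0 := by simpa using ha
    simp [foldBits, h0]
  | succ ℓ ih =>
    obtain ⟨b, y, h1, h2, h3⟩ := exists_bit (reg a)
    simp only [foldBits, h2]
    rw [ih _ _ (by rw [h3]; rwa [h1, bit_lt_two_pow_succ] at ha), h3, h1]
    cases c <;> cases b <;> simp [Nat.bit_val]

/-- Columns come in increasing significance, so the last column in which the two registers differ
decides; if there is none, the initial flag survives. -/
theorem foldBits_lt (a d : ι) (ℓ : ℕ) (c : Bool) (reg : ι → ℕ) (ha : reg a < 2 ^ ℓ)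
    (hd : reg d < 2 ^ ℓ) :
    foldBits (fun c col => if col a = col d then c else col d) ℓ c reg =
      (decide (reg a < reg d) || (c && decide (reg a = reg d))) := by
  induction ℓ generalizing c reg with
  | zero =>
    have h0 : reg a = 0 := by simpa using ha
    have h1 : reg d = 0 := by simpa using hd
    simp [foldBits, h0, h1]
  | succ ℓ ih =>
    obtain ⟨b, y, h1, h2, h3⟩ := exists_bit (reg a)
    obtain ⟨b', y', h1', h2', h3'⟩ := exists_bit (reg d)
    simp only [foldBits, h2, h2']
    rw [ih _ _ (by rw [h3]; rwa [h1, bit_lt_two_pow_succ] at ha)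
      (by rw [h3']; rwa [h1', bit_lt_two_pow_succ] at hd), h3, h3', h1, h1']
    rw [Bool.eq_iff_iff]
    cases c <;> cases b <;> cases b' <;> simp [Nat.bit_val] <;> omega

end Sweeps

variable {R : Type} {α β : Type*} [Finite α] [Finite β] [DecidableEq R]

/-! ### Memories -/

theorem Memory.set_reg (s : Memory R β) (r : R) (x : ℕ) (r' : R) :
    (s.set r x).reg r' = if r' = r then x else s.reg r' := by
  simp [Memory.set, Function.update_apply]

theorem Memory.set_out (s : Memory R β) (r : R) (x : ℕ) : (s.set r x).out = s.out := rfl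

theorem Memory.set_self (s : Memory R β) (r : R) : s.set r (s.reg r) = s := by
  simp [Memory.set]

def Memory.append (s : Memory R β) (u : List β) : Memory R β := ⟨s.reg, s.out ++ u⟩

theorem Memory.append_reg (s : Memory R β) (u : List β) : (s.append u).reg = s.reg := rfl

theorem Memory.append_out (s : Memory R β) (u : List β) : (s.append u).out = s.out ++ u := rfl

/-- All registers hold numbers of at most `ℓ` bits. -/
def Memory.Valid (ℓ : ℕ) (s : Memory R β) : Prop := ∀ r, s.reg r < 2 ^ ℓ

theorem Memory.Valid.append {ℓ : ℕ} {s : Memory R β} (h : s.Valid ℓ) (u : List β) :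
    (s.append u).Valid ℓ := h

theorem Memory.Valid.set {ℓ : ℕ} {s : Memory R β} (h : s.Valid ℓ) (r : R) {x : ℕ}
    (hx : x < 2 ^ ℓ) : (s.set r x).Valid ℓ := fun r' => by
  rw [Memory.set_reg]; split
  exacts [hx, h r']

namespace Program

variable {w : List α} {ℓ : ℕ}

theorem exec_valid (p : Program R α β) {s : Memory R β} (hs : s.Valid ℓ) :
    (p.exec w ℓ s).Valid ℓ := by
  induction p generalizing s with
  | skip => exact hs
  | emit x => exact hs
  | emitCell r f => exact hs
  | sweep d b f =>
    have := hs.set d (sweepResult_lt f ℓ b s.reg)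
    exact this
  | seq p q ihp ihq => exact ihq (ihp hs)
  | ite t p q ihp ihq =>
    simp only [exec]
    split
    exacts [ihp hs, ihq hs]
  | loop r p ih =>
    refine Memory.Valid.set ?_ r (by positivity)
    have : ∀ (m i : ℕ), i + m ≤ 2 ^ ℓ → ∀ s : Memory R β, s.Valid ℓ →
        ((List.range' i m).foldl (fun s i => p.exec w ℓ (s.set r i)) s).Valid ℓ := by
      intro m
      induction m with
      | zero => intro i _ s hs; exact hs
      | succ m ihm =>
        intro i hi s hs
        rw [List.range'_succ, List.foldl_cons]
        exact ihm (i + 1) (by omega) _ (ih (hs.set r (by omega)))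
    exact this _ 0 (by omega) s hs

/-- The invariant must ignore the loop register (`hP`), which is set before each round and reset at
the end. In return, a round may use that the loop register is `i` and that all registers the loop
does not write still have their initial values. -/
theorem exec_loop_inv {r : R} {p : Program R α β} (hr : ¬ p.Writes r) {s : Memory R β}
    (hs : s.Valid ℓ) (P : ℕ → Memory R β → Prop) (hP : ∀ i τ a, P i τ → P i (τ.set r a))
    (h0 : P 0 s)
    (step : ∀ i τ, i < 2 ^ ℓ → τ.Valid ℓ → (∀ x, x ≠ r → ¬ p.Writes x → τ.reg x = s.reg x) →
      τ.reg r = i → P i τ → P (i + 1) (p.exec w ℓ τ)) :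
    P (2 ^ ℓ) ((loop r p).exec w ℓ s) := by
  refine hP _ _ _ ?_
  have : ∀ (m i : ℕ), i + m = 2 ^ ℓ → ∀ τ : Memory R β, τ.Valid ℓ →
      (∀ x, x ≠ r → ¬ p.Writes x → τ.reg x = s.reg x) → P i τ →
      P (2 ^ ℓ) ((List.range' i m).foldl (fun s i => p.exec w ℓ (s.set r i)) τ) := by
    intro m
    induction m with
    | zero =>
      intro i hi τ _ _ h
      obtain rfl : i = 2 ^ ℓ := by omega
      exact h
    | succ m ihm =>
      intro i hi τ hτ hfr h
      rw [List.range'_succ, List.foldl_cons]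
      have hfr' : ∀ x, x ≠ r → ¬ p.Writes x → (τ.set r i).reg x = s.reg x := fun x hx hw => by
        rw [Memory.set_reg, if_neg hx, hfr x hx hw]
      refine ihm (i + 1) (by omega) _ (exec_valid p (hτ.set r (by omega))) (fun x hx hw => ?_) ?_
      · rw [exec_reg hw, hfr' x hx hw]
      · exact step i _ (by omega) (hτ.set r (by omega)) hfr' (by simp [Memory.set_reg])
          (hP _ _ _ h)
  exact this _ 0 (by omega) s hs (fun _ _ _ => rfl) h0

theorem exec_loop_out {r : R} {p : Program R α β} (hr : ¬ p.Writes r) {s : Memory R β}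
    (hs : s.Valid ℓ) (u : ℕ → List β)
    (step : ∀ i τ, i < 2 ^ ℓ → τ.Valid ℓ → (∀ x, x ≠ r → ¬ p.Writes x → τ.reg x = s.reg x) →
      τ.reg r = i → (p.exec w ℓ τ).out = τ.out ++ u i) :
    ((loop r p).exec w ℓ s).out = s.out ++ (List.range (2 ^ ℓ)).flatMap u := by
  refine exec_loop_inv hr hs (fun i τ => τ.out = s.out ++ (List.range i).flatMap u)
    (fun _ _ _ h => h) (by simp) fun i τ hi hτ hfr hri h => ?_
  rw [step i τ hi hτ hfr hri, h, List.range_succ, List.flatMap_append]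
  simp

/-! ### Elementary programs -/

def clear (d : R) : Program R α β := sweep d true fun c _ => (c, false, none)

def copy (d r : R) : Program R α β := sweep d true fun c col => (c, col r, none)

def complement (d r : R) : Program R α β := sweep d true fun c col => (c, !col r, none)

def incr (d : R) : Program R α β := sweep d true fun c col => (c && col d, xor c (col d), none)

/-- Replace `x` by `2 x + 1`. -/
def double (d : R) : Program R α β := sweep d true fun c col => (col d, c, none)

/-- Append one `x` for each one in the binary expansion of the register `r`, and clear `d`. -/
def emitBits (d r : R) (x : β) : Program R α β :=
  sweep d true fun c col => (c, false, if col r then some x else none)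

/-- Append one `x` for each one in the last block of ones in the binary expansion of the
register `r`. -/
def emitTail (d r : R) (x : β) : Program R α β :=
  sweep d true fun c col => (c && col r, false, if c && col r then some x else none)

def emitWord : List β → Program R α β
  | [] => skip
  | x :: u => seq (emit x) (emitWord u)

theorem exec_seq (p q : Program R α β) (s : Memory R β) :
    (seq p q).exec w ℓ s = q.exec w ℓ (p.exec w ℓ s) := rfl

theorem exec_skip (s : Memory R β) : (skip : Program R α β).exec w ℓ s = s := rfl

theorem exec_ite (t : Test R α) (p q : Program R α β) (s : Memory R β) :
    (ite t p q).exec w ℓ s = if t.eval w ℓ s.reg then p.exec w ℓ s else q.exec w ℓ s := rfl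

theorem exec_clear (d : R) (s : Memory R β) : (clear d).exec w ℓ s = s.set d 0 := by
  simp [clear, exec, sweepResult_zero, Memory.set]

theorem exec_copy {d r : R} {s : Memory R β} (hs : s.Valid ℓ) :
    (copy d r).exec w ℓ s = s.set d (s.reg r) := by
  simp [copy, exec, Memory.set,
    sweepResult_copy (fun col : R → Bool => col r) (fun _ x => x) r (fun _ _ _ _ => rfl) rfl
      (fun _ => rfl) ℓ true s.reg (hs r)]

theorem exec_complement {d r : R} {s : Memory R β} (hs : s.Valid ℓ) :
    (complement d r).exec w ℓ s = s.set d (2 ^ ℓ - 1 - s.reg r) := by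
  simp [complement, exec, Memory.set,
    sweepResult_copy (fun col : R → Bool => !col r) (fun ℓ x => 2 ^ ℓ - 1 - x) r
      (fun ℓ b x hx => by cases b <;> simp [Nat.bit_val, pow_succ] <;> omega) rfl
      (fun _ => rfl) ℓ true s.reg (hs r)]

theorem exec_incr {d : R} {s : Memory R β} (hs : s.Valid ℓ) :
    (incr d).exec w ℓ s = s.set d ((s.reg d + 1) % 2 ^ ℓ) := by
  simp [incr, exec, Memory.set, sweepResult_incr d ℓ true s.reg (hs d)]

theorem exec_double (d : R) (s : Memory R β) :
    (double d).exec w ℓ s = s.set d ((2 * s.reg d + 1) % 2 ^ ℓ) := by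
  simp [double, exec, Memory.set, sweepResult_double d ℓ true s.reg]

theorem exec_emitBits {d r : R} {x : β} {s : Memory R β} {h : ℕ} (hℓ : h ≤ ℓ)
    (hr : s.reg r = 2 ^ h - 1) :
    (emitBits d r x).exec w ℓ s = (s.set d 0).append (List.replicate h x) := by
  simp [emitBits, exec, sweepResult_emitBits r x h ℓ hℓ true s.reg hr, Memory.set, Memory.append]

theorem exec_emitTail {d r : R} {x : β} {s : Memory R β} (hs : s.Valid ℓ) :
    (emitTail d r x).exec w ℓ s =
      (s.set d 0).append (List.replicate (trailingOnes (s.reg r)) x) := by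
  simp only [emitTail, exec, sweepResult_emitTail r x ℓ true s.reg (hs r), if_true, Memory.set,
    Memory.append]

theorem exec_emitWord (u : List β) (s : Memory R β) :
    (emitWord u).exec w ℓ s = s.append u := by
  induction u generalizing s with
  | nil => simp [emitWord, exec, Memory.append]
  | cons x u ih => simp [emitWord, exec, ih, Memory.append]

theorem writes_emitWord (u : List β) (r : R) : ¬ (emitWord u : Program R α β).Writes r := by
  induction u with
  | nil => exact id
  | cons x u ih => rw [emitWord, Writes, not_or]; exact ⟨id, ih⟩

theorem wellFormed_emitWord (u : List β) : (emitWord u : Program R α β).WellFormed := by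
  induction u with
  | nil => trivial
  | cons x u ih => exact ⟨trivial, ih⟩

end Program

/-! ### Tests on registers -/

namespace Test

def eq (a d : R) : Test R α := .bits true fun c col => c && (col a == col d)

def lt (a d : R) : Test R α := .bits false fun c col => if col a = col d then c else col d

def isZero (a : R) : Test R α := .bits true fun c col => c && (col a == false)

variable {w : List α} {ℓ : ℕ}

theorem eval_eq {a d : R} {s : Memory R β} (hs : s.Valid ℓ) :
    (eq a d).eval w ℓ s.reg = decide (s.reg a = s.reg d) := by
  simp [eq, eval, foldBits_eq a d ℓ true s.reg (hs a) (hs d)]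

theorem eval_lt {a d : R} {s : Memory R β} (hs : s.Valid ℓ) :
    (lt a d).eval w ℓ s.reg = decide (s.reg a < s.reg d) := by
  simp [lt, eval, foldBits_lt a d ℓ false s.reg (hs a) (hs d)]

theorem eval_isZero {a : R} {s : Memory R β} (hs : s.Valid ℓ) :
    (isZero a).eval w ℓ s.reg = decide (s.reg a = 0) := by
  rw [isZero, eval, foldBits_isZero a ℓ true s.reg (hs a), Bool.true_and]

end Test

end Logspace

/-! ### Words of balanced trees -/

open TensorFormula (binaryCode)

/-- The word of a complete binary tree of height `h` with leaves `f 0, …, f (2 ^ h - 1)`. -/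
def treeWord {Γ : Type*} (op : Delimiter) :
    ℕ → (ℕ → List (FormulaSymbol Γ)) → List (FormulaSymbol Γ)
  | 0, f => f 0
  | h + 1, f => treeWord op h fun i => binaryCode op (f (2 * i)) (f (2 * i + 1))

/-- What is written between leaf `i` and the next leaf, or the end, of the word of a tree. -/
def treeSep {Γ : Type*} (op : Delimiter) (h i : ℕ) : List (FormulaSymbol Γ) :=
  List.replicate (Logspace.trailingOnes i) (.inr .rparen) ++
    if i + 1 = 2 ^ h then [] else
      .inr op :: List.replicate (Logspace.trailingOnes i) (.inr .lparen)

theorem flatMap_range_two_mul {β : Type*} (g : ℕ → List β) (n : ℕ) :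
    (List.range (2 * n)).flatMap g =
      (List.range n).flatMap fun i => g (2 * i) ++ g (2 * i + 1) := by
  induction n with
  | zero => rfl
  | succ n ih =>
    rw [show 2 * (n + 1) = 2 * n + 1 + 1 by ring, List.range_succ, List.range_succ,
      List.range_succ]
    simp [ih]

/-- In the induction for `treeWord_eq`, `x` is an opening parenthesis: one from the initial block
moves in front of the first pair of leaves, and those that end the separators move in front of the
following pairs. -/
theorem flatMap_range_shift {β : Type*} (x : β) (A : ℕ → List β) (n : ℕ) (hn : 0 < n) :
    x :: (List.range n).flatMap (fun i => A i ++ if i + 1 = n then [] else [x]) =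
      (List.range n).flatMap fun i => x :: A i := by
  obtain ⟨m, rfl⟩ : ∃ m, n = m + 1 := ⟨n - 1, by omega⟩
  have h1 : (List.range m).flatMap (fun i => A i ++ if i + 1 = m + 1 then [] else [x]) =
      (List.range m).flatMap fun i => A i ++ [x] := by
    refine List.flatMap_congr fun i hi => ?_
    rw [if_neg (by have := List.mem_range.1 hi; omega)]
  have h2 : x :: (List.range m).flatMap (fun i => A i ++ [x]) =
      (List.range m).flatMap (fun i => x :: A i) ++ [x] := by
    clear h1 hn
    induction m with
    | zero => rfl
    | succ m ih =>
      rw [List.range_succ, List.flatMap_append, List.flatMap_append, ← List.cons_append, ih]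
      simp
  rw [List.range_succ, List.flatMap_append, List.flatMap_append, h1, ← List.cons_append, h2]
  simp

/-- After leaf `i` those subtrees are complete in which `i` is the last leaf; their number is the
number of trailing ones of `i`. As many subtrees begin at leaf `i + 1`, whose trailing zeros are
equally numerous. So a tree can be written leaf by leaf, with a counter in place of a stack. The
induction merges neighbouring leaves: `2 * i` has no trailing ones, and `2 * i + 1` has one more
than `i`. -/
theorem treeWord_eq {Γ : Type*} (op : Delimiter) (h : ℕ) (f : ℕ → List (FormulaSymbol Γ)) :
    treeWord op h f = List.replicate h (.inr .lparen) ++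
      (List.range (2 ^ h)).flatMap fun i => f i ++ treeSep op h i := by
  induction h generalizing f with
  | zero =>
    have : Logspace.trailingOnes 0 = 0 := Logspace.trailingOnes_bit_false 0
    simp [treeWord, treeSep, this]
  | succ h ih =>
    rw [treeWord, ih, pow_succ, mul_comm, flatMap_range_two_mul, List.replicate_succ',
      List.append_assoc]
    congr 1
    rw [List.singleton_append]
    refine Eq.trans ?_ (Eq.trans (flatMap_range_shift (.inr .lparen)
      (fun i => f (2 * i) ++ .inr op :: f (2 * i + 1) ++ .inr .rparen :: treeSep op h i)
      (2 ^ h) (by positivity)).symm ?_)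
    · refine List.flatMap_congr fun i _ => ?_
      simp [binaryCode]
    · congr 1
      refine List.flatMap_congr fun i hi => ?_
      have hi := List.mem_range.1 hi
      have e1 : 2 * i + 1 ≠ 2 ^ (h + 1) := by rw [pow_succ]; omega
      have e2 : 2 * i + 1 + 1 = 2 ^ (h + 1) ↔ i + 1 = 2 ^ h := by rw [pow_succ]; omega
      simp only [treeSep, Logspace.trailingOnes_bit_false, Logspace.trailingOnes_bit_true, e1,
        e2, if_false]
      split
      · simp [List.replicate_succ]
      · simp [List.replicate_succ, List.replicate_succ']
        rw [← List.replicate_succ, List.replicate_succ']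

namespace Logspace

open Transducer

variable {R : Type} {α β : Type*} [Finite α] [Finite β] [DecidableEq R]

/-- The cell holds a symbol that satisfies `f`. -/
def InputCell.symbolIs (f : α → Bool) : InputCell α → Bool
  | .symbol a => f a
  | _ => false

/-- Position `0` holds the left end marker, hence the shift by one. -/
theorem scan_append {w pre u post : List α} (hw : w = pre ++ u ++ post) {i : ℕ}
    (hi : i < u.length) : scan w (pre.length + 1 + i) = .symbol u[i] := by
  rw [show pre.length + 1 + i = pre.length + i + 1 by omega, scan, hw, List.append_assoc,
    List.getElem?_append_right (by omega), Nat.add_sub_cancel_left,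
    List.getElem?_append_left hi, List.getElem?_eq_getElem hi]

namespace Program

variable {w : List α} {ℓ : ℕ}

/-! ### Scanning a bracketed part of the input -/

/-- The scan is switched off as soon as the brackets read so far are balanced. As this is tested
after the current letter has been counted, the initial empty count does not stop it, and the
matching bracket is still scanned. -/
def scanTail (x on o c : R) (opn cls : α → Bool) : Program R α β :=
  seq (ite (.cell x (InputCell.symbolIs opn)) (incr o) skip)
    (seq (ite (.cell x (InputCell.symbolIs cls)) (incr c) skip)
      (ite (.eq o c) (clear on) skip))

/-- Run `body` for all positions `x` from position `b` to the matching bracket. -/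
def bracketScan (b x on o c : R) (opn cls : α → Bool) (body : Program R α β) : Program R α β :=
  seq (clear on) (seq (clear o) (seq (clear c) (loop x (seq (ite (.eq x b) (incr on) skip)
    (ite (.isZero on) skip (seq body (scanTail x on o c opn cls)))))))

theorem exec_scanTail {x on o c : R} {opn cls : α → Bool} {s : Memory R β} (hs : s.Valid ℓ)
    (ho : s.reg o + 1 < 2 ^ ℓ) (hc : s.reg c + 1 < 2 ^ ℓ) (hxo : x ≠ o) (hco : c ≠ o) (m k : ℕ)
    (hm : m = s.reg o + (InputCell.symbolIs opn (scan w (s.reg x))).toNat)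
    (hk : k = s.reg c + (InputCell.symbolIs cls (scan w (s.reg x))).toNat) :
    (scanTail x on o c opn cls).exec w ℓ s =
      if m = k then ((s.set o m).set c k).set on 0 else (s.set o m).set c k := by
  have h1 : (ite (.cell x (InputCell.symbolIs opn)) (incr o) skip : Program R α β).exec w ℓ s =
      s.set o m := by
    rw [exec_ite, Test.eval]
    cases h : InputCell.symbolIs opn (scan w (s.reg x))
    · simp [hm, h, exec_skip, Memory.set_self]
    · simp [hm, h, exec_incr hs, Nat.mod_eq_of_lt ho]
  have v1 : (s.set o m).Valid ℓ :=
    hs.set o (by have := (InputCell.symbolIs opn (scan w (s.reg x))).toNat_le; omega)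
  have h2 : (ite (.cell x (InputCell.symbolIs cls)) (incr c) skip : Program R α β).exec w ℓ
      (s.set o m) = (s.set o m).set c k := by
    have e1 : (s.set o m).reg x = s.reg x := by rw [Memory.set_reg, if_neg hxo]
    have e2 : (s.set o m).reg c = s.reg c := by rw [Memory.set_reg, if_neg hco]
    rw [exec_ite, Test.eval, e1]
    cases h : InputCell.symbolIs cls (scan w (s.reg x))
    · have := Memory.set_self (s.set o m) c
      rw [e2] at this
      simp [hk, h, exec_skip, this]
    · simp [hk, h, exec_incr v1, e2, Nat.mod_eq_of_lt hc]
  have v2 : ((s.set o m).set c k).Valid ℓ :=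
    v1.set c (by have := (InputCell.symbolIs cls (scan w (s.reg x))).toNat_le; omega)
  rw [scanTail, exec_seq, exec_seq, h1, h2, exec_ite, Test.eval_eq v2, exec_clear, exec_skip]
  simp [Memory.set_reg, hco.symm]

theorem countP_take_succ (f : α → Bool) (u : List α) {i : ℕ} (hi : i < u.length) :
    (u.take (i + 1)).countP f = (u.take i).countP f + (f u[i]).toNat := by
  rw [List.take_add_one, List.getElem?_eq_getElem hi, List.countP_append]
  cases h : f u[i] <;> simp [h]

/-- The counts agree for `u` but for none of its proper non-empty prefixes, so the scan is active
exactly on `u`. `Inv i` describes the memory after `i` letters of `u`; it must be insensitive to the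
four registers that control the scan. -/
theorem exec_bracketScan {b x on o c : R} {opn cls : α → Bool} {body : Program R α β}
    (hbx : b ≠ x) (hbon : b ≠ on) (hbo : b ≠ o) (hbc : b ≠ c) (hxon : x ≠ on) (hxo : x ≠ o)
    (hxc : x ≠ c) (hono : on ≠ o) (honc : on ≠ c) (hoc : o ≠ c)
    (wb : ¬ body.Writes b) (wx : ¬ body.Writes x) (won : ¬ body.Writes on) (wo : ¬ body.Writes o)
    (wc : ¬ body.Writes c) {pre u post : List α} (hw : w = pre ++ u ++ post)
    (hℓ : w.length + 1 < 2 ^ ℓ) (hne : u ≠ [])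
    (hu : ∀ i, 0 < i → i < u.length → (u.take i).countP opn ≠ (u.take i).countP cls)
    (hu' : u.countP opn = u.countP cls) {s : Memory R β} (hs : s.Valid ℓ)
    (hb : s.reg b = pre.length + 1) (Inv : ℕ → Memory R β → Prop)
    (hInv : ∀ i τ r a, (r = x ∨ r = on ∨ r = o ∨ r = c) → Inv i τ → Inv i (τ.set r a))
    (h0 : Inv 0 s)
    (step : ∀ i τ, i < u.length → τ.Valid ℓ → τ.reg x = pre.length + 1 + i →
      (∀ r, r ≠ x → r ≠ on → r ≠ o → r ≠ c → ¬ body.Writes r → τ.reg r = s.reg r) →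
      Inv i τ → Inv (i + 1) (body.exec w ℓ τ)) :
    Inv u.length ((bracketScan b x on o c opn cls body).exec w ℓ s) := by
  have hulen : 0 < u.length := List.length_pos_iff.2 hne
  have hwlen : w.length = pre.length + u.length + post.length := by
    simp [hw, Nat.add_assoc]
  set e := pre.length + 1 with he
  have hmain := exec_loop_inv (w := w) (ℓ := ℓ) (r := x)
    (p := seq (ite (.eq x b) (incr on) skip)
      (ite (.isZero on) skip (seq body (scanTail x on o c opn cls))))
    (s := ((s.set on 0).set o 0).set c 0)
    (by simp [Writes, scanTail, incr, clear, wx, hxon, hxo, hxc])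
    (((hs.set on (by positivity)).set o (by positivity)).set c (by positivity))
    -- Truncated subtraction makes all counts zero before `u`, and `take` and `min` freeze them
    -- after it. At `k = e` the register `on` is still `0`: it is set during that round, by the
    -- comparison with `b`.
    (fun k τ => τ.reg on = (if e < k ∧ k < e + u.length then 1 else 0) ∧
      τ.reg o = (u.take (k - e)).countP opn ∧ τ.reg c = (u.take (k - e)).countP cls ∧
      Inv (min (k - e) u.length) τ)
    (fun k τ a h => ⟨by simpa [Memory.set_reg, hxon.symm] using h.1,
      by simpa [Memory.set_reg, hxo.symm] using h.2.1,
      by simpa [Memory.set_reg, hxc.symm] using h.2.2.1, hInv _ _ _ _ (.inl rfl) h.2.2.2⟩)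
    ⟨by simp [Memory.set_reg, hono, honc], by simp [Memory.set_reg, hoc],
      by simp [Memory.set_reg], by
        simpa using hInv _ _ _ _ (by simp) (hInv _ _ _ _ (by simp) (hInv _ _ _ _ (by simp) h0))⟩
    ?_
  · rw [bracketScan, exec_seq, exec_seq, exec_seq, exec_clear, exec_clear, exec_clear]
    have := hmain.2.2.2
    rwa [min_eq_right (by omega)] at this
  · rintro k τ hk hτ hfr hx ⟨h1, h2, h3, h4⟩
    have hfr' : ∀ r, r ≠ x → r ≠ on → r ≠ o → r ≠ c → ¬ body.Writes r → τ.reg r = s.reg r := by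
      intro r r1 r2 r3 r4 r5
      rw [hfr r r1 (by simp [Writes, scanTail, incr, clear, r2, r3, r4, r5])]
      simp [Memory.set_reg, r2, r3, r4]
    have hbe : τ.reg b = e := by rw [hfr' b hbx hbon hbo hbc wb, hb]
    -- An active round, treated at once for the first letter, where `on` has just been set, and for
    -- the later ones.
    have hin : ∀ (i : ℕ) (σ : Memory R β), k = e + i → i < u.length → σ.Valid ℓ →
        σ.reg on = 1 → (∀ r, r ≠ on → σ.reg r = τ.reg r) → Inv i σ →
        (fun τ' : Memory R β => τ'.reg on = (if e < k + 1 ∧ k + 1 < e + u.length then 1 else 0) ∧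
          τ'.reg o = (u.take (k + 1 - e)).countP opn ∧
          τ'.reg c = (u.take (k + 1 - e)).countP cls ∧ Inv (min (k + 1 - e) u.length) τ')
        ((ite (.isZero on) skip (seq body (scanTail x on o c opn cls))).exec w ℓ σ) := by
      intro i σ hki hi hσ hon hστ hI
      have hIi := step i σ hi hσ (by rw [hστ x hxon, hx, hki])
        (fun r r1 r2 r3 r4 r5 => by rw [hστ r r2, hfr' r r1 r2 r3 r4 r5]) hI
      have vb := exec_valid (w := w) body hσ
      have eo : (body.exec w ℓ σ).reg o = (u.take i).countP opn := by
        rw [exec_reg wo, hστ o hono.symm, h2, hki, Nat.add_sub_cancel_left]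
      have ec : (body.exec w ℓ σ).reg c = (u.take i).countP cls := by
        rw [exec_reg wc, hστ c honc.symm, h3, hki, Nat.add_sub_cancel_left]
      have ex : (body.exec w ℓ σ).reg x = e + i := by
        rw [exec_reg wx, hστ x hxon, hx, hki]
      have len1 : (u.take i).countP opn ≤ i := List.countP_le_length.trans (by simp)
      have len2 : (u.take i).countP cls ≤ i := List.countP_le_length.trans (by simp)
      have hsc := scan_append hw hi
      have hrun := exec_scanTail (w := w) (on := on) (opn := opn) (cls := cls) vb
        (by omega) (by omega) hxo hoc.symm
        ((u.take (i + 1)).countP opn) ((u.take (i + 1)).countP cls)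
        (by rw [countP_take_succ _ _ hi, eo, ex, hsc]; rfl)
        (by rw [countP_take_succ _ _ hi, ec, ex, hsc]; rfl)
      have hk1 : k + 1 - e = i + 1 := by omega
      rw [exec_ite, Test.eval_isZero hσ, hon, exec_seq, hrun, hk1, min_eq_left (by omega)]
      simp only [one_ne_zero, decide_false, Bool.false_eq_true, if_false]
      by_cases hlast : i + 1 < u.length
      · have hd := hu (i + 1) (by omega) hlast
        rw [if_neg hd]
        refine ⟨?_, ?_, ?_, hInv _ _ _ _ (by simp) (hInv _ _ _ _ (by simp) hIi)⟩
        · rw [if_pos (by omega), Memory.set_reg, if_neg honc, Memory.set_reg, if_neg hono,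
            exec_reg won, hon]
        · simp [Memory.set_reg, hoc]
        · simp [Memory.set_reg]
      · have hd : (u.take (i + 1)).countP opn = (u.take (i + 1)).countP cls := by
          rw [List.take_of_length_le (by omega), hu']
        rw [if_pos hd]
        refine ⟨?_, ?_, ?_, hInv _ _ _ _ (by simp) (hInv _ _ _ _ (by simp)
          (hInv _ _ _ _ (by simp) hIi))⟩
        · rw [if_neg (by omega)]; simp [Memory.set_reg]
        · simp [Memory.set_reg, hoc, hono.symm]
        · simp [Memory.set_reg, honc.symm]
    have hfirst : (ite (.eq x b) (incr on) skip : Program R α β).exec w ℓ τ =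
        if k = e then (incr on).exec w ℓ τ else τ := by
      rw [exec_ite, Test.eval_eq hτ, hx, hbe, exec_skip]; simp
    rw [exec_seq, hfirst]
    rcases lt_trichotomy k e with hlt | heq | hgt
    · have hz : τ.reg on = 0 := by rw [h1, if_neg (by omega)]
      have z1 : k + 1 - e = 0 := by omega
      have z2 : k - e = 0 := by omega
      rw [z2] at h2 h3 h4
      rw [if_neg hlt.ne]
      rw [exec_ite, Test.eval_isZero hτ, hz]
      simp only [decide_true, if_true, exec_skip, z1]
      exact ⟨by rw [hz, if_neg (by omega)], h2, h3, h4⟩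
    · have hz : τ.reg on = 0 := by rw [h1, if_neg (by omega)]
      have h1ℓ : 1 % 2 ^ ℓ = 1 := Nat.mod_eq_of_lt (by omega)
      rw [if_pos heq, exec_incr hτ, hz, zero_add, h1ℓ]
      refine hin 0 (τ.set on 1) (by omega) hulen (hτ.set on (by omega))
        (by simp [Memory.set_reg]) (fun r hr => by rw [Memory.set_reg, if_neg hr]) ?_
      have : min (k - e) u.length = 0 := by omega
      rw [this] at h4
      exact hInv _ _ _ _ (by simp) h4
    · rw [if_neg hgt.ne']
      by_cases hlast : k < e + u.length
      · have hz : τ.reg on = 1 := by rw [h1, if_pos (by omega)]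
        refine hin (k - e) τ (by omega) (by omega) hτ hz (fun _ _ => rfl) ?_
        rwa [min_eq_left (by omega)] at h4
      · have hz : τ.reg on = 0 := by rw [h1, if_neg (by omega)]
        rw [exec_ite, Test.eval_isZero hτ, hz]
        simp only [decide_true, if_true, exec_skip]
        rw [List.take_of_length_le (by omega)] at h2 h3 ⊢
        rw [min_eq_right (by omega)] at h4 ⊢
        exact ⟨by rw [hz, if_neg (by omega)], h2, h3, h4⟩

end Program

end Logspace

namespace Logspace

open Transducer Program
open TensorFormula (binaryCode)

/-! ### The program that transforms gate arrays into tensor formulas -/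

/-- `mask` holds `2 ^ h - 1` for the common height `h` of all trees, `wires` the number `n`, and
`total` the number of wires and gates. `back` counts upwards, and its complement `level` is a
position that runs backwards through the input; `probe` is the cell after it. `slot` is the number
of the next leaf in the product of all gates, `num` the index of a wire within its gate, and `wire`
its number. `time` only limits repetitions, and `dummy` is the target of sweeps that are made for
their output alone. -/
inductive Register where
  | wires | total | mask | back | level | probe | gate | levelOn | levelOpen | levelClose | slot
  | arity | matrix | pos | on | opened | closed | wire | next | time | num | leaf | found | pad
  | dummy
  deriving DecidableEq

instance : Finite Register :=
  Finite.of_surjective (fun i : Fin 25 => Register.ofNat i) fun r =>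
    ⟨⟨r.ctorIdx, by cases r <;> decide⟩, by cases r <;> rfl⟩

/-- The words of the atomic formulas. -/
structure Atoms (Γ : Type*) where
  one : List (FormulaSymbol Γ)
  id : List (FormulaSymbol Γ)
  unit : Bool → List (FormulaSymbol Γ)
  ones : List (FormulaSymbol Γ)
  row : List (FormulaSymbol Γ)
  col : List (FormulaSymbol Γ)

def isLBracket {Γ : Type*} : ArraySymbol Γ → Bool
  | .inl (.inr .lbracket) => true
  | _ => false

def isRBracket {Γ : Type*} : ArraySymbol Γ → Bool
  | .inl (.inr .rbracket) => true
  | _ => false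

def isLParen {Γ : Type*} : ArraySymbol Γ → Bool
  | .inl (.inr .lparen) => true
  | _ => false

def isRParen {Γ : Type*} : ArraySymbol Γ → Bool
  | .inl (.inr .rparen) => true
  | _ => false

def isUnary {Γ : Type*} : ArraySymbol Γ → Bool
  | .inr _ => true
  | _ => false

def InputCell.formulaSymbol {Γ : Type*} : InputCell (ArraySymbol Γ) → Option (FormulaSymbol Γ)
  | .symbol (.inl a) => some a
  | _ => none

namespace ArrayProgram

variable {Γ : Type*} [Finite Γ]

abbrev Prog (Γ : Type*) := Program Register (ArraySymbol Γ) (FormulaSymbol Γ)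

abbrev Mem (Γ : Type*) := Memory Register (FormulaSymbol Γ)

def cellIs (r : Register) (f : ArraySymbol Γ → Bool) : Test Register (ArraySymbol Γ) :=
  .cell r (InputCell.symbolIs f)

/-- Write the word of an operation. -/
def binary (op : Delimiter) (p q : Prog Γ) : Prog Γ :=
  seq (emit (.inr .lparen)) (seq p (seq (emit (.inr op)) (seq q (emit (.inr .rparen)))))

/-- Writes `treeSep` for the leaf whose number is in `r`. The last leaf, which is not followed by an
operation, is recognized by its number being `mask`. -/
def sep (op : Delimiter) (r : Register) : Prog Γ :=
  seq (emitTail .dummy r (.inr .rparen)) (ite (.eq r .mask) skip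
    (seq (emit (.inr op)) (emitTail .dummy r (.inr .lparen))))

variable (A : Atoms Γ)

/-- Leaves from `size` on are `A.one`, which will be the `1 × 1` matrix `1`, neutral for the tensor
product. -/
def tensorTree (size : Register) (leaf : Prog Γ) : Prog Γ :=
  seq (emitBits .dummy .mask (.inr .lparen)) (loop .leaf (ite (.lt .mask .leaf) skip
    (seq (ite (.lt .leaf size) leaf (emitWord A.one)) (sep .otimes .leaf))))

/-- Fill a tree up with copies of a leaf. -/
def fill (op : Delimiter) (r : Register) (leaf : Prog Γ) : Prog Γ :=
  loop .pad (ite (.lt .mask r) skip (seq leaf (seq (sep op r) (incr r))))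

/-- Compute the length of the block of unary symbols after position `pos`. -/
def countUnary : Prog Γ :=
  seq (clear .wire) (seq (copy .next .pos) (seq (incr .next)
    (loop .time (ite (cellIs .next isUnary) (seq (incr .next) (incr .wire)) skip))))

/-- Run `body` for all wires of the gate at position `gate`. -/
def forWires (body : Prog Γ) : Prog Γ :=
  seq (clear .num) (bracketScan .gate .pos .on .opened .closed isLParen isRParen
    (ite (cellIs .pos isLBracket) (seq countUnary (seq body (incr .num))) skip))

/-- For the diagonal projection on the vectors whose bit number `r` is `b`. -/
def spot (size r : Register) (b : Bool) : Prog Γ :=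
  tensorTree A size (ite (.eq .leaf r) (emitWord (A.unit b)) (emitWord A.id))

/-- `P₀ ⊗ P₀ + P₁ ⊗ P₁`: the diagonal projection on the vectors in which auxiliary bit `num` equals
bit `wire`. -/
def linkLeaf : Prog Γ :=
  binary .plus (binary .otimes (spot A .arity .num false) (spot A .wires .wire false))
    (binary .otimes (spot A .arity .num true) (spot A .wires .wire true))

def constTree (size : Register) (u : List (FormulaSymbol Γ)) : Prog Γ :=
  tensorTree A size (emitWord u)

def link : Prog Γ :=
  seq (emitBits .dummy .mask (.inr .lparen))
    (seq (forWires (seq (linkLeaf A) (sep .times .num)))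
      (fill .times .num (binary .otimes (constTree A .arity A.id) (constTree A .wires A.id))))

/-- On the wires of the gate the all-ones matrix puts no condition on the bits, which are the
business of the matrix of the gate; off them the identity forces agreement. -/
def fresh : Prog Γ :=
  tensorTree A .wires (seq (clear .found) (seq
    (forWires (ite (.eq .wire .leaf) (seq (clear .found) (incr .found)) skip))
    (ite (.isZero .found) (emitWord A.id) (emitWord A.ones))))

/-- Copy the matrix of the gate at position `gate`. -/
def copyMatrix : Prog Γ :=
  seq (bracketScan .gate .pos .on .opened .closed isLParen isRParen (copy .matrix .pos))
    (seq (incr .matrix) (bracketScan .matrix .pos .on .opened .closed isLBracket isRBracket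
      (emitCell .pos InputCell.formulaSymbol)))

/-- The outer factors add and remove auxiliary bits, one for each wire of the gate. The links force
these bits to be copies of the bits on the wires, so the gate may act on the adjacent copies. -/
def gateProg : Prog Γ :=
  seq (seq (clear .arity) (forWires (incr .arity)))
    (binary .times (binary .times (binary .times (binary .times
      (binary .otimes (constTree A .arity A.row) (constTree A .wires A.id)) (link A))
      (binary .otimes copyMatrix (fresh A))) (link A))
      (binary .otimes (constTree A .arity A.col) (constTree A .wires A.id)))

/-- In a gate array the code of a gate contains a single opening parenthesis, its first letter; thus
such a letter marks a gate. -/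
def levelProg : Prog Γ :=
  bracketScan .level .gate .levelOn .levelOpen .levelClose isLBracket isRBracket
    (ite (cellIs .gate isLParen) (seq (gateProg A) (seq (sep .times .slot) (incr .slot))) skip)

/-- The gates are counted by their opening parentheses, and `mask` becomes the least number `2 ^ h -
1` that is not below `total`. -/
def prepare : Prog Γ :=
  seq (seq (clear .pos) (seq countUnary (copy .wires .wire)))
    (seq (seq (copy .total .wires) (loop .pos (ite (cellIs .pos isLParen) (incr .total) skip)))
      (seq (clear .mask) (loop .time (ite (.lt .mask .total) (double .mask) skip))))

/-- Later levels are left factors, so the input is searched backwards. A non-empty level starts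
where an opening bracket is directly followed by an opening parenthesis; empty levels are identities
and may be skipped. -/
def main : Prog Γ :=
  seq prepare (seq (emitBits .dummy .mask (.inr .lparen)) (seq (clear .slot) (seq
    (loop .back (seq (complement .level .back) (ite (cellIs .level isLBracket)
      (seq (copy .probe .level) (seq (incr .probe)
        (ite (cellIs .probe isLParen) (levelProg A) skip))) skip)))
    (fill .times .slot (constTree A .wires A.id)))))

attribute [local simp] Program.Writes binary sep tensorTree fill countUnary forWires spot linkLeaf
  constTree link fresh copyMatrix gateProg levelProg prepare main bracketScan scanTail
  writes_emitWord Program.clear Program.copy Program.complement Program.incr Program.double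
  emitBits emitTail in
theorem main_wellFormed : (main A).WellFormed := by
  simp [Program.WellFormed, wellFormed_emitWord]

end ArrayProgram
end Logspace

namespace Logspace

open Transducer Program
open TensorFormula (binaryCode)

namespace ArrayProgram

variable {Γ : Type*} [Finite Γ] (A : Atoms Γ)

/-! ### The words written by the program -/

def tensorWord (h s : ℕ) (f : ℕ → List (FormulaSymbol Γ)) : List (FormulaSymbol Γ) :=
  treeWord .otimes h fun i => if i < s then f i else A.one

def spotWord (h s j : ℕ) (b : Bool) : List (FormulaSymbol Γ) :=
  tensorWord A h s fun i => if i = j then A.unit b else A.id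

def linkLeafWord (h k n j v : ℕ) : List (FormulaSymbol Γ) :=
  binaryCode .plus (binaryCode .otimes (spotWord A h k j false) (spotWord A h n v false))
    (binaryCode .otimes (spotWord A h k j true) (spotWord A h n v true))

def pairWord (h k n : ℕ) (u : List (FormulaSymbol Γ)) : List (FormulaSymbol Γ) :=
  binaryCode .otimes (tensorWord A h k fun _ => u) (tensorWord A h n fun _ => A.id)

def linkWord (h n : ℕ) (ms : List ℕ) : List (FormulaSymbol Γ) :=
  treeWord .times h fun j =>
    if j < ms.length then linkLeafWord A h ms.length n j (ms.getD j 0)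
    else pairWord A h ms.length n A.id

def freshWord (h n : ℕ) (ms : List ℕ) : List (FormulaSymbol Γ) :=
  tensorWord A h n fun i => if i ∈ ms then A.ones else A.id

def gateWord (h n : ℕ) (ms : List ℕ) (mat : List (FormulaSymbol Γ)) : List (FormulaSymbol Γ) :=
  binaryCode .times (binaryCode .times (binaryCode .times (binaryCode .times
    (pairWord A h ms.length n A.row) (linkWord A h n ms))
    (binaryCode .otimes mat (freshWord A h n ms))) (linkWord A h n ms))
    (pairWord A h ms.length n A.col)

/-! ### Programs whose output depends on some registers only -/

/-- Started with the values `ρ r` in the registers `r ∈ S`, the program writes the word `u`. -/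
def Emits (w : List (ArraySymbol Γ)) (ℓ : ℕ) (p : Prog Γ) (S : List Register)
    (ρ : Register → ℕ) (u : List (FormulaSymbol Γ)) : Prop :=
  ∀ s : Mem Γ, s.Valid ℓ → (∀ r ∈ S, s.reg r = ρ r) → (p.exec w ℓ s).out = s.out ++ u

variable {w : List (ArraySymbol Γ)} {ℓ h : ℕ} {S : List Register} {ρ : Register → ℕ}
  {p q : Prog Γ} {u v : List (FormulaSymbol Γ)}

theorem emits_emitWord (u : List (FormulaSymbol Γ)) : Emits w ℓ (emitWord u) S ρ u :=
  fun s _ _ => by rw [exec_emitWord]; rfl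

theorem Emits.mono {S' : List Register} {ρ' : Register → ℕ} (hp : Emits w ℓ p S ρ u)
    (hS : ∀ r ∈ S, r ∈ S' ∧ ρ' r = ρ r) : Emits w ℓ p S' ρ' u :=
  fun s hs hr => hp s hs fun r hrS => (hr r (hS r hrS).1).trans (hS r hrS).2

/-- The second program has to find the registers in `S` unchanged; hence the condition on what `p`
writes. -/
theorem Emits.binary {op : Delimiter} (hp : Emits w ℓ p S ρ u) (hq : Emits w ℓ q S ρ v)
    (hw : ∀ r ∈ S, ¬ p.Writes r) : Emits w ℓ (binary op p q) S ρ (binaryCode op u v) := by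
  intro s hs hr
  simp only [ArrayProgram.binary, exec_seq]
  have h1 := hp ((emit (.inr .lparen)).exec w ℓ s) (exec_valid _ hs) hr
  have v1 := exec_valid (w := w) p (exec_valid (w := w) (emit (.inr .lparen)) hs)
  have h2 := hq ((emit (.inr op)).exec w ℓ (p.exec w ℓ ((emit (.inr .lparen)).exec w ℓ s)))
    (exec_valid _ v1) (fun r hrS => (exec_reg (hw r hrS) _).trans (hr r hrS))
  have h3 : ∀ (x : FormulaSymbol Γ) (s : Mem Γ), ((emit x).exec w ℓ s).out = s.out ++ [x] :=
    fun _ _ => rfl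
  rw [h3, h2, h3, h1, h3]
  simp [binaryCode]

theorem exec_sep {op : Delimiter} {r : Register} {s : Mem Γ} (hs : s.Valid ℓ)
    (hm : s.reg .mask = 2 ^ h - 1) (hr : r ≠ .dummy) :
    (sep op r).exec w ℓ s = (s.set .dummy 0).append (treeSep op h (s.reg r)) := by
  have e1 : ∀ u, ((s.set .dummy 0).append u).reg r = s.reg r := fun u => by
    rw [Memory.append_reg, Memory.set_reg, if_neg hr]
  have e2 : ∀ u, ((s.set .dummy 0).append u).reg .mask = 2 ^ h - 1 := fun u => by
    rw [Memory.append_reg, Memory.set_reg, if_neg (by simp), hm]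
  have hv : ∀ u, ((s.set .dummy 0).append u).Valid ℓ := fun u =>
    (hs.set .dummy (by positivity)).append u
  have hp : 0 < 2 ^ h := by positivity
  rw [sep, exec_seq, exec_emitTail hs, exec_ite, Test.eval_eq (hv _), e1, e2, treeSep]
  by_cases hlast : s.reg r + 1 = 2 ^ h
  · have : s.reg r = 2 ^ h - 1 := by omega
    simp [this, exec_skip, Nat.sub_add_cancel hp]
  · have : s.reg r ≠ 2 ^ h - 1 := by omega
    simp only [this, decide_false, Bool.false_eq_true, if_false, exec_seq, hlast]
    have e3 : ∀ t : Mem Γ, (emit (.inr op)).exec w ℓ t = t.append [.inr op] := fun _ => rfl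
    rw [e3, exec_emitTail ((hv _).append _), Memory.append_reg, e1]
    simp [Memory.set, Memory.append]

attribute [local simp] Program.Writes ArrayProgram.binary sep tensorTree fill countUnary forWires
  spot linkLeaf constTree link fresh copyMatrix gateProg levelProg prepare main bracketScan scanTail
  writes_emitWord Program.clear Program.copy Program.complement Program.incr Program.double
  emitBits emitTail

theorem flatMap_range_ite {β : Type*} (g : ℕ → List β) {m n : ℕ} (h : m ≤ n) :
    ((List.range n).flatMap fun i => if i < m then g i else []) = (List.range m).flatMap g := by
  induction n, h using Nat.le_induction with
  | base => exact List.flatMap_congr fun i hi => if_pos (List.mem_range.1 hi)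
  | succ n hn ih => rw [List.range_succ, List.flatMap_append, ih]; simp [hn.not_gt]

theorem Emits.tensorTree {size : Register} {f : ℕ → List (FormulaSymbol Γ)} (hh : h ≤ ℓ)
    (hm : .mask ∈ S) (hρ : ρ .mask = 2 ^ h - 1) (hsz : size ∈ S) (hl : .leaf ∉ S)
    (hd : .dummy ∉ S) (hpS : ∀ r ∈ S, ¬ p.Writes r) (hpl : ¬ p.Writes .leaf)
    (hp : ∀ i < ρ size, Emits w ℓ p (.leaf :: S) (Function.update ρ .leaf i) (f i)) :
    Emits w ℓ (tensorTree A size p) S ρ (tensorWord A h (ρ size) f) := by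
  intro s hs hr
  have hne : ∀ r ∈ S, r ≠ .leaf ∧ r ≠ .dummy := fun r hr =>
    ⟨fun e => hl (e ▸ hr), fun e => hd (e ▸ hr)⟩
  rw [ArrayProgram.tensorTree, exec_seq, exec_emitBits hh ((hr _ hm).trans hρ)]
  -- The loop passes through all `2 ^ ℓ` values; those from `2 ^ h` on contribute the empty word and
  -- are removed by `flatMap_range_ite`.
  rw [exec_loop_out (by simp [hpl]) 
    ((hs.set .dummy (by positivity)).append _) (fun i => if i < 2 ^ h then
      (if i < ρ size then f i else A.one) ++ treeSep .otimes h i else [])]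
  · rw [flatMap_range_ite _ (Nat.pow_le_pow_right two_pos hh), tensorWord, treeWord_eq]
    simp [Memory.append_out, Memory.set_out]
  · intro i τ hi hτ hfr hli
    have hS : ∀ r ∈ S, τ.reg r = ρ r := by
      intro r hrS
      rw [hfr r (hne r hrS).1 (by simp [hpS r hrS, (hne r hrS).2]), ← hr r hrS]
      simp [Memory.append_reg, Memory.set_reg, (hne r hrS).2]
    have hmask : τ.reg .mask = 2 ^ h - 1 := (hS _ hm).trans hρ
    have hp0 : 0 < 2 ^ h := by positivity
    rw [exec_ite, Test.eval_lt hτ, hmask, hli]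
    by_cases hi' : i < 2 ^ h
    · have e : ¬ (2 ^ h - 1 < i) := by omega
      simp only [e, decide_false, Bool.false_eq_true, if_false, hi', if_true]
      rw [exec_seq]
      set τ' := (ite (.lt .leaf size) p (emitWord A.one)).exec w ℓ τ with hτ'
      have hv' : τ'.Valid ℓ := exec_valid _ hτ
      have hm' : τ'.reg .mask = 2 ^ h - 1 := by
        rw [hτ', exec_reg (by simp [hpS _ hm]), hmask]
      have hl' : τ'.reg .leaf = i := by rw [hτ', exec_reg (by simp [hpl]), hli]
      rw [exec_sep hv' hm' (by simp), hl', Memory.append_out, Memory.set_out, ← List.append_assoc]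
      congr 1
      rw [hτ', exec_ite, Test.eval_lt hτ, hli, hS _ hsz]
      by_cases hs' : i < ρ size
      · simp only [hs', decide_true, if_true]
        refine hp i hs' τ hτ fun r hrS => ?_
        rcases List.mem_cons.1 hrS with rfl | hrS
        · simp [hli]
        · rw [hS r hrS, Function.update_of_ne (hne r hrS).1]
      · simp [hs', exec_emitWord, Memory.append_out]
    · have e : 2 ^ h - 1 < i := by omega
      simp [e, exec_skip, hi']

theorem emits_constTree {size : Register} (hh : h ≤ ℓ) (hm : .mask ∈ S)
    (hρ : ρ .mask = 2 ^ h - 1) (hsz : size ∈ S) (hl : .leaf ∉ S) (hd : .dummy ∉ S)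
    (u : List (FormulaSymbol Γ)) :
    Emits w ℓ (constTree A size u) S ρ (tensorWord A h (ρ size) fun _ => u) :=
  Emits.tensorTree A hh hm hρ hsz hl hd (by simp) (by simp) fun _ _ => emits_emitWord u

theorem emits_spot {size r : Register} (hh : h ≤ ℓ) (hm : .mask ∈ S)
    (hρ : ρ .mask = 2 ^ h - 1) (hsz : size ∈ S) (hl : .leaf ∉ S) (hd : .dummy ∉ S)
    (hr : r ∈ S) (b : Bool) :
    Emits w ℓ (spot A size r b) S ρ (spotWord A h (ρ size) (ρ r) b) := by
  refine Emits.tensorTree A hh hm hρ hsz hl hd (by simp) (by simp) fun i _ s hs hS => ?_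
  have h1 := hS .leaf (by simp)
  rw [Function.update_self] at h1
  have h2 := hS r (by simp [hr])
  rw [Function.update_of_ne (fun e : r = .leaf => hl (e ▸ hr))] at h2
  rw [exec_ite, Test.eval_eq hs, h1, h2]
  by_cases hi : i = ρ r <;> simp [hi, exec_emitWord, Memory.append_out]

theorem emits_linkLeaf (hh : h ≤ ℓ)
    (hS : ∀ r ∈ [Register.mask, .arity, .wires, .num, .wire], r ∈ S)
    (hρ : ρ .mask = 2 ^ h - 1) (hl : .leaf ∉ S) (hd : .dummy ∉ S) :
    Emits w ℓ (linkLeaf A) S ρ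
      (linkLeafWord A h (ρ .arity) (ρ .wires) (ρ .num) (ρ .wire)) := by
  have hne : ∀ r ∈ S, r ≠ .leaf ∧ r ≠ .dummy := fun r hr =>
    ⟨fun e => hl (e ▸ hr), fun e => hd (e ▸ hr)⟩
  have key : ∀ size r b, size ∈ S → r ∈ S →
      Emits w ℓ (spot A size r b) S ρ (spotWord A h (ρ size) (ρ r) b) :=
    fun size r b h1 h2 => emits_spot A hh (hS _ (by simp)) hρ h1 hl hd h2 b
  refine Emits.binary (Emits.binary (key _ _ _ ?_ ?_) (key _ _ _ ?_ ?_) ?_)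
    (Emits.binary (key _ _ _ ?_ ?_) (key _ _ _ ?_ ?_) ?_) ?_
  all_goals first
    | exact hS _ (by simp)
    | (intro r hr; simp [(hne r hr).1, (hne r hr).2])

theorem emits_pair (hh : h ≤ ℓ) (hS : ∀ r ∈ [Register.mask, .arity, .wires], r ∈ S)
    (hρ : ρ .mask = 2 ^ h - 1) (hl : .leaf ∉ S) (hd : .dummy ∉ S) (u : List (FormulaSymbol Γ)) :
    Emits w ℓ (ArrayProgram.binary .otimes (constTree A .arity u) (constTree A .wires A.id)) S ρ
      (pairWord A h (ρ .arity) (ρ .wires) u) := by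
  have hne : ∀ r ∈ S, r ≠ .leaf ∧ r ≠ .dummy := fun r hr =>
    ⟨fun e => hl (e ▸ hr), fun e => hd (e ▸ hr)⟩
  refine Emits.binary (emits_constTree A hh (hS _ (by simp)) hρ (hS _ (by simp)) hl hd u)
    (emits_constTree A hh (hS _ (by simp)) hρ (hS _ (by simp)) hl hd A.id) fun r hr => ?_
  simp [(hne r hr).1, (hne r hr).2]

/-- Rounds after the last leaf are idle. The inequality `h < ℓ` is strict because `r` finally
reaches `2 ^ h`, which must not overflow. -/
theorem exec_fill {op : Delimiter} {r : Register} (hh : h < ℓ) {s : Mem Γ} (hs : s.Valid ℓ)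
    (hm : s.reg .mask = 2 ^ h - 1) (hr : r ≠ .pad ∧ r ≠ .mask ∧ r ≠ .dummy)
    (hp : ¬ p.Writes r ∧ ¬ p.Writes .pad ∧ ¬ p.Writes .mask) (hk : s.reg r ≤ 2 ^ h)
    (hout : ∀ τ : Mem Γ, τ.Valid ℓ → (∀ x, x ≠ .pad → x ≠ r → x ≠ .dummy → ¬ p.Writes x →
      τ.reg x = s.reg x) → (p.exec w ℓ τ).out = τ.out ++ u) :
    ((fill op r p).exec w ℓ s).out = s.out ++
      (List.range' (s.reg r) (2 ^ h - s.reg r)).flatMap fun i => u ++ treeSep op h i := by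
  have hlt : 2 ^ h < 2 ^ ℓ := Nat.pow_lt_pow_right one_lt_two hh
  have hp0 : 0 < 2 ^ h := by positivity
  have := exec_loop_inv (w := w) (r := .pad) (p := ite (.lt .mask r) skip
      (seq p (seq (sep op r) (incr r)))) (by simp [hp, hr.1.symm]) hs
    -- `m` is the number of leaves added: one in each round until the tree is full.
    (fun t τ => ∃ m, τ.reg r = s.reg r + m ∧ s.reg r + m ≤ 2 ^ h ∧
      (s.reg r + m = 2 ^ h ∨ m = t) ∧ τ.out = s.out ++
      (List.range' (s.reg r) m).flatMap fun i => u ++ treeSep op h i)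
    (by rintro i τ a ⟨m, h1, h2, h3, h4⟩
        exact ⟨m, by simpa [Memory.set_reg, hr.1] using h1, h2, h3, h4⟩)
    ⟨0, by simp [hk]⟩ ?_
  · obtain ⟨m, h1, h2, h3, h4⟩ := this
    have hm : m = 2 ^ h - s.reg r := by omega
    rw [← hm]
    exact h4
  · rintro i τ hi hτ hfr hpad ⟨m, h1, h2, h3, h4⟩
    have hmτ : τ.reg .mask = 2 ^ h - 1 := by
      rw [hfr _ (by simp) (by simp [hp, hr.2.1.symm]), hm]
    rw [exec_ite, Test.eval_lt hτ, hmτ, h1]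
    by_cases hlast : s.reg r + m = 2 ^ h
    · have e : 2 ^ h - 1 < s.reg r + m := by omega
      simp only [e, decide_true, if_true, exec_skip]
      exact ⟨m, h1, h2, .inl hlast, h4⟩
    · have e : ¬ 2 ^ h - 1 < s.reg r + m := by omega
      simp only [e, decide_false, Bool.false_eq_true, if_false, exec_seq]
      have v1 := exec_valid (w := w) p hτ
      have r1 : (p.exec w ℓ τ).reg r = s.reg r + m := by rw [exec_reg hp.1, h1]
      rw [exec_sep v1 (by rw [exec_reg hp.2.2, hmτ]) hr.2.2, 
        exec_incr ((v1.set .dummy (by positivity)).append _)]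
      refine ⟨m + 1, ?_, by omega, by omega, ?_⟩
      · simp only [Memory.append_reg, Memory.set_reg, if_true, if_neg hr.2.2, r1]
        rw [Nat.mod_eq_of_lt (by omega)]
        ring
      · rw [Memory.set_out, Memory.append_out, Memory.set_out, hout τ hτ (fun x x1 x2 x3 x4 => hfr x x1 (by simp [x2, x3, x4])), h4,
          r1, List.range'_concat, List.flatMap_append]
        simp

end ArrayProgram
end Logspace

namespace Logspace

open Transducer Program
open TensorFormula (binaryCode)

/-! ### The lists of wires in the input -/

section Words

variable {Γ : Type*}

def wireCode (m : ℕ) : List (ArraySymbol Γ) :=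
  .inl (.inr .lbracket) :: unary m ++ [.inl (.inr .rbracket)]

def gateHead (ms : List ℕ) : List (ArraySymbol Γ) :=
  .inl (.inr .lparen) :: ms.flatMap wireCode ++ [.inl (.inr .rparen)]

theorem countP_unary {f : ArraySymbol Γ → Bool} (hf : f (.inr ()) = false) (m : ℕ) :
    (unary m : List (ArraySymbol Γ)).countP f = 0 := by
  simp [unary, List.countP_replicate, hf]

theorem countP_wireCode {f : ArraySymbol Γ → Bool} (hf : f (.inr ()) = false) (m : ℕ) :
    (wireCode m : List (ArraySymbol Γ)).countP f =
      (f (.inl (.inr .lbracket))).toNat + (f (.inl (.inr .rbracket))).toNat := by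
  simp only [wireCode, List.cons_append, List.countP_cons, List.countP_append, countP_unary hf,
    List.countP_nil]
  cases f (.inl (.inr .lbracket)) <;> cases f (.inl (.inr .rbracket)) <;> simp

theorem countP_flatMap_wireCode {f : ArraySymbol Γ → Bool} (hf : f (.inr ()) = false)
    (ms : List ℕ) :
    (ms.flatMap wireCode : List (ArraySymbol Γ)).countP f = ms.length *
      ((f (.inl (.inr .lbracket))).toNat + (f (.inl (.inr .rbracket))).toNat) := by
  induction ms with
  | nil => simp
  | cons m ms ih =>
    rw [List.flatMap_cons, List.countP_append, ih, countP_wireCode hf, List.length_cons]; ring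

/-- Opening brackets occur in the list only as first letters of wires. So the number of brackets
before one of them is the index of its wire, and the unary number follows immediately. -/
theorem wires_following (ms : List ℕ) {p t : List (ArraySymbol Γ)} {x : ArraySymbol Γ}
    (h : ms.flatMap wireCode ++ [.inl (.inr .rparen)] = p ++ x :: t) (hx : isLBracket x) :
    p.countP isLBracket < ms.length ∧ ∃ rest, t = unary (ms.getD (p.countP isLBracket) 0) ++
      .inl (.inr .rbracket) :: rest := by
  induction ms generalizing p with
  | nil =>
    have : x ∈ [(.inl (.inr .rparen) : ArraySymbol Γ)] := by
      rw [List.flatMap_nil, List.nil_append] at h; rw [h]; simp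
    rw [List.mem_singleton.1 this] at hx
    cases hx
  | cons m ms ih =>
    rw [List.flatMap_cons, List.append_assoc, List.append_eq_append_iff] at h
    rcases h with ⟨q, rfl, h2⟩ | ⟨q, h1, h2⟩
    · obtain ⟨h3, h4⟩ := ih h2
      rw [List.countP_append, countP_wireCode rfl]
      simp only [isLBracket, Bool.toNat_true, Bool.toNat_false, add_zero, List.length_cons]
      refine ⟨by omega, ?_⟩
      rw [add_comm 1, List.getD_cons_succ]
      exact h4
    · cases q with
      | nil =>
        rw [List.append_nil] at h1
        obtain ⟨h3, h4⟩ := ih (p := []) h2.symm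
        subst h1
        rw [countP_wireCode rfl]
        simp only [isLBracket, Bool.toNat_true, Bool.toNat_false, add_zero, List.length_cons]
        exact ⟨by simpa using h3, by simpa using h4⟩
      | cons y q =>
        rw [List.cons_append, List.cons.injEq] at h2
        obtain ⟨rfl, rfl⟩ := h2
        cases p with
        | nil =>
          rw [List.nil_append, wireCode, List.cons_append, List.cons.injEq] at h1
          refine ⟨by simp, _, by simp [← h1.2]; rfl⟩
        | cons z p =>
          rw [wireCode, List.cons_append, List.cons_append, List.cons.injEq] at h1
          have : x ∈ unary m ++ [(.inl (.inr .rbracket) : ArraySymbol Γ)] := by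
            rw [h1.2]; simp
          rcases List.mem_append.1 this with h | h
          · rw [List.eq_of_mem_replicate h] at hx; cases hx
          · rw [List.mem_singleton.1 h] at hx; cases hx

theorem countP_lparen_gateHead (ms : List ℕ) :
    (gateHead ms : List (ArraySymbol Γ)).countP isLParen = 1 := by
  rw [gateHead, List.countP_append, List.countP_cons, countP_flatMap_wireCode rfl]
  simp [isLParen]

theorem countP_rparen_gateHead (ms : List ℕ) :
    (gateHead ms : List (ArraySymbol Γ)).countP isRParen = 1 := by
  rw [gateHead, List.countP_append, List.countP_cons, countP_flatMap_wireCode rfl]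
  simp [isRParen]

theorem countP_lbracket_gateHead (ms : List ℕ) :
    (gateHead ms : List (ArraySymbol Γ)).countP isLBracket = ms.length := by
  rw [gateHead, List.countP_append, List.countP_cons, countP_flatMap_wireCode rfl]
  simp [isLBracket]

/-- The only closing parenthesis is the last letter, and the only opening one is the first. -/
theorem countP_take_gateHead (ms : List ℕ) {i : ℕ} (h0 : 0 < i)
    (hi : i < (gateHead ms : List (ArraySymbol Γ)).length) :
    ((gateHead ms : List (ArraySymbol Γ)).take i).countP isLParen ≠
      ((gateHead ms : List (ArraySymbol Γ)).take i).countP isRParen := by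
  have h1 : ((gateHead ms : List (ArraySymbol Γ)).take i).countP isRParen = 0 := by
    have e : (gateHead ms : List (ArraySymbol Γ)) =
      (.inl (.inr .lparen) :: ms.flatMap wireCode) ++ [.inl (.inr .rparen)] := rfl
    have e2 : i ≤ (.inl (.inr .lparen) :: ms.flatMap wireCode : List (ArraySymbol Γ)).length := by
      rw [e, List.length_append, List.length_singleton] at hi; omega
    rw [e, List.take_append_of_le_length e2]
    refine Nat.eq_zero_of_le_zero (((List.take_sublist _ _).countP_le).trans ?_)
    rw [List.countP_cons, countP_flatMap_wireCode rfl]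
    simp [isRParen]
  rw [h1]
  obtain ⟨i, rfl⟩ := Nat.exists_eq_succ_of_ne_zero h0.ne'
  simp [gateHead, List.countP_cons, isLParen]

end Words

/-! ### The loop over the wires of a gate -/

namespace ArrayProgram

variable {Γ : Type*} [Finite Γ] (A : Atoms Γ)
variable {w : List (ArraySymbol Γ)} {ℓ h : ℕ} {S : List Register} {ρ : Register → ℕ}
  {p q : Prog Γ} {u v : List (FormulaSymbol Γ)}

attribute [local simp] Program.Writes ArrayProgram.binary sep tensorTree fill countUnary forWires
  spot linkLeaf constTree link fresh copyMatrix gateProg levelProg prepare main bracketScan scanTail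
  writes_emitWord Program.clear Program.copy Program.complement Program.incr Program.double
  emitBits emitTail

theorem eval_cellIs (r : Register) (f : ArraySymbol Γ → Bool) (reg : Register → ℕ) :
    (cellIs r f).eval w ℓ reg = InputCell.symbolIs f (scan w (reg r)) := rfl

/-- The loop makes `2 ^ ℓ` rounds, more than needed: once `next` points to the letter `y` after the
unary block, nothing moves any more. This is why the invariant contains `min t m`. -/
theorem exec_countUnary {pre post : List (ArraySymbol Γ)} {y : ArraySymbol Γ} {m : ℕ}
    (hw : w = pre ++ unary m ++ y :: post) (hy : isUnary y = false) (hℓ : w.length + 1 < 2 ^ ℓ)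
    {s : Mem Γ} (hs : s.Valid ℓ) (hpos : s.reg .pos = pre.length) :
    ((countUnary : Prog Γ).exec w ℓ s).reg .wire = m ∧
      ((countUnary : Prog Γ).exec w ℓ s).out = s.out := by
  have hlen : w.length = pre.length + m + 1 + post.length := by
    simp [hw, unary]; omega
  have v0 := hs.set .wire (x := 0) (by positivity)
  have v1 := v0.set .next (hs .pos)
  have v2 := exec_valid (w := w) (incr .next) v1
  have key := exec_loop_inv (w := w) (r := .time)
    (p := (ite (cellIs .next isUnary) (seq (incr .next) (incr .wire)) skip : Prog Γ))
    (by simp) v2 (fun t τ => τ.reg .next = pre.length + 1 + min t m ∧ τ.reg .wire = min t m ∧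
      τ.out = s.out) (fun t τ a h => by simpa [Memory.set_reg, Memory.set_out] using h) ?_ ?_
  · rw [min_eq_right (by omega)] at key
    rw [countUnary, exec_seq, exec_seq, exec_seq, exec_clear, exec_copy v0]
    have e : (s.set .wire 0).reg .pos = s.reg .pos := by simp [Memory.set_reg]
    rw [e]
    exact key.2
  · rw [exec_incr v1]
    simp only [Memory.set_reg, Memory.set_out, if_true, hpos, reduceCtorEq, if_false]
    refine ⟨?_, by simp, trivial⟩
    rw [Nat.mod_eq_of_lt (by omega)]; simp
  · rintro t τ ht hτ hfr htime ⟨h1, h2, h3⟩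
    rw [exec_ite, cellIs, Test.eval, h1]
    by_cases htm : t < m
    · rw [min_eq_left htm.le] at h1 h2 ⊢
      have hsc : scan w (pre.length + 1 + t) = .symbol (.inr ()) := by
        rw [scan_append hw (by simpa [unary] using htm)]
        simp [unary]
      simp only [hsc, InputCell.symbolIs, isUnary, if_true, exec_seq, exec_incr hτ,
        exec_incr (exec_valid (w := w) (incr .next) hτ)]
      rw [min_eq_left (by omega)]
      have v3 := hτ.set .next (x := (τ.reg .next + 1) % 2 ^ ℓ) (Nat.mod_lt _ (by positivity))
      rw [exec_incr v3]
      simp only [Memory.set_reg, Memory.set_out, if_true, reduceCtorEq, if_false, h1, h2, h3]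
      rw [Nat.mod_eq_of_lt (by omega), Nat.mod_eq_of_lt (by omega)]
      simp; omega
    · rw [min_eq_right (by omega)] at h1 h2 ⊢
      have hsc : scan w (pre.length + 1 + m) = .symbol y := by
        have := scan_append (i := m) (u := unary m ++ [y]) (pre := pre) (post := post) (w := w)
          (by simp [hw]) (by simp [unary])
        rw [this]
        simp [unary]
      simp only [hsc, InputCell.symbolIs, hy, Bool.false_eq_true, if_false, exec_skip]
      rw [min_eq_right (by omega)]
      exact ⟨h1, h2, h3⟩

/-- Registers that the loop over the wires of a gate uses. -/
def wireRegisters : List Register :=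
  [.pos, .on, .opened, .closed, .num, .wire, .next, .time]

/-- `Inv j` describes the memory after `j` wires. It may mention the output and the registers
outside `wireRegisters` only, since the loop itself uses the others. -/
theorem exec_forWires {pre post : List (ArraySymbol Γ)} {ms : List ℕ} {body : Prog Γ}
    (hw : w = pre ++ gateHead ms ++ post) (hℓ : w.length + 1 < 2 ^ ℓ)
    {s : Mem Γ} (hs : s.Valid ℓ) (hg : s.reg .gate = pre.length + 1)
    (hb : ∀ r ∈ [Register.gate, .pos, .on, .opened, .closed, .num], ¬ body.Writes r)
    (Inv : ℕ → Mem Γ → Prop)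
    (hInv : ∀ j (τ τ' : Mem Γ), τ'.out = τ.out → (∀ r ∉ wireRegisters, τ'.reg r = τ.reg r) →
      Inv j τ → Inv j τ') (h0 : Inv 0 s)
    (step : ∀ j τ, j < ms.length → τ.Valid ℓ → τ.reg .num = j → τ.reg .wire = ms.getD j 0 →
      (∀ r ∉ wireRegisters, ¬ body.Writes r → τ.reg r = s.reg r) → Inv j τ →
      Inv (j + 1) (body.exec w ℓ τ)) :
    Inv ms.length ((forWires body).exec w ℓ s) ∧ 
      ((forWires body).exec w ℓ s).reg .num = ms.length := by
  have hsg : (s.set .num 0).reg .gate = pre.length + 1 := by simp [Memory.set_reg, hg]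
  have hpl : 0 < ℓ := Nat.pos_of_ne_zero fun e => by simp [e] at hℓ
  have hlen : ms.length ≤ w.length := by
    rw [← countP_lbracket_gateHead (Γ := Γ) ms, hw]
    refine List.countP_le_length.trans ?_
    simp; omega
  simp only [List.forall_mem_cons, List.not_mem_nil, IsEmpty.forall_iff, implies_true,
    and_true] at hb
  obtain ⟨b1, b2, b3, b4, b5, b6⟩ := hb
  rw [forWires, exec_seq, exec_clear]
  have key := exec_bracketScan (w := w) (ℓ := ℓ) (b := .gate) (x := .pos) (on := .on) (o := .opened)
    (c := .closed) (opn := isLParen) (cls := isRParen)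
    (body := (ite (cellIs .pos isLBracket) (seq countUnary (seq body (incr .num))) skip : Prog Γ))
    (by simp) (by simp) (by simp) (by simp) (by simp) (by simp) (by simp) (by simp) (by simp)
    (by simp) (by simp [b1]) (by simp [b2]) (by simp [b3]) (by simp [b4])
    (by simp [b5]) hw hℓ (by simp [gateHead]) (fun i h0 hi => countP_take_gateHead ms h0 hi)
    (by rw [countP_lparen_gateHead, countP_rparen_gateHead]) (hs.set .num (by positivity)) hsg
    (fun i τ => τ.reg .num = ((gateHead ms : List (ArraySymbol Γ)).take i).countP isLBracket ∧
      Inv (((gateHead ms : List (ArraySymbol Γ)).take i).countP isLBracket) τ)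
    ?_ ?_ ?_
  · simp only [List.take_length, countP_lbracket_gateHead] at key
    exact key.symm
  · rintro i τ r a hr ⟨h1, h2⟩
    refine ⟨?_, hInv _ τ _ rfl (fun r' hr' => ?_) h2⟩
    · rw [Memory.set_reg, if_neg (by rintro rfl; simp at hr), h1]
    · rw [Memory.set_reg, if_neg]
      rintro rfl
      rcases hr with rfl | rfl | rfl | rfl <;> simp [wireRegisters] at hr'
  · refine ⟨by simp [Memory.set_reg], hInv _ s _ rfl (fun r' hr' => ?_) h0⟩
    rw [Memory.set_reg, if_neg]
    rintro rfl
    simp [wireRegisters] at hr'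
  · rintro i τ hi hτ hx hfr ⟨h1, h2⟩
    have hev : (cellIs .pos isLBracket).eval w ℓ τ.reg = isLBracket (gateHead ms)[i] := by
      rw [eval_cellIs, hx, scan_append hw hi]; rfl
    rw [countP_take_succ _ _ hi, exec_ite, hev]
    by_cases hbr : isLBracket (gateHead ms)[i] = true
    swap
    · rw [if_neg hbr, Bool.eq_false_of_not_eq_true hbr]
      exact ⟨h1, h2⟩
    rw [if_pos hbr, hbr]
    have hi0 : i ≠ 0 := by rintro rfl; simp [gateHead, isLBracket] at hbr
    obtain ⟨k, rfl⟩ := Nat.exists_eq_succ_of_ne_zero hi0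
    obtain ⟨y, hy⟩ : ∃ y, y = (gateHead ms : List (ArraySymbol Γ))[k + 1] := ⟨_, rfl⟩
    obtain ⟨D, hD⟩ : ∃ D, D = (gateHead ms : List (ArraySymbol Γ)).drop (k + 1 + 1) := ⟨_, rfl⟩
    have hsplit : (gateHead ms : List (ArraySymbol Γ)) = (gateHead ms).take (k + 1) ++ y :: D := by
      rw [hy, hD, List.getElem_cons_drop, List.take_append_drop]
    replace hbr : isLBracket y = true := hy ▸ hbr
    obtain ⟨V, hV⟩ : ∃ V, V = (ms.flatMap wireCode ++ [.inl (.inr .rparen)] :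
      List (ArraySymbol Γ)) := ⟨_, rfl⟩
    have hVg : (gateHead ms : List (ArraySymbol Γ)) = .inl (.inr .lparen) :: V := by rw [hV]; rfl
    have hcount : ((gateHead ms : List (ArraySymbol Γ)).take (k + 1)).countP isLBracket =
        (V.take k).countP isLBracket := by
      simp [hVg, isLBracket]
    -- The bracket just met starts wire number `j`, where `j` counts the earlier brackets and is
    -- also the value of `num`.
    obtain ⟨f1, rest, f2⟩ := wires_following ms (p := V.take k) (x := y) (t := D) (by
        rw [hVg, List.take_succ_cons, List.cons_append, List.cons.injEq] at hsplit
        rw [← hV]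
        exact hsplit.2) hbr
    rw [← hcount] at f1 f2
    set j := ((gateHead ms : List (ArraySymbol Γ)).take (k + 1)).countP isLBracket with hj
    -- Positions start at `1` for letters, so the position of the bracket is the length of the
    -- prefix that ends with it.
    have hpos : τ.reg .pos = (pre ++ (gateHead ms).take (k + 1) ++ [y]).length := by
      rw [hx]; simp; omega
    have hw' : w = (pre ++ (gateHead ms).take (k + 1) ++ [y]) ++
        unary (ms.getD j 0) ++ .inl (.inr .rbracket) :: (rest ++ post) := by
      rw [hw]
      conv_lhs => rw [hsplit, f2]
      simp only [List.append_assoc, List.cons_append, List.nil_append]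
    obtain ⟨c1, c2⟩ := exec_countUnary hw' rfl hℓ hτ hpos
    have hcw : ∀ r ∉ wireRegisters, ((countUnary : Prog Γ).exec w ℓ τ).reg r = τ.reg r := by
      intro r hr
      refine exec_reg ?_ _
      simp [wireRegisters] at hr
      simp [hr]
    have vτ := exec_valid (w := w) (countUnary : Prog Γ) hτ
    have hnum : ((countUnary : Prog Γ).exec w ℓ τ).reg .num = j := by
      rw [exec_reg (by simp), h1]
    have hI := step j _ f1 vτ hnum c1 (fun r hr hb => by
      rw [hcw r hr, hfr r (by rintro rfl; simp [wireRegisters] at hr)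
        (by rintro rfl; simp [wireRegisters] at hr) (by rintro rfl; simp [wireRegisters] at hr)
        (by rintro rfl; simp [wireRegisters] at hr) (by
          simp [wireRegisters] at hr; simp [hr, hb]), Memory.set_reg, if_neg]
      rintro rfl; simp [wireRegisters] at hr) (hInv _ _ _ c2 hcw h2)
    have vb := exec_valid (w := w) body vτ
    simp only [exec_seq, exec_incr vb, Bool.toNat_true]
    have hnum' : (body.exec w ℓ ((countUnary : Prog Γ).exec w ℓ τ)).reg .num = j := by
      rw [exec_reg b6, hnum]
    rw [hnum', Nat.mod_eq_of_lt (by omega)]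
    refine ⟨by simp [Memory.set_reg],
      hInv _ (body.exec w ℓ ((countUnary : Prog Γ).exec w ℓ τ)) _ rfl (fun r hr => ?_) hI⟩
    rw [Memory.set_reg, if_neg]
    rintro rfl; simp [wireRegisters] at hr

end ArrayProgram
end Logspace

namespace Logspace

open Transducer Program
open TensorFormula (binaryCode)

/-! ### Balanced words -/

section Balanced

variable {α : Type*} {opn cls : α → Bool}

/-- Every prefix has at least as many opening as closing brackets, and the word has equally many. -/
def Balanced (opn cls : α → Bool) (u : List α) : Prop :=
  u.countP opn = u.countP cls ∧ ∀ p, p <+: u → p.countP cls ≤ p.countP opn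

theorem balanced_nil : Balanced opn cls [] :=
  ⟨rfl, fun p hp => by rw [List.prefix_nil.1 hp]; rfl⟩

theorem Balanced.append {u v : List α} (hu : Balanced opn cls u) (hv : Balanced opn cls v) :
    Balanced opn cls (u ++ v) := by
  refine ⟨by rw [List.countP_append, List.countP_append, hu.1, hv.1], fun p hp => ?_⟩
  obtain ⟨t, ht⟩ := hp
  rcases List.append_eq_append_iff.1 ht with ⟨q, h, -⟩ | ⟨q, rfl, h⟩
  · exact hu.2 p ⟨q, h.symm⟩
  · rw [List.countP_append, List.countP_append, hu.1]
    exact Nat.add_le_add_left (hv.2 q ⟨t, h.symm⟩) _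

theorem Balanced.flatMap {β : Type*} {l : List β} {f : β → List α}
    (h : ∀ b ∈ l, Balanced opn cls (f b)) : Balanced opn cls (l.flatMap f) := by
  induction l with
  | nil => exact balanced_nil
  | cons b l ih =>
    rw [List.flatMap_cons]
    exact (h b (by simp)).append (ih fun b hb => h b (by simp [hb]))

theorem balanced_of_neutral {u : List α} (ho : ∀ x ∈ u, opn x = false)
    (hc : ∀ x ∈ u, cls x = false) : Balanced opn cls u := by
  have h : ∀ (f : α → Bool), (∀ x ∈ u, f x = false) → ∀ p, p <+: u → p.countP f = 0 :=
    fun f hf p hp => List.countP_eq_zero.2 fun x hx => by simp [hf x (hp.subset hx)]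
  exact ⟨by rw [h _ ho _ List.prefix_rfl, h _ hc _ List.prefix_rfl],
    fun p hp => by rw [h _ hc p hp]; exact Nat.zero_le _⟩

/-- A word that ends with the bracket matching its first letter. -/
structure Block (opn cls : α → Bool) (u : List α) : Prop where
  ne_nil : u ≠ []
  take_ne : ∀ i, 0 < i → i < u.length → (u.take i).countP opn ≠ (u.take i).countP cls
  countP_eq : u.countP opn = u.countP cls

/-- In a proper prefix the outer opening bracket is still unmatched. -/
theorem Balanced.wrap_aux {u : List α} (hu : Balanced opn cls u) {a b : α} (ha : opn a = true)
    (ha' : cls a = false) {p : List α} (hp : p <+: (a :: u ++ [b])) (hne : p ≠ [])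
    (hlt : p.length < (a :: u ++ [b]).length) : p.countP cls < p.countP opn := by
  cases p with
  | nil => exact absurd rfl hne
  | cons x p =>
    rw [List.cons_append, List.cons_prefix_cons] at hp
    obtain ⟨rfl, hp⟩ := hp
    have : p <+: u := by
      refine List.prefix_of_prefix_length_le hp (List.prefix_append _ _) ?_
      simpa using hlt
    have := hu.2 p this
    simp [ha, ha']
    omega

theorem Balanced.block {u : List α} (hu : Balanced opn cls u) {a b : α} (ha : opn a = true)
    (ha' : cls a = false) (hb : opn b = false) (hb' : cls b = true) :
    Block opn cls (a :: u ++ [b]) := by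
  refine ⟨by simp, fun i h0 hi => ?_, ?_⟩
  · refine (hu.wrap_aux ha ha' (List.take_prefix _ _) ?_ ?_).ne'
    · rw [← List.length_pos_iff, List.length_take]; omega
    · rw [List.length_take]; omega
  · simp [List.countP_append, ha, ha', hb, hb', hu.1]

theorem Balanced.wrap {u : List α} (hu : Balanced opn cls u) {a b : α} (ha : opn a = true)
    (ha' : cls a = false) (hb : opn b = false) (hb' : cls b = true) :
    Balanced opn cls (a :: u ++ [b]) := by
  refine ⟨(hu.block ha ha' hb hb').countP_eq, fun p hp => ?_⟩
  by_cases hne : p = []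
  · subst hne; rfl
  by_cases hlt : p.length < (a :: u ++ [b]).length
  · exact (hu.wrap_aux ha ha' hp hne hlt).le
  · rw [hp.eq_of_length_le (not_lt.1 hlt), (hu.block ha ha' hb hb').countP_eq]

end Balanced

section Words

variable {Γ : Type*} {K : Type*} (enc : K → List Γ)

abbrev BracketBalanced (u : List (ArraySymbol Γ)) : Prop := Balanced isLBracket isRBracket u

theorem bracketBalanced_bracket {u : List (FormulaSymbol Γ)}
    (hu : BracketBalanced (u.map Sum.inl)) : BracketBalanced ((bracket u).map Sum.inl) := by
  have := hu.wrap (a := .inl (.inr .lbracket)) (b := .inl (.inr .rbracket)) rfl rfl rfl rfl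
  simpa [bracket] using this

theorem bracketBalanced_flatMap {ι : Type*} {l : List ι} {f : ι → List (FormulaSymbol Γ)}
    (h : ∀ i ∈ l, BracketBalanced ((f i).map Sum.inl)) :
    BracketBalanced ((l.flatMap f).map Sum.inl) := by
  rw [List.map_flatMap]
  exact Balanced.flatMap h

theorem bracketBalanced_rows {k l : ℕ} (M : Matrix (Fin k) (Fin l) K) :
    BracketBalanced ((((List.finRange k).flatMap fun i => bracket <| (List.finRange l).flatMap
      fun j => bracket <| (enc (M i j)).map Sum.inl).map Sum.inl) : List (ArraySymbol Γ)) := by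
  refine bracketBalanced_flatMap fun i _ => bracketBalanced_bracket <|
    bracketBalanced_flatMap fun j _ => bracketBalanced_bracket <| balanced_of_neutral ?_ ?_
  all_goals
    intro x hx
    simp only [List.map_map, List.mem_map] at hx
    obtain ⟨a, -, rfl⟩ := hx
    rfl

theorem bracketBalanced_gateHead (ms : List ℕ) :
    BracketBalanced (gateHead ms : List (ArraySymbol Γ)) := by
  have h : ∀ d : Delimiter, isLBracket (.inl (.inr d) : ArraySymbol Γ) = false →
      isRBracket (.inl (.inr d) : ArraySymbol Γ) = false →
      BracketBalanced [(.inl (.inr d) : ArraySymbol Γ)] := fun d h1 h2 =>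
    balanced_of_neutral (by simpa using h1) (by simpa using h2)
  refine ((h .lparen rfl rfl).append (Balanced.flatMap fun m _ => Balanced.wrap
    (balanced_of_neutral ?_ ?_) rfl rfl rfl rfl)).append (h .rparen rfl rfl)
  all_goals
    intro x hx
    rw [List.eq_of_mem_replicate hx]; rfl

theorem gateHead_block (ms : List ℕ) :
    Block isLParen isRParen (gateHead ms : List (ArraySymbol Γ)) :=
  ⟨by simp [gateHead], fun i h0 hi => countP_take_gateHead ms h0 hi,
    by rw [countP_lparen_gateHead, countP_rparen_gateHead]⟩

/-- The numbers of the wires of a gate. -/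
def _root_.Gate.wireList {n : ℕ} (g : Gate K n) : List ℕ :=
  (List.finRange g.arity).map fun j => (g.wires j : ℕ)

theorem _root_.Gate.code_eq {n : ℕ} (g : Gate K n) :
    g.code enc = gateHead g.wireList ++ (matrixCode enc g.matrix).map Sum.inl := by
  simp [Gate.code, gateHead, Gate.wireList, List.flatMap_map, wireCode]

end Words

/-! ### The word written for one gate -/

namespace ArrayProgram

variable {Γ : Type*} [Finite Γ] (A : Atoms Γ)
variable {w : List (ArraySymbol Γ)} {ℓ h : ℕ} {S : List Register} {ρ : Register → ℕ}
  {p q : Prog Γ} {u v : List (FormulaSymbol Γ)}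

attribute [local simp] Program.Writes ArrayProgram.binary sep tensorTree fill countUnary forWires
  spot linkLeaf constTree link fresh copyMatrix gateProg levelProg prepare main bracketScan scanTail
  writes_emitWord Program.clear Program.copy Program.complement Program.incr Program.double
  emitBits emitTail

theorem range_append_range' {m n : ℕ} (hm : m ≤ n) :
    List.range n = List.range m ++ List.range' m (n - m) := by
  rw [List.range_eq_range', List.range_eq_range']
  have := List.range'_append (s := 0) (m := m) (n := n - m) (step := 1)
  rw [Nat.add_sub_cancel' hm] at this
  simpa using this.symm

/-- The form in which the program writes a tree: opening parentheses, a loop over the genuine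
leaves, then the copies added by `fill`. -/
theorem treeWord_split (op : Delimiter) {h m : ℕ} (hm : m ≤ 2 ^ h)
    (f g : ℕ → List (FormulaSymbol Γ)) :
    treeWord op h (fun i => if i < m then f i else g i) = List.replicate h (.inr .lparen) ++
      ((List.range m).flatMap (fun i => f i ++ treeSep op h i) ++
        (List.range' m (2 ^ h - m)).flatMap fun i => g i ++ treeSep op h i) := by
  rw [treeWord_eq, range_append_range' hm, List.flatMap_append]
  congr 2
  · exact List.flatMap_congr fun i hi => by rw [if_pos (List.mem_range.1 hi)]
  · exact List.flatMap_congr fun i hi => by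
      rw [if_neg (by have := (List.mem_range'_1.1 hi).1; omega)]

theorem emits_link {pre post : List (ArraySymbol Γ)} {ms : List ℕ}
    (hw : w = pre ++ gateHead ms ++ post) (hℓ : w.length + 1 < 2 ^ ℓ) (hh : h < ℓ)
    (hm : ρ .mask = 2 ^ h - 1) (ha : ρ .arity = ms.length) (hg : ρ .gate = pre.length + 1)
    (hms : ms.length ≤ 2 ^ h) :
    Emits w ℓ (link A) [.mask, .wires, .arity, .gate] ρ (linkWord A h (ρ .wires) ms) := by
  intro s hs hr
  simp only [List.forall_mem_cons, List.not_mem_nil, IsEmpty.forall_iff, implies_true,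
    and_true] at hr
  obtain ⟨r1, r2, r3, r4⟩ := hr
  rw [hm] at r1
  rw [ha] at r3
  rw [hg] at r4
  rw [link, exec_seq, exec_seq, exec_emitBits hh.le r1]
  set s' := (s.set .dummy 0).append (List.replicate h (.inr .lparen)) with hs'
  have v' : s'.Valid ℓ := (hs.set .dummy (by positivity)).append _
  have e' : ∀ r, r ≠ .dummy → s'.reg r = s.reg r := fun r hr => by
    simp [hs', Memory.append_reg, Memory.set_reg, hr]
  obtain ⟨k1, k2⟩ := exec_forWires (body := seq (linkLeaf A) (sep .times .num)) hw hℓ v'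
    (by rw [e' _ (by simp), r4]) (by simp)
    (fun j τ => τ.out = s'.out ++ (List.range j).flatMap fun j =>
      linkLeafWord A h ms.length (ρ .wires) j (ms.getD j 0) ++ treeSep .times h j)
    (fun j τ τ' ho _ h => ho.trans h) (by simp) (by
      intro j τ hj hτ hnum hwire hfr hI
      have f1 : τ.reg .mask = 2 ^ h - 1 := by
        rw [hfr _ (by simp [wireRegisters]) (by simp), e' _ (by simp), r1]
      have f2 : τ.reg .wires = ρ .wires := by
        rw [hfr _ (by simp [wireRegisters]) (by simp), e' _ (by simp), r2]
      have f3 : τ.reg .arity = ms.length := by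
        rw [hfr _ (by simp [wireRegisters]) (by simp), e' _ (by simp), r3]
      have vl := exec_valid (w := w) (linkLeaf A) hτ
      have hl := emits_linkLeaf (w := w) (ρ := τ.reg) A hh.le
        (S := [Register.mask, .arity, .wires, .num, .wire]) (fun _ h => h) f1 (by simp) (by simp)
        τ hτ (fun _ _ => rfl)
      have hln : ((linkLeaf A).exec w ℓ τ).reg .num = j := by rw [exec_reg (by simp), hnum]
      rw [exec_seq, exec_sep vl (by rw [exec_reg (by simp), f1]) (by simp), hln,
        Memory.append_out, Memory.set_out, hl, f2, f3, hnum, hwire, hI, List.range_succ,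
        List.flatMap_append]
      simp)
  set t := (forWires (seq (linkLeaf A) (sep .times .num))).exec w ℓ s' with ht
  have vt : t.Valid ℓ := exec_valid _ v'
  have tr : ∀ r ∈ [Register.mask, .wires, .arity], t.reg r = s.reg r := by
    intro r hr
    rw [ht, exec_reg, e']
    · rintro rfl; simp at hr
    · simp only [List.mem_cons, List.not_mem_nil, or_false] at hr
      rcases hr with rfl | rfl | rfl <;> simp
  rw [exec_fill (u := pairWord A h ms.length (ρ .wires) A.id) hh vt (by rw [tr _ (by simp), r1])
    (by simp) (by simp) (by rw [k2]; exact hms), k1, k2]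
  · rw [linkWord, treeWord_split _ hms, hs', Memory.append_out, Memory.set_out]
    simp
  · intro τ hτ hfr
    have := emits_pair (w := w) (ρ := τ.reg) A hh.le (S := [Register.mask, .arity, .wires])
      (fun _ h => h) (by rw [hfr _ (by simp) (by simp) (by simp) (by simp), tr _ (by simp), r1])
      (by simp) (by simp) A.id τ hτ (fun _ _ => rfl)
    rw [this, hfr .arity (by simp) (by simp) (by simp) (by simp), tr _ (by simp), r3,
      hfr .wires (by simp) (by simp) (by simp) (by simp), tr _ (by simp), r2]

theorem emits_fresh {pre post : List (ArraySymbol Γ)} {ms : List ℕ}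
    (hw : w = pre ++ gateHead ms ++ post) (hℓ : w.length + 1 < 2 ^ ℓ) (hh : h ≤ ℓ)
    (hm : ρ .mask = 2 ^ h - 1) (hg : ρ .gate = pre.length + 1) :
    Emits w ℓ (fresh A) [.mask, .wires, .gate] ρ (freshWord A h (ρ .wires) ms) := by
  have hpl : 1 < 2 ^ ℓ := by omega
  refine Emits.tensorTree A hh (by simp) hm (by simp) (by simp) (by simp) (by simp) (by simp)
    fun i _ s hs hr => ?_
  simp only [List.forall_mem_cons, List.not_mem_nil, IsEmpty.forall_iff, implies_true,
    and_true, Function.update_self, ne_eq, reduceCtorEq, not_false_eq_true,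
    Function.update_of_ne] at hr
  obtain ⟨r1, r2, r3, r4⟩ := hr
  rw [hg] at r4
  rw [exec_seq, exec_clear, exec_seq]
  have v' := hs.set .found (x := 0) (by positivity)
  obtain ⟨k1, k2⟩ := exec_forWires
    (body := ite (.eq .wire .leaf) (seq (clear .found) (incr .found)) skip) hw hℓ v'
    (by simp [Memory.set_reg, r4]) (by simp)
    (fun j τ => τ.reg .found = (if i ∈ ms.take j then 1 else 0) ∧ τ.out = s.out)
    (fun j τ τ' ho hreg h => ⟨(hreg _ (by simp [wireRegisters])).trans h.1, ho.trans h.2⟩)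
    (by simp [Memory.set_reg, Memory.set_out]) (by
      rintro j τ hj hτ hnum hwire hfr ⟨h1, h2⟩
      have f1 : τ.reg .leaf = i := by
        rw [hfr _ (by simp [wireRegisters]) (by simp), Memory.set_reg, if_neg (by simp), r1]
      have ht : (ms.take (j + 1)) = ms.take j ++ [ms.getD j 0] := by
        rw [List.take_add_one, List.getElem?_eq_getElem hj]
        simp [List.getD, hj]
      rw [exec_ite, Test.eval_eq hτ, hwire, f1, ht]
      by_cases hji : ms.getD j 0 = i
      · rw [if_pos (by simpa using hji), exec_seq, exec_clear, exec_incr (hτ.set _ (by positivity))]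
        simp [Memory.set_reg, Memory.set_out, h2, hji, Nat.mod_eq_of_lt hpl,
          -List.getD_eq_getElem?_getD]
      · rw [if_neg (by simpa using hji), exec_skip, h1, h2]
        simp [show ¬ i = ms.getD j 0 from fun e => hji e.symm, -List.getD_eq_getElem?_getD])
  rw [List.take_length] at k1
  set t := (forWires (ite (.eq .wire .leaf) (seq (clear .found) (incr .found)) skip)).exec w ℓ
    (s.set .found 0)
  have vt : t.Valid ℓ := exec_valid _ v'
  rw [exec_ite, Test.eval_isZero vt, k1.1]
  by_cases hi : i ∈ ms <;> simp [hi, exec_emitWord, Memory.append_out, k1.2]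

/-- The first scan overwrites `matrix` with every position of the wire list, so it ends at the
closing parenthesis; the matrix starts in the next cell and is copied by the second scan. -/
theorem emits_copyMatrix {pre post : List (ArraySymbol Γ)} {ms : List ℕ}
    {mat : List (FormulaSymbol Γ)} (hw : w = pre ++ (gateHead ms ++ mat.map Sum.inl) ++ post)
    (hℓ : w.length + 1 < 2 ^ ℓ) (hmat : Block isLBracket isRBracket (mat.map Sum.inl))
    (hg : ρ .gate = pre.length + 1) : Emits w ℓ copyMatrix [.gate] ρ mat := by
  intro s hs hr
  have r1 : s.reg .gate = pre.length + 1 := (hr _ (by simp)).trans hg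
  have hlen : w.length = pre.length + (gateHead ms : List (ArraySymbol Γ)).length + mat.length +
      post.length := by simp [hw]; omega
  have hB := gateHead_block (Γ := Γ) ms
  have hpos : 0 < (gateHead ms : List (ArraySymbol Γ)).length := List.length_pos_iff.2 hB.ne_nil
  have k1 := exec_bracketScan (w := w) (ℓ := ℓ) (b := .gate) (x := .pos) (on := .on) (o := .opened)
    (c := .closed) (opn := isLParen) (cls := isRParen)
    (body := (copy .matrix .pos : Prog Γ))
    (by simp) (by simp) (by simp) (by simp) (by simp) (by simp) (by simp) (by simp) (by simp)
    (by simp) (by simp) (by simp) (by simp) (by simp)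
    (by simp) (u := gateHead ms) (pre := pre) (post := mat.map Sum.inl ++ post)
    (by simp [hw]) hℓ hB.ne_nil hB.take_ne hB.countP_eq hs r1
    -- Before the first round `matrix` holds an arbitrary value.
    (fun i τ => (0 < i → τ.reg .matrix = pre.length + i) ∧ τ.out = s.out)
    (by rintro i τ r a hr ⟨h1, h2⟩
        rcases hr with rfl | rfl | rfl | rfl <;> simpa [Memory.set_reg, Memory.set_out, h2] using h1)
    (by simp)
    (by rintro i τ hi hτ hx - ⟨-, h2⟩
        rw [exec_copy hτ, hx]
        simp [Memory.set_reg, Memory.set_out, h2]; omega)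
  rw [copyMatrix, exec_seq]
  set t := (bracketScan .gate .pos .on .opened .closed isLParen isRParen
    (copy .matrix .pos) : Prog Γ).exec w ℓ s
  have vt : t.Valid ℓ := exec_valid _ hs
  rw [exec_seq, exec_incr vt, k1.1 hpos, Nat.mod_eq_of_lt (by omega)]
  have k2 := exec_bracketScan (w := w) (ℓ := ℓ) (b := .matrix) (x := .pos) (on := .on)
    (o := .opened) (c := .closed) (opn := isLBracket) (cls := isRBracket)
    (body := (emitCell .pos InputCell.formulaSymbol : Prog Γ))
    (by simp) (by simp) (by simp) (by simp) (by simp) (by simp) (by simp) (by simp) (by simp)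
    (by simp) (by simp) (by simp) (by simp) (by simp)
    (by simp) (u := mat.map Sum.inl) (pre := pre ++ gateHead ms) (post := post)
    (by simp [hw]) hℓ hmat.ne_nil hmat.take_ne hmat.countP_eq
    (vt.set .matrix (x := pre.length + (gateHead ms : List (ArraySymbol Γ)).length + 1) (by omega))
    (by simp [Memory.set_reg])
    (fun i τ => τ.out = s.out ++ mat.take i)
    (fun i τ r a _ h => h) (by simp [Memory.set_out, k1.2])
    (by intro i τ hi hτ hx _ h2
        have hi' : i < mat.length := by simpa using hi
        have e := scan_append (w := w) (pre := pre ++ gateHead ms) (u := mat.map Sum.inl)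
          (post := post) (by simp [hw]) hi
        simp only [Program.exec, hx, e]
        rw [h2, List.take_add_one, List.getElem?_eq_getElem hi', List.append_assoc]
        simp [InputCell.formulaSymbol])
  simpa using k2

theorem emits_gateProg {pre post : List (ArraySymbol Γ)} {ms : List ℕ}
    {mat : List (FormulaSymbol Γ)} (hw : w = pre ++ (gateHead ms ++ mat.map Sum.inl) ++ post)
    (hℓ : w.length + 1 < 2 ^ ℓ) (hmat : Block isLBracket isRBracket (mat.map Sum.inl)) (hh : h < ℓ)
    (hm : ρ .mask = 2 ^ h - 1) (hg : ρ .gate = pre.length + 1) (hms : ms.length ≤ 2 ^ h) :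
    Emits w ℓ (gateProg A) [.mask, .wires, .gate] ρ (gateWord A h (ρ .wires) ms mat) := by
  intro s hs hr
  simp only [List.forall_mem_cons, List.not_mem_nil, IsEmpty.forall_iff, implies_true,
    and_true] at hr
  obtain ⟨r1, r2, r3⟩ := hr
  have hw' : w = pre ++ gateHead ms ++ (mat.map Sum.inl ++ post) := by simp [hw]
  have hlen : ms.length ≤ w.length := by
    rw [← countP_lbracket_gateHead (Γ := Γ) ms, hw]
    refine List.countP_le_length.trans ?_
    simp; omega
  have v' := hs.set .arity (x := 0) (by positivity)
  rw [gateProg, exec_seq, exec_seq, exec_clear]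
  obtain ⟨⟨k1, k2⟩, -⟩ := exec_forWires (body := incr .arity) hw' hℓ v'
    (by simp [Memory.set_reg, r3, hg]) (by simp)
    (fun j τ => τ.reg .arity = j ∧ τ.out = s.out)
    (fun j τ τ' ho hreg h => ⟨(hreg _ (by simp [wireRegisters])).trans h.1, ho.trans h.2⟩)
    (by simp [Memory.set_reg, Memory.set_out]) (by
      rintro j τ hj hτ hnum hwire hfr ⟨h1, h2⟩
      rw [exec_incr hτ, h1, Nat.mod_eq_of_lt (by omega)]
      simp [Memory.set_reg, Memory.set_out, h2])
  set t := (forWires (incr .arity)).exec w ℓ (s.set .arity 0) with ht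
  have vt : t.Valid ℓ := exec_valid _ v'
  have tr : ∀ r ∈ [Register.mask, .wires, .gate], t.reg r = ρ r := by
    intro r hr
    simp only [List.mem_cons, List.not_mem_nil, or_false] at hr
    rcases hr with rfl | rfl | rfl <;> 
      rw [ht, exec_reg (by simp), Memory.set_reg, if_neg (by simp)] <;> assumption
  have tm := (tr .mask (by simp)).trans hm
  have tg := (tr .gate (by simp)).trans hg
  have pairs := fun u => (emits_pair (w := w) (ρ := t.reg) A hh.le
      (S := [Register.mask, .wires, .arity, .gate]) (by simp) tm (by simp) (by simp) u)
  have hlink := emits_link A hw' hℓ hh tm k1 tg hms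
  have hfresh : Emits w ℓ (fresh A) [.mask, .wires, .arity, .gate] t.reg
    (freshWord A h (t.reg .wires) ms) :=
    (emits_fresh A hw' hℓ hh.le tm tg).mono (by simp)
  have hcopy : Emits w ℓ copyMatrix [.mask, .wires, .arity, .gate] t.reg mat :=
    (emits_copyMatrix hw hℓ hmat tg).mono (by simp)
  have key := (((((pairs A.row).binary (op := .times) hlink (by simp)).binary (op := .times)
    (hcopy.binary (op := .otimes) hfresh (by simp)) (by simp)).binary (op := .times) hlink
    (by simp)).binary (op := .times) (pairs A.col) (by simp)) t vt (fun _ _ => rfl)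
  rw [key, k1, k2, tr .wires (by simp)]
  rfl

end ArrayProgram
end Logspace

namespace Logspace

open Transducer Program
open TensorFormula (binaryCode)

/-! ### The levels in the input -/

/-- A gate as it is written in the input. -/
structure InputGate (Γ : Type*) where
  wires : List ℕ
  body : List (FormulaSymbol Γ)
  balanced : BracketBalanced (body.map Sum.inl)
  noParen : ∀ x ∈ body, x ≠ .inr .lparen

section Words

variable {Γ : Type*}

namespace InputGate

def matrix (g : InputGate Γ) : List (FormulaSymbol Γ) := bracket g.body

def code (g : InputGate Γ) : List (ArraySymbol Γ) := gateHead g.wires ++ g.matrix.map Sum.inl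

def levelCode (L : List (InputGate Γ)) : List (ArraySymbol Γ) :=
  .inl (.inr .lbracket) :: L.flatMap code ++ [.inl (.inr .rbracket)]

theorem block (g : InputGate Γ) : Block isLBracket isRBracket (g.matrix.map Sum.inl) := by
  have := g.balanced.block (a := .inl (.inr .lbracket)) (b := .inl (.inr .rbracket))
    rfl rfl rfl rfl
  simpa [matrix, bracket] using this

/-- The code without its first letter. -/
def tail (g : InputGate Γ) : List (ArraySymbol Γ) :=
  g.wires.flatMap wireCode ++ (.inl (.inr .rparen) :: .inl (.inr .lbracket) :: g.body.map Sum.inl)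

theorem code_eq (g : InputGate Γ) :
    g.code = .inl (.inr .lparen) :: g.tail ++ [.inl (.inr .rbracket)] := by
  simp [code, gateHead, matrix, tail, bracket]

theorem not_isLParen_of_mem_tail (g : InputGate Γ) {x : ArraySymbol Γ} (hx : x ∈ g.tail) :
    isLParen x = false := by
  simp only [tail, List.mem_append, List.mem_flatMap, List.mem_cons, List.mem_map] at hx
  rcases hx with ⟨m, -, hx⟩ | rfl | rfl | ⟨y, hy, rfl⟩
  · simp only [wireCode, List.cons_append, List.mem_cons, List.mem_append, List.not_mem_nil,
      or_false] at hx
    rcases hx with rfl | hx | rfl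
    · rfl
    · rw [List.eq_of_mem_replicate hx]; rfl
    · rfl
  · rfl
  · rfl
  · have := g.noParen y hy
    rcases y with y | y
    · rfl
    · cases y <;> first | rfl | exact absurd rfl this

theorem countP_code (g : InputGate Γ) : g.code.countP isLParen = 1 := by
  rw [code_eq, List.countP_append, List.countP_cons, List.countP_eq_zero.2 fun x hx => by
    simp [g.not_isLParen_of_mem_tail hx]]
  rfl

theorem countP_flatMap_code (L : List (InputGate Γ)) :
    (L.flatMap code).countP isLParen = L.length := by
  induction L with
  | nil => rfl
  | cons g L ih => rw [List.flatMap_cons, List.countP_append, ih, countP_code, List.length_cons,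
      add_comm]

theorem countP_levelCode (L : List (InputGate Γ)) :
    (levelCode L).countP isLParen = L.length := by
  rw [levelCode, List.countP_append, List.countP_cons, countP_flatMap_code]; rfl

theorem bracketBalanced_code (g : InputGate Γ) : BracketBalanced g.code := by
  refine (bracketBalanced_gateHead _).append ?_
  have := g.balanced.wrap (a := .inl (.inr .lbracket)) (b := .inl (.inr .rbracket))
    rfl rfl rfl rfl
  simpa [matrix, bracket] using this

theorem levelCode_block (L : List (InputGate Γ)) :
    Block isLBracket isRBracket (levelCode L) :=
  (Balanced.flatMap fun g _ => g.bracketBalanced_code).block rfl rfl rfl rfl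

/-- By `not_isLParen_of_mem_tail` an opening parenthesis is always the first letter of a gate, so
whole gates precede it. -/
theorem gates_following (L : List (InputGate Γ)) {p t : List (ArraySymbol Γ)} {x : ArraySymbol Γ}
    (h : L.flatMap code ++ [.inl (.inr .rbracket)] = p ++ x :: t) (hx : isLParen x) :
    ∃ L₁ g L₂, L = L₁ ++ g :: L₂ ∧ p = L₁.flatMap code := by
  induction L generalizing p with
  | nil =>
    have : x ∈ [(.inl (.inr .rbracket) : ArraySymbol Γ)] := by
      rw [List.flatMap_nil, List.nil_append] at h; rw [h]; simp
    rw [List.mem_singleton.1 this] at hx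
    cases hx
  | cons g L ih =>
    rw [List.flatMap_cons, List.append_assoc, List.append_eq_append_iff] at h
    rcases h with ⟨q, rfl, h2⟩ | ⟨q, h1, h2⟩
    · obtain ⟨L₁, g', L₂, rfl, rfl⟩ := ih h2
      exact ⟨g :: L₁, g', L₂, rfl, rfl⟩
    · cases q with
      | nil =>
        obtain ⟨L₁, g', L₂, rfl, h4⟩ := ih (p := []) h2.symm
        refine ⟨g :: L₁, g', L₂, rfl, ?_⟩
        rw [List.append_nil] at h1
        rw [List.flatMap_cons, ← h4, List.append_nil, h1]
      | cons y q =>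
        rw [List.cons_append, List.cons.injEq] at h2
        obtain ⟨rfl, rfl⟩ := h2
        cases p with
        | nil => exact ⟨[], g, L, rfl, rfl⟩
        | cons z p =>
          rw [code_eq, List.cons_append, List.cons_append, List.cons.injEq] at h1
          have : x ∈ g.tail ++ [(.inl (.inr .rbracket) : ArraySymbol Γ)] := by
            rw [h1.2]; simp
          rcases List.mem_append.1 this with h | h
          · rw [g.not_isLParen_of_mem_tail h] at hx; cases hx
          · rw [List.mem_singleton.1 h] at hx; cases hx

/-- The code of every gate ends with a closing bracket. -/
theorem not_isLBracket_before_gate {L : List (InputGate Γ)} {q : List (ArraySymbol Γ)}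
    {x : ArraySymbol Γ} (h : L.flatMap code = q ++ [x]) : isLBracket x = false := by
  rcases List.eq_nil_or_concat L with rfl | ⟨L, g, rfl⟩
  · simp at h
  · rw [List.concat_eq_append, List.flatMap_append, List.flatMap_singleton, code_eq, ← List.append_assoc] at h
    have := (List.append_inj' h rfl).2
    rw [List.cons.injEq] at this
    rw [← this.1]; rfl

/-- Inside a level, the letter before an opening parenthesis is the bracket of the level or the last
letter of a gate, and the latter is a closing bracket. So an opening bracket followed by an opening
parenthesis can only start a level. -/
theorem levels_following (Ls : List (List (InputGate Γ))) {p t : List (ArraySymbol Γ)}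
    {x y : ArraySymbol Γ} (h : Ls.flatMap levelCode = p ++ x :: y :: t) (hx : isLBracket x)
    (hy : isLParen y) :
    ∃ Ls₁ L Ls₂, Ls = Ls₁ ++ L :: Ls₂ ∧ p = Ls₁.flatMap levelCode := by
  induction Ls generalizing p with
  | nil => simp at h
  | cons L Ls ih =>
    rw [List.flatMap_cons, List.append_eq_append_iff] at h
    rcases h with ⟨q, rfl, h2⟩ | ⟨q, h1, h2⟩
    · obtain ⟨L₁, g', L₂, rfl, rfl⟩ := ih h2
      exact ⟨L :: L₁, g', L₂, rfl, rfl⟩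
    · cases q with
      | nil =>
        obtain ⟨L₁, g', L₂, rfl, h4⟩ := ih (p := []) h2.symm
        refine ⟨L :: L₁, g', L₂, rfl, ?_⟩
        rw [List.append_nil] at h1
        rw [List.flatMap_cons, ← h4, List.append_nil, h1]
      | cons x' q =>
        rw [List.cons_append, List.cons.injEq] at h2
        obtain ⟨rfl, h2⟩ := h2
        cases p with
        | nil => exact ⟨[], L, Ls, rfl, rfl⟩
        | cons z p =>
          rw [levelCode, List.cons_append, List.cons_append, List.cons.injEq] at h1
          cases q with
          | nil =>
            have := (List.append_inj' h1.2 rfl).2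
            rw [List.cons.injEq] at this
            rw [← this.1] at hx; cases hx
          | cons y' q =>
            rw [List.cons_append, List.cons.injEq] at h2
            obtain ⟨rfl, -⟩ := h2
            have h3 := h1.2
            rw [show p ++ x :: y :: q = (p ++ [x]) ++ y :: q by simp] at h3
            obtain ⟨L₁, g, L₂, -, h4⟩ := gates_following L h3 hy
            rw [not_isLBracket_before_gate h4.symm] at hx
            cases hx

/-- The gates of the levels that start at position `q` or later, the last level being the first;
the first level starts at position `a`. -/
def gatesFrom : List (List (InputGate Γ)) → ℕ → ℕ → List (InputGate Γ)
  | [], _, _ => []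
  | L :: Ls, a, q => gatesFrom Ls (a + (levelCode L).length) q ++ if q ≤ a then L else []

theorem gatesFrom_of_le (Ls : List (List (InputGate Γ))) {a q : ℕ} (h : q ≤ a) :
    gatesFrom Ls a q = Ls.reverse.flatten := by
  induction Ls generalizing a with
  | nil => rfl
  | cons L Ls ih => simp [gatesFrom, ih (h.trans (Nat.le_add_right _ _)), h]

theorem gatesFrom_of_length_le (Ls : List (List (InputGate Γ))) {a q : ℕ}
    (h : a + (Ls.flatMap levelCode).length ≤ q) : gatesFrom Ls a q = [] := by
  induction Ls generalizing a with
  | nil => rfl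
  | cons L Ls ih =>
    rw [List.flatMap_cons, List.length_append] at h
    have : 0 < (levelCode L).length := by simp [levelCode]
    rw [gatesFrom, ih (by omega), if_neg (by omega), List.append_nil]

/-- Lowering the threshold to the start of `L` admits just this level. Its gates come last in the
list, behind those of the later levels, as the order of the matrix factors requires. -/
theorem gatesFrom_level (Ls₁ : List (List (InputGate Γ))) (L : List (InputGate Γ))
    (Ls₂ : List (List (InputGate Γ))) {a q : ℕ} (h : q = a + (Ls₁.flatMap levelCode).length) :
    gatesFrom (Ls₁ ++ L :: Ls₂) a q = gatesFrom (Ls₁ ++ L :: Ls₂) a (q + 1) ++ L := by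
  induction Ls₁ generalizing a with
  | nil =>
    have hq : q = a := by simpa using h
    have : 0 < (levelCode L).length := by simp [levelCode]
    simp only [List.nil_append, gatesFrom, hq, le_refl, if_true]
    rw [gatesFrom_of_le Ls₂ (by omega), gatesFrom_of_le Ls₂ (by omega), if_neg (by omega)]
    simp
  | cons L' Ls₁ ih =>
    rw [List.flatMap_cons, List.length_append] at h
    have : 0 < (levelCode L').length := by simp [levelCode]
    rw [List.cons_append, gatesFrom, gatesFrom, ih (by omega), if_neg (by omega),
      if_neg (by omega)]
    simp

/-- Only a non-empty level can change the list, so the backward search loses nothing by overlooking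
empty ones. -/
theorem gatesFrom_eq_or (Ls : List (List (InputGate Γ))) (a q : ℕ) :
    gatesFrom Ls a q = gatesFrom Ls a (q + 1) ∨
      ∃ Ls₁ L Ls₂, Ls = Ls₁ ++ L :: Ls₂ ∧ L ≠ [] ∧ q = a + (Ls₁.flatMap levelCode).length := by
  induction Ls generalizing a with
  | nil => exact .inl rfl
  | cons L Ls ih =>
    by_cases hqa : q = a ∧ L ≠ []
    · exact .inr ⟨[], L, Ls, rfl, hqa.2, by simpa using hqa.1⟩
    rcases ih (a + (levelCode L).length) with h | ⟨Ls₁, L', Ls₂, rfl, h1, h2⟩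
    · refine .inl ?_
      rw [gatesFrom, gatesFrom, h]
      congr 1
      by_cases hL : L = []
      · simp [hL]
      · have : q ≠ a := fun e => hqa ⟨e, hL⟩
        by_cases hle : q ≤ a
        · rw [if_pos hle, if_pos (by omega)]
        · rw [if_neg hle, if_neg (by omega)]
    · refine .inr ⟨L :: Ls₁, L', Ls₂, rfl, h1, ?_⟩
      rw [h2, List.flatMap_cons, List.length_append, add_assoc]

end InputGate

/-- Words, each followed by the separator that belongs to its position in a tree. -/
def slotted (op : Delimiter) (h : ℕ) :
    ℕ → List (List (FormulaSymbol Γ)) → List (FormulaSymbol Γ)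
  | _, [] => []
  | k, u :: us => u ++ treeSep op h k ++ slotted op h (k + 1) us

theorem slotted_append (op : Delimiter) (h k : ℕ) (us vs : List (List (FormulaSymbol Γ))) :
    slotted op h k (us ++ vs) = slotted op h k us ++ slotted op h (k + us.length) vs := by
  induction us generalizing k with
  | nil => rfl
  | cons u us ih =>
    rw [List.cons_append, slotted, ih, slotted, List.length_cons,
      Nat.add_right_comm, Nat.add_assoc]
    simp only [List.append_assoc]

theorem slotted_zero (op : Delimiter) (h : ℕ) (us : List (List (FormulaSymbol Γ))) :
    slotted op h 0 us =
      (List.range us.length).flatMap fun i => us.getD i [] ++ treeSep op h i := by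
  induction us using List.reverseRecOn with
  | nil => rfl
  | append_singleton us u ih =>
    rw [slotted_append, ih, List.length_append, List.length_singleton, List.range_succ,
      List.flatMap_append, List.flatMap_singleton]
    congr 1
    · refine List.flatMap_congr fun i hi => ?_
      have := List.mem_range.1 hi
      simp [List.getElem?_append_left this]
    · simp [slotted]

end Words

/-! ### The word written for one level -/

namespace ArrayProgram

variable {Γ : Type*} [Finite Γ] (A : Atoms Γ)
variable {w : List (ArraySymbol Γ)} {ℓ h : ℕ} {S : List Register} {ρ : Register → ℕ}
  {p q : Prog Γ} {u v : List (FormulaSymbol Γ)}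

attribute [local simp] Program.Writes ArrayProgram.binary sep tensorTree fill countUnary forWires
  spot linkLeaf constTree link fresh copyMatrix gateProg levelProg prepare main bracketScan scanTail
  writes_emitWord Program.clear Program.copy Program.complement Program.incr Program.double
  emitBits emitTail

def inputGateWord (h n : ℕ) (g : InputGate Γ) : List (FormulaSymbol Γ) :=
  gateWord A h n g.wires g.matrix

/-- The word for the product of all gates of the input. -/
def productWord (h n : ℕ) (G : List (InputGate Γ)) : List (FormulaSymbol Γ) :=
  treeWord .times h fun i =>
    if i < G.length then (G.map (inputGateWord A h n)).getD i [] else tensorWord A h n fun _ => A.id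

theorem exec_levelProg {pre post : List (ArraySymbol Γ)} {L : List (InputGate Γ)} {n : ℕ}
    (hw : w = pre ++ InputGate.levelCode L ++ post) (hℓ : w.length + 1 < 2 ^ ℓ) (hh : h < ℓ)
    {s : Mem Γ} (hs : s.Valid ℓ) (hm : s.reg .mask = 2 ^ h - 1) (hn : s.reg .wires = n)
    (hlevel : s.reg .level = pre.length + 1) (hslot : s.reg .slot + L.length ≤ 2 ^ h)
    (harity : ∀ g ∈ L, g.wires.length ≤ 2 ^ h) :
    ((levelProg A).exec w ℓ s).reg .slot = s.reg .slot + L.length ∧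
      ((levelProg A).exec w ℓ s).out =
        s.out ++ slotted .times h (s.reg .slot) (L.map (inputGateWord A h n)) := by
  have hlt : 2 ^ h < 2 ^ ℓ := Nat.pow_lt_pow_right one_lt_two hh
  have hB := InputGate.levelCode_block L
  have key := exec_bracketScan (w := w) (ℓ := ℓ) (b := .level) (x := .gate) (on := .levelOn)
    (o := .levelOpen) (c := .levelClose) (opn := isLBracket) (cls := isRBracket)
    (body := ite (cellIs .gate isLParen)
      (seq (gateProg A) (seq (sep .times .slot) (incr .slot))) skip)
    (by simp) (by simp) (by simp) (by simp) (by simp) (by simp) (by simp) (by simp) (by simp)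
    (by simp) (by simp) (by simp) (by simp) (by simp)
    (by simp) hw hℓ hB.ne_nil hB.take_ne hB.countP_eq hs hlevel
    -- The number `j` of opening parentheses already passed is the number of gates already written.
    (fun i τ => ∃ j, j = ((InputGate.levelCode L).take i).countP isLParen ∧
      τ.reg .slot = s.reg .slot + j ∧ τ.out =
        s.out ++ slotted .times h (s.reg .slot) ((L.take j).map (inputGateWord A h n)))
    (by rintro i τ r a hr ⟨j, h1, h2, h3⟩
        rcases hr with rfl | rfl | rfl | rfl <;>
          exact ⟨j, h1, by simpa [Memory.set_reg] using h2, h3⟩)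
    ⟨0, by simp [slotted]⟩ ?_
  · obtain ⟨j, h1, h2, h3⟩ := key
    rw [List.take_length, InputGate.countP_levelCode] at h1
    rw [h1] at h2 h3
    rw [List.take_length] at h3
    exact ⟨h2, h3⟩
  · rintro i τ hi hτ hx hfr ⟨j, h1, h2, h3⟩
    have hev : (cellIs .gate isLParen).eval w ℓ τ.reg = isLParen (InputGate.levelCode L)[i] := by
      rw [eval_cellIs, hx, scan_append hw hi]; rfl
    rw [countP_take_succ _ _ hi, exec_ite, hev]
    by_cases hbr : isLParen (InputGate.levelCode L)[i] = true
    swap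
    · rw [if_neg hbr, Bool.eq_false_of_not_eq_true hbr, ← h1]
      exact ⟨j, rfl, h2, h3⟩
    rw [if_pos hbr, hbr]
    have hi0 : i ≠ 0 := by rintro rfl; simp [InputGate.levelCode, isLParen] at hbr
    obtain ⟨k, rfl⟩ := Nat.exists_eq_succ_of_ne_zero hi0
    obtain ⟨y, hy⟩ : ∃ y, y = (InputGate.levelCode L)[k + 1] := ⟨_, rfl⟩
    obtain ⟨D, hD⟩ : ∃ D, D = (InputGate.levelCode L).drop (k + 1 + 1) := ⟨_, rfl⟩
    have hsplit : InputGate.levelCode L = (InputGate.levelCode L).take (k + 1) ++ y :: D := by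
      rw [hy, hD, List.getElem_cons_drop, List.take_append_drop]
    replace hbr : isLParen y = true := hy ▸ hbr
    obtain ⟨V, hV⟩ : ∃ V, V = (L.flatMap InputGate.code ++ [.inl (.inr .rbracket)] :
      List (ArraySymbol Γ)) := ⟨_, rfl⟩
    have hVg : InputGate.levelCode L = .inl (.inr .lbracket) :: V := by rw [hV]; rfl
    have hcount : ((InputGate.levelCode L).take (k + 1)).countP isLParen =
        (V.take k).countP isLParen := by
      simp [hVg, isLParen]
    obtain ⟨L₁, g, L₂, rfl, f2⟩ := InputGate.gates_following L (p := V.take k) (x := y) (t := D)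
      (by rw [hVg, List.take_succ_cons, List.cons_append, List.cons.injEq] at hsplit
          rw [← hV]
          exact hsplit.2) hbr
    have hpl : k = (L₁.flatMap InputGate.code).length := by
      rw [← f2, List.length_take, min_eq_left]
      have := congrArg List.length hVg
      rw [List.length_cons] at this
      omega
    rw [Nat.succ_eq_add_one, hcount, f2, InputGate.countP_flatMap_code] at h1 ⊢
    subst h1
    rw [List.take_left] at h3
    rw [List.length_append, List.length_cons] at hslot
    have hw' : w = (pre ++ .inl (.inr .lbracket) :: L₁.flatMap InputGate.code) ++
        (gateHead g.wires ++ g.matrix.map Sum.inl) ++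
        (L₂.flatMap InputGate.code ++ .inl (.inr .rbracket) :: post) := by
      rw [hw]
      simp [InputGate.levelCode, InputGate.code]
    have hgate : τ.reg .gate =
        (pre ++ .inl (.inr .lbracket) :: L₁.flatMap InputGate.code).length + 1 := by
      rw [hx, hpl, List.length_append, List.length_cons]; omega
    have hmτ : τ.reg .mask = 2 ^ h - 1 := by
      rw [hfr _ (by simp) (by simp) (by simp) (by simp) (by simp), hm]
    have hnτ : τ.reg .wires = n := by
      rw [hfr _ (by simp) (by simp) (by simp) (by simp) (by simp), hn]
    have hg := emits_gateProg (ρ := τ.reg) A hw' hℓ g.block hh hmτ hgate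
      (harity g (by simp)) τ hτ (fun _ _ => rfl)
    have vg := exec_valid (w := w) (gateProg A) hτ
    have hmg : ((gateProg A).exec w ℓ τ).reg .mask = 2 ^ h - 1 := by rw [exec_reg (by simp), hmτ]
    have hsg : ((gateProg A).exec w ℓ τ).reg .slot = s.reg .slot + L₁.length := by
      rw [exec_reg (by simp), h2]
    rw [exec_seq, exec_seq, exec_sep vg hmg (by simp), hsg,
      exec_incr ((vg.set .dummy (by positivity)).append _)]
    refine ⟨L₁.length + 1, rfl, ?_, ?_⟩
    · simp only [Memory.append_reg, Memory.set_reg, if_true, reduceCtorEq, if_false, hsg]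
      rw [Nat.mod_eq_of_lt (by omega), add_assoc]
    · rw [Memory.set_out, Memory.append_out, Memory.set_out, hg, h3, hnτ,
        show L₁ ++ g :: L₂ = (L₁ ++ [g]) ++ L₂ by simp,
        show L₁.length + 1 = (L₁ ++ [g]).length by simp, List.take_left, List.map_append,
        slotted_append]
      simp [slotted, inputGateWord]

end ArrayProgram
end Logspace

namespace Logspace

open Transducer Program
open TensorFormula (binaryCode)

/-! ### The output of the whole program -/

namespace ArrayProgram

variable {Γ : Type*} [Finite Γ] (A : Atoms Γ)
variable {w : List (ArraySymbol Γ)} {ℓ h : ℕ}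

attribute [local simp] Program.Writes ArrayProgram.binary sep tensorTree fill countUnary forWires
  spot linkLeaf constTree link fresh copyMatrix gateProg levelProg prepare main bracketScan scanTail
  writes_emitWord Program.clear Program.copy Program.complement Program.incr Program.double
  emitBits emitTail

theorem symbolIs_scan_succ (f : ArraySymbol Γ → Bool) {i : ℕ} (hi : i < w.length) :
    InputCell.symbolIs f (scan w (i + 1)) = f w[i] := by
  have := scan_append (w := w) (pre := []) (u := w) (post := []) (by simp) hi
  rw [List.length_nil, zero_add, add_comm] at this
  rw [this]; rfl

theorem symbolIs_scan_of_le (f : ArraySymbol Γ → Bool) {i : ℕ} (hi : w.length ≤ i) :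
    InputCell.symbolIs f (scan w (i + 1)) = false := by
  rw [scan, List.getElem?_eq_none hi]; rfl

theorem exec_countParen {t : Mem Γ} (ht : t.Valid ℓ) (hℓ : w.length + 1 < 2 ^ ℓ)
    (hbound : t.reg .total + w.countP isLParen < 2 ^ ℓ) :
    ((loop .pos (ite (cellIs .pos isLParen) (incr .total) skip) : Prog Γ).exec w ℓ t).reg .total =
        t.reg .total + w.countP isLParen ∧
      ((loop .pos (ite (cellIs .pos isLParen) (incr .total) skip) : Prog Γ).exec w ℓ t).out =
        t.out := by
  have key := exec_loop_inv (w := w) (r := .pos)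
    (p := (ite (cellIs .pos isLParen) (incr .total) skip : Prog Γ)) (by simp) ht
    -- Before the round for position `i` the positions below `i` have been inspected. Position `0`
    -- is the end marker, so these contain `i - 1` letters.
    (fun i τ => τ.reg .total = t.reg .total + (w.take (i - 1)).countP isLParen ∧ τ.out = t.out)
    (fun i τ a h => by simpa [Memory.set_reg, Memory.set_out] using h) (by simp) ?_
  · rwa [List.take_of_length_le (by omega)] at key
  · rintro i τ hi hτ - hpos ⟨h1, h2⟩
    rw [exec_ite, eval_cellIs, hpos]
    cases i with
    | zero => simpa [scan, InputCell.symbolIs, exec_skip] using And.intro h1 h2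
    | succ i =>
      rw [Nat.add_sub_cancel] at h1 ⊢
      by_cases hiw : i < w.length
      · rw [symbolIs_scan_succ _ hiw, countP_take_succ _ _ hiw]
        by_cases hb : isLParen w[i] = true
        · have hle : (w.take (i + 1)).countP isLParen ≤ w.countP isLParen :=
            (List.take_sublist _ _).countP_le
          rw [countP_take_succ _ _ hiw, hb] at hle
          rw [Bool.toNat_true] at hle
          rw [if_pos hb, exec_incr hτ, h1, hb, Nat.mod_eq_of_lt (by omega)]
          exact ⟨by simp [Memory.set_reg]; ring, h2⟩
        · rw [if_neg hb, Bool.eq_false_of_not_eq_true hb]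
          exact ⟨h1, h2⟩
      · rw [symbolIs_scan_of_le _ (by omega), List.take_of_length_le (by omega)]
        rw [List.take_of_length_le (by omega)] at h1
        exact ⟨h1, h2⟩

/-- `mask` is doubled only while it is below `total`, so `hbound` excludes an overflow. -/
theorem exec_mask {t : Mem Γ} (ht : t.Valid ℓ) (hm : t.reg .mask = 0)
    (hbound : 2 * t.reg .total < 2 ^ ℓ) :
    ∃ h, ((loop .time (ite (.lt .mask .total) (double .mask) skip) : Prog Γ).exec w ℓ t).reg .mask =
        2 ^ h - 1 ∧ t.reg .total < 2 ^ h ∧ (h = 0 ∨ 2 ^ (h - 1) ≤ t.reg .total) ∧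
      ((loop .time (ite (.lt .mask .total) (double .mask) skip) : Prog Γ).exec w ℓ t).out =
        t.out := by
  have v := exec_valid (w := w) (loop .time (ite (.lt .mask .total) (double .mask) skip)) ht
  have key := exec_loop_inv (w := w) (r := .time)
    (p := (ite (.lt .mask .total) (double .mask) skip : Prog Γ)) (by simp) ht
    (fun i τ => ∃ h, τ.reg .mask = 2 ^ h - 1 ∧ (h = 0 ∨ 2 ^ (h - 1) ≤ t.reg .total) ∧
      (t.reg .total < 2 ^ h ∨ h = i) ∧ τ.out = t.out)
    (fun i τ a h => by simpa [Memory.set_reg, Memory.set_out] using h) ⟨0, by simp [hm]⟩ ?_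
  · obtain ⟨h, h1, h2, h3, h4⟩ := key
    refine ⟨h, h1, ?_, h2, h4⟩
    rcases h3 with h3 | rfl
    · exact h3
    -- The loop cannot end while still doubling: `2 ^ ℓ` doublings would give a number too large for
    -- `ℓ` bits.
    · have := v .mask
      rw [h1] at this
      have h5 : ℓ < 2 ^ ℓ := Nat.lt_two_pow_self
      have h6 : 2 ^ (ℓ + 1) ≤ 2 ^ 2 ^ ℓ := Nat.pow_le_pow_right two_pos h5
      rw [pow_succ] at h6
      omega
  · rintro i τ hi hτ hfr - ⟨h, h1, h2, h3, h4⟩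
    have hp : 0 < 2 ^ h := by positivity
    rw [exec_ite, Test.eval_lt hτ, hfr .total (by simp) (by simp), h1]
    by_cases hlt : 2 ^ h - 1 < t.reg .total
    · rw [if_pos (by simpa using hlt), exec_double]
      have hps : 2 ^ (h + 1) = 2 ^ h * 2 := pow_succ 2 h
      refine ⟨h + 1, ?_, .inr ?_, .inr ?_, h4⟩
      · rw [Memory.set_reg, if_pos rfl, h1, Nat.mod_eq_of_lt (by omega)]; omega
      · rw [Nat.add_sub_cancel]; omega
      · omega
    · rw [if_neg (by simpa using hlt), exec_skip]
      exact ⟨h, h1, h2, .inl (by omega), h4⟩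

/-- Wires and gates number at most `2 * w.length`; the factor `8` in the width also covers the last
doubling of the mask. -/
theorem exec_prepare {n : ℕ} {y : ArraySymbol Γ} {post : List (ArraySymbol Γ)}
    (hw : w = unary n ++ y :: post) (hy : isUnary y = false) (hℓ : 8 * (w.length + 1) ≤ 2 ^ ℓ)
    {s : Mem Γ} (hs : s.Valid ℓ) :
    ∃ h, (prepare.exec w ℓ s).reg .mask = 2 ^ h - 1 ∧ (prepare.exec w ℓ s).reg .wires = n ∧
      n + w.countP isLParen < 2 ^ h ∧ (h = 0 ∨ 2 ^ (h - 1) ≤ n + w.countP isLParen) ∧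
      (prepare.exec w ℓ s).out = s.out := by
  have hn : n ≤ w.length := by simp [hw, unary]
  have hc : w.countP isLParen ≤ w.length := List.countP_le_length
  have v1 := hs.set .pos (x := 0) (by positivity)
  obtain ⟨a1, a2⟩ := exec_countUnary (w := w) (pre := []) (post := post) (m := n)
    (by simp [hw]) hy (by omega) v1
    (by simp [Memory.set_reg])
  set t₁ := countUnary.exec w ℓ (s.set .pos 0) with ht₁
  have w1 : t₁.Valid ℓ := exec_valid _ v1
  have w2 := w1.set .wires (x := n) (by omega)
  have w3 := w2.set .total (x := n) (by omega)
  obtain ⟨b1, b2⟩ := exec_countParen (w := w) w3 (by omega) (by simp [Memory.set_reg]; omega)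
  set t₂ := (loop .pos (ite (cellIs .pos isLParen) (incr .total) skip) : Prog Γ).exec w ℓ
    ((t₁.set .wires n).set .total n) with ht₂
  have w4 : t₂.Valid ℓ := exec_valid _ w3
  have w5 := w4.set .mask (x := 0) (by positivity)
  have htot : (t₂.set .mask 0).reg .total = n + w.countP isLParen := by
    rw [Memory.set_reg, if_neg (by simp), b1]; simp [Memory.set_reg]
  have hwr : (t₂.set .mask 0).reg .wires = n := by
    rw [Memory.set_reg, if_neg (by simp), ht₂, exec_reg (by simp)]; simp [Memory.set_reg]
  obtain ⟨h, c1, c2, c3, c4⟩ := exec_mask (w := w) w5 (by simp [Memory.set_reg])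
    (by rw [htot]; omega)
  have hrun : prepare.exec w ℓ s = (loop .time (ite (.lt .mask .total) (double .mask) skip) :
      Prog Γ).exec w ℓ (t₂.set .mask 0) := by
    simp only [prepare, exec_seq, exec_clear]
    rw [← ht₁, exec_copy w1, a1, exec_copy w2,
      show (t₁.set .wires n).reg .wires = n by simp [Memory.set_reg], ← ht₂]
  rw [htot] at c2 c3
  refine ⟨h, by rw [hrun, c1], by rw [hrun, exec_reg (by simp), hwr], c2, c3, ?_⟩
  rw [hrun, c4, Memory.set_out, b2, Memory.set_out, Memory.set_out, a2, Memory.set_out]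

theorem length_gatesFrom_le (Ls : List (List (InputGate Γ))) (a q : ℕ) :
    (InputGate.gatesFrom Ls a q).length ≤ (Ls.flatMap InputGate.levelCode).countP isLParen := by
  induction Ls generalizing a with
  | nil => rfl
  | cons L Ls ih =>
    rw [InputGate.gatesFrom, List.length_append, List.flatMap_cons, List.countP_append,
      InputGate.countP_levelCode]
    have := ih (a + (InputGate.levelCode L).length)
    split <;> simp <;> omega

/-- Soundness of the program's test for the start of a level; the unary prefix contains no bracket.
Completeness for non-empty levels is `scan_of_level`. -/
theorem level_of_scan {n : ℕ} {Ls : List (List (InputGate Γ))} {p : ℕ}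
    (hw : w = unary n ++ Ls.flatMap InputGate.levelCode)
    (h1 : InputCell.symbolIs isLBracket (scan w p) = true)
    (h2 : InputCell.symbolIs isLParen (scan w (p + 1)) = true) :
    ∃ Ls₁ L Ls₂, Ls = Ls₁ ++ L :: Ls₂ ∧ p = n + (Ls₁.flatMap InputGate.levelCode).length + 1 := by
  cases p with
  | zero => cases h1
  | succ i =>
    have hi2 : i + 1 < w.length := by
      by_contra hi
      rw [symbolIs_scan_of_le _ (by omega)] at h2
      cases h2
    have hi1 : i < w.length := by omega
    rw [symbolIs_scan_succ _ hi1] at h1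
    rw [symbolIs_scan_succ _ hi2] at h2
    have hsplit : w = w.take i ++ w[i] :: w[i + 1] :: w.drop (i + 2) := by
      rw [List.getElem_cons_drop, List.getElem_cons_drop, List.take_append_drop]
    have hlen : (w.take i).length = i := by rw [List.length_take]; omega
    generalize w.take i = a at hsplit hlen
    generalize w[i] = x at hsplit h1
    generalize w[i + 1] = y at hsplit h2
    generalize w.drop (i + 2) = t at hsplit
    rw [hw, List.append_eq_append_iff] at hsplit
    have hun : ∀ q : List (ArraySymbol Γ), unary n = a ++ x :: q → False := by
      intro q hq
      have : x ∈ (unary n : List (ArraySymbol Γ)) := by rw [hq]; simp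
      rw [List.eq_of_mem_replicate this] at h1
      cases h1
    have hlun : (unary n : List (ArraySymbol Γ)).length = n := by simp [unary]
    rcases hsplit with ⟨q, rfl, hq⟩ | ⟨q, hq1, hq2⟩
    · obtain ⟨Ls₁, L, Ls₂, e1, rfl⟩ := InputGate.levels_following Ls hq h1 h2
      refine ⟨Ls₁, L, Ls₂, e1, ?_⟩
      rw [List.length_append, hlun] at hlen
      omega
    · cases q with
      | nil =>
        obtain ⟨Ls₁, L, Ls₂, e1, e2⟩ := InputGate.levels_following Ls (p := []) hq2.symm h1 h2
        refine ⟨Ls₁, L, Ls₂, e1, ?_⟩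
        rw [List.append_nil] at hq1
        rw [← e2, List.length_nil, ← hlen, ← hq1, hlun, add_zero]
      | cons x' q =>
        rw [List.cons_append, List.cons.injEq] at hq2
        obtain ⟨rfl, -⟩ := hq2
        exact (hun q hq1).elim

theorem scan_of_level {n : ℕ} {Ls₁ Ls₂ : List (List (InputGate Γ))} {L : List (InputGate Γ)}
    {p : ℕ} (hw : w = unary n ++ (Ls₁ ++ L :: Ls₂).flatMap InputGate.levelCode) (hL : L ≠ [])
    (hp : p = n + (Ls₁.flatMap InputGate.levelCode).length + 1) :
    InputCell.symbolIs isLBracket (scan w p) = true ∧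
      InputCell.symbolIs isLParen (scan w (p + 1)) = true := by
  obtain ⟨g, L, rfl⟩ := List.exists_cons_of_ne_nil hL
  have hw' : w = (unary n ++ Ls₁.flatMap InputGate.levelCode) ++
      InputGate.levelCode (g :: L) ++ Ls₂.flatMap InputGate.levelCode := by
    simp [hw]
  have hlen : (unary n ++ Ls₁.flatMap InputGate.levelCode : List (ArraySymbol Γ)).length + 1 = p := by
    simp [hp, unary]
  have hc : ∃ u, InputGate.levelCode (g :: L) = .inl (.inr .lbracket) :: .inl (.inr .lparen) :: u :=
    ⟨_, by simp [InputGate.levelCode, InputGate.code_eq]; rfl⟩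
  obtain ⟨u, hu⟩ := hc
  rw [hu] at hw'
  have e0 := scan_append (i := 0) hw' (by simp)
  have e1 := scan_append (i := 1) hw' (by simp)
  rw [hlen] at e0 e1
  rw [e0, e1]
  exact ⟨rfl, rfl⟩

/-- The two bounds on `2 ^ h` make every tree large enough for its leaves and keep the depth
logarithmic. -/
theorem exec_main {n : ℕ} {Ls : List (List (InputGate Γ))}
    (hw : w = unary n ++ Ls.flatMap InputGate.levelCode) (hne : Ls ≠ [])
    (hℓ : 8 * (w.length + 1) ≤ 2 ^ ℓ) (harity : ∀ L ∈ Ls, ∀ g ∈ L, g.wires.length ≤ n) :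
    ∃ h, n + Ls.flatten.length ≤ 2 ^ h ∧ 2 ^ h ≤ 2 * (n + Ls.flatten.length) + 1 ∧
      ((main A).exec w ℓ ⟨fun _ => 0, []⟩).out = productWord A h n Ls.reverse.flatten := by
  obtain ⟨L₀, Ls', hLs⟩ := List.exists_cons_of_ne_nil hne
  have hs : (⟨fun _ => 0, []⟩ : Mem Γ).Valid ℓ := fun r => by simp
  obtain ⟨h, c1, c2, c3, c4, c5⟩ := exec_prepare (n := n) (y := .inl (.inr .lbracket))
    (w := w) (post := L₀.flatMap InputGate.code ++ .inl (.inr .rbracket) ::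
      Ls'.flatMap InputGate.levelCode) (by simp [hw, hLs, InputGate.levelCode]) rfl hℓ hs
  set t := prepare.exec w ℓ (⟨fun _ => 0, []⟩ : Mem Γ) with ht
  have vt : t.Valid ℓ := exec_valid _ hs
  have hcount : w.countP isLParen = (Ls.flatMap InputGate.levelCode).countP isLParen := by
    rw [hw, List.countP_append, countP_unary rfl, zero_add]
  have hflat : ∀ Ls : List (List (InputGate Γ)),
      (Ls.flatMap InputGate.levelCode).countP isLParen = Ls.flatten.length := by
    intro Ls
    induction Ls with
    | nil => rfl
    | cons L Ls ih => rw [List.flatMap_cons, List.countP_append, ih, InputGate.countP_levelCode,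
        List.flatten_cons, List.length_append]
  have hnw : n + (Ls.flatMap InputGate.levelCode).length = w.length := by simp [hw, unary]
  have hcl : (Ls.flatMap InputGate.levelCode).countP isLParen ≤
    (Ls.flatMap InputGate.levelCode).length := List.countP_le_length
  have hpow : 2 ^ h ≤ 2 * (n + w.countP isLParen) + 1 := by
    rcases c4 with rfl | c4
    · simp
    · cases h with
      | zero => simp
      | succ h => rw [Nat.add_sub_cancel] at c4; rw [pow_succ]; omega
  have hh : h < ℓ := by
    by_contra hle
    have := Nat.pow_le_pow_right two_pos (not_lt.1 hle)
    omega
  refine ⟨h, by rw [← hflat, ← hcount]; exact c3.le, by rw [← hflat, ← hcount]; exact hpow, ?_⟩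
  rw [main, exec_seq, ← ht, exec_seq, exec_emitBits hh.le c1, exec_seq, exec_clear, exec_seq]
  set t' := ((t.set .dummy 0).append (List.replicate h (.inr .lparen))).set .slot 0 with ht'
  have vt' : t'.Valid ℓ :=
    ((vt.set .dummy (by positivity)).append _).set .slot (by positivity)
  have tr : ∀ r, r ≠ .dummy → r ≠ .slot → t'.reg r = t.reg r := fun r h1 h2 => by
    simp [ht', Memory.set_reg, Memory.append_reg, h1, h2]
  have key := exec_loop_inv (w := w) (r := .back) (p := seq (complement .level .back)
      (ite (cellIs .level isLBracket) (seq (copy .probe .level) (seq (incr .probe)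
        (ite (cellIs .probe isLParen) (levelProg A) skip))) skip)) (by simp) vt'
    -- After `b` rounds the positions from `2 ^ ℓ - b` on have been visited, and the gates of the
    -- levels starting there have been written, the last level first.
    (fun b τ => τ.reg .slot = (InputGate.gatesFrom Ls (n + 1) (2 ^ ℓ - b)).length ∧
      τ.out = t'.out ++ slotted .times h 0
        ((InputGate.gatesFrom Ls (n + 1) (2 ^ ℓ - b)).map (inputGateWord A h n)))
    (fun b τ a h => by simpa [Memory.set_reg, Memory.set_out] using h) ?_ ?_
  · rw [Nat.sub_self, InputGate.gatesFrom_of_le Ls (by omega)] at key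
    obtain ⟨k1, k2⟩ := key
    set s' := (loop .back (seq (complement .level .back)
      (ite (cellIs .level isLBracket) (seq (copy .probe .level) (seq (incr .probe)
        (ite (cellIs .probe isLParen) (levelProg A) skip))) skip))).exec w ℓ t' with hs'
    have vs' : s'.Valid ℓ := exec_valid _ vt'
    have sm : s'.reg .mask = 2 ^ h - 1 := by
      rw [hs', exec_reg (by simp), tr _ (by simp) (by simp), c1]
    have sw : s'.reg .wires = n := by
      rw [hs', exec_reg (by simp), tr _ (by simp) (by simp), c2]
    have hslot : Ls.reverse.flatten.length ≤ 2 ^ h := by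
      have : Ls.reverse.flatten.length = Ls.flatten.length := by
        rw [List.length_flatten, List.length_flatten, List.map_reverse, List.sum_reverse]
      rw [this, ← hflat, ← hcount]; omega
    rw [exec_fill (u := tensorWord A h n fun _ => A.id) hh vs' sm (by simp) (by simp)
      (by rw [k1]; exact hslot), k1, k2, productWord, treeWord_split _ hslot, slotted_zero,
      List.length_map, ht', Memory.set_out, Memory.append_out, Memory.set_out, c5]
    · simp
    · intro τ hτ hfr
      have := emits_constTree (w := w) (ρ := τ.reg) (size := .wires) A hh.le
        (S := [Register.mask, .wires]) (by simp)
        (by rw [hfr _ (by simp) (by simp) (by simp) (by simp), sm]) (by simp) (by simp) (by simp)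
        A.id τ hτ (fun _ _ => rfl)
      rw [this, hfr _ (by simp) (by simp) (by simp) (by simp), sw]
  · rw [Nat.sub_zero, InputGate.gatesFrom_of_length_le Ls (by omega)]
    simp [ht', Memory.set_reg, slotted]
  · rintro b τ hb hτ hfr hback ⟨h1, h2⟩
    obtain ⟨p, hp⟩ : ∃ p, p = 2 ^ ℓ - 1 - b := ⟨_, rfl⟩
    have e1 : 2 ^ ℓ - b = p + 1 := by omega
    have e2 : 2 ^ ℓ - (b + 1) = p := by omega
    rw [e1] at h1 h2
    rw [e2, exec_seq, exec_complement hτ, hback, ← hp]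
    have v1 := hτ.set .level (x := p) (by omega)
    -- If the test fails at `p`, no non-empty level starts there, and the list of gates does not
    -- change.
    have same : ¬ (InputCell.symbolIs isLBracket (scan w p) = true ∧
        InputCell.symbolIs isLParen (scan w (p + 1)) = true) →
        InputGate.gatesFrom Ls (n + 1) p = InputGate.gatesFrom Ls (n + 1) (p + 1) := by
      intro hno
      rcases InputGate.gatesFrom_eq_or Ls (n + 1) p with h | ⟨Ls₁, L, Ls₂, e3, e4, e5⟩
      · exact h
      · rw [e3] at hw
        exact (hno (scan_of_level hw e4 (by omega))).elim
    rw [exec_ite, eval_cellIs, show (τ.set .level p).reg .level = p by simp [Memory.set_reg]]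
    by_cases hbr : InputCell.symbolIs isLBracket (scan w p) = true
    swap
    · rw [if_neg hbr, exec_skip, same fun h => hbr h.1]
      exact ⟨h1, h2⟩
    -- A bracket has been seen at `p`, so `p` lies within the input and the increment of `probe`
    -- does not overflow.
    have hpw : p < w.length + 1 := by
      by_contra hlt
      obtain ⟨i, rfl⟩ := Nat.exists_eq_add_of_le (not_lt.1 hlt)
      rw [show w.length + 1 + i = w.length + i + 1 by omega, symbolIs_scan_of_le _ (by omega)] at hbr
      cases hbr
    have v2 := v1.set .probe (x := p) (by omega)
    rw [if_pos hbr, exec_seq, exec_copy v1,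
      show (τ.set .level p).reg .level = p by simp [Memory.set_reg], exec_seq, exec_incr v2,
      show ((τ.set .level p).set .probe p).reg .probe = p by simp [Memory.set_reg],
      Nat.mod_eq_of_lt (by omega : p + 1 < 2 ^ ℓ)]
    have v3 := v2.set .probe (x := p + 1) (by omega)
    set σ := (((τ.set .level p).set .probe p).set .probe (p + 1)) with hσ
    have σr : ∀ r, r ≠ .level → r ≠ .probe → σ.reg r = τ.reg r := fun r r1 r2 => by
      simp [hσ, Memory.set_reg, r1, r2]
    rw [exec_ite, eval_cellIs, show σ.reg .probe = p + 1 by simp [hσ, Memory.set_reg]]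
    by_cases hpar : InputCell.symbolIs isLParen (scan w (p + 1)) = true
    swap
    · rw [if_neg hpar, exec_skip, same fun h => hpar h.2, σr _ (by simp) (by simp)]
      exact ⟨h1, h2⟩
    rw [if_pos hpar]
    obtain ⟨Ls₁, L, Ls₂, rfl, f2⟩ := level_of_scan hw hbr hpar
    have hgates := InputGate.gatesFrom_level Ls₁ L Ls₂ (a := n + 1) (q := p) (by omega)
    have hbound := length_gatesFrom_le (Ls₁ ++ L :: Ls₂) (n + 1) p
    rw [hgates, List.length_append, ← h1] at hbound
    have hlev := exec_levelProg A (w := w) (n := n) (h := h) (L := L)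
      (pre := unary n ++ Ls₁.flatMap InputGate.levelCode)
      (post := Ls₂.flatMap InputGate.levelCode) (by simp [hw]) (by omega) hh v3
      (by rw [σr _ (by simp) (by simp), hfr _ (by simp) (by simp), tr _ (by simp) (by simp), c1])
      (by rw [σr _ (by simp) (by simp), hfr _ (by simp) (by simp), tr _ (by simp) (by simp), c2])
      (by simp [hσ, Memory.set_reg, f2, unary])
      (by rw [σr _ (by simp) (by simp)]; omega)
      (fun g hg => by have := harity L (by simp) g hg; omega)
    rw [σr _ (by simp) (by simp)] at hlev
    rw [hlev.1, hlev.2, hgates, List.length_append, h1, List.map_append, slotted_append,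
      List.length_map, zero_add]
    refine ⟨rfl, ?_⟩
    rw [show σ.out = τ.out from rfl, h2, List.append_assoc]

end ArrayProgram
end Logspace

/-! ### Matrices indexed by bit vectors -/

theorem bitIndex_val {k : ℕ} (y : Fin k → Fin 2) :
    (bitIndex k y : ℕ) = ∑ i : Fin k, (y i : ℕ) * 2 ^ (k - 1 - (i : ℕ)) := by
  rw [← Equiv.sum_comp Fin.revPerm]
  simp only [bitIndex, Equiv.trans_apply, finFunctionFinEquiv_apply]
  refine Finset.sum_congr rfl fun i _ => ?_
  simp only [Equiv.arrowCongr_apply, Function.comp, Fin.revPerm_apply, Fin.revPerm_symm,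
    Equiv.refl_apply, Fin.val_rev]
  congr 2
  omega

/-- As the first bit is the most significant one, concatenation of bit vectors is exactly the index
arithmetic of the Kronecker product. This allows all matrices to be treated as indexed by bit
vectors. -/
theorem bitIndex_append_val {a c : ℕ} (y : Fin (a + c) → Fin 2) :
    (bitIndex (a + c) y : ℕ) = (bitIndex c fun i => y (Fin.natAdd a i)) +
      2 ^ c * (bitIndex a fun i => y (Fin.castAdd c i)) := by
  rw [bitIndex_val, bitIndex_val, bitIndex_val, Fin.sum_univ_add, add_comm, Finset.mul_sum]
  congr 1
  · refine Finset.sum_congr rfl fun i _ => ?_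
    rw [Fin.val_natAdd]
    congr 2
    omega
  · refine Finset.sum_congr rfl fun i _ => ?_
    rw [Fin.val_castAdd, mul_left_comm, ← pow_add]
    congr 2
    omega

/-- The word `u` describes a tensor formula over the admissible elements of depth at most `D` whose
value is `M`. -/
def DenotesFin {K : Type*} [Semiring K] {Γ : Type*} (E : ElementEncoding K Γ) {k l : ℕ}
    (u : List (FormulaSymbol Γ)) (D : ℕ) (M : Matrix (Fin k) (Fin l) K) : Prop :=
  ∃ F : TensorFormula K k l, F.code E.encode = u ∧ F.EntriesIn E.carrier ∧ F.depth ≤ D ∧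
    F.value = M

/-- The same for a matrix whose rows and columns are indexed by bit vectors. -/
def Denotes {K : Type*} [Semiring K] {Γ : Type*} (E : ElementEncoding K Γ) {a b : ℕ}
    (u : List (FormulaSymbol Γ)) (D : ℕ)
    (M : Matrix (Fin a → Fin 2) (Fin b → Fin 2) K) : Prop :=
  DenotesFin E u D (M.submatrix (bitIndex a).symm (bitIndex b).symm)

section Denotes

variable {K : Type*} [Semiring K] {Γ : Type*} {E : ElementEncoding K Γ} {a b c d D : ℕ}
  {u v : List (FormulaSymbol Γ)}

open TensorFormula (binaryCode)

theorem DenotesFin.cast {k l k' l' : ℕ} {M : Matrix (Fin k) (Fin l) K} (h : DenotesFin E u D M)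
    (hk : k' = k) (hl : l' = l) : DenotesFin E u D (M.submatrix (Fin.cast hk) (Fin.cast hl)) := by
  subst hk hl
  exact h

theorem Denotes.congr {M N : Matrix (Fin a → Fin 2) (Fin b → Fin 2) K} (h : Denotes E u D M)
    (hMN : ∀ y z, M y z = N y z) : Denotes E u D N := by
  rwa [← Matrix.ext hMN]

theorem Denotes.mono {D' : ℕ} {M : Matrix (Fin a → Fin 2) (Fin b → Fin 2) K}
    (h : Denotes E u D M) (hD : D ≤ D') : Denotes E u D' M := by
  obtain ⟨F, h1, h2, h3, h4⟩ := h
  exact ⟨F, h1, h2, h3.trans hD, h4⟩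

/-- Needed for numbers of bits such as `0 + n` and `n`, which are equal but not by definition. -/
theorem Denotes.cast {a' b' : ℕ} {M : Matrix (Fin a → Fin 2) (Fin b → Fin 2) K}
    (h : Denotes E u D M) (ha : a = a') (hb : b = b') :
    Denotes E u D (fun (y : Fin a' → Fin 2) (z : Fin b' → Fin 2) =>
      M (fun i => y (Fin.cast ha i)) (fun i => z (Fin.cast hb i))) := by
  subst ha hb
  exact h

theorem Denotes.add {M N : Matrix (Fin a → Fin 2) (Fin b → Fin 2) K} (hM : Denotes E u D M)
    (hN : Denotes E v D N) : Denotes E (binaryCode .plus u v) (D + 1) (M + N) := by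
  obtain ⟨F, rfl, h2, h3, h4⟩ := hM
  obtain ⟨G, rfl, k2, k3, k4⟩ := hN
  refine ⟨.add F G, rfl, ⟨h2, k2⟩, Nat.succ_le_succ (max_le h3 k3), ?_⟩
  rw [TensorFormula.value, h4, k4]
  rfl

theorem Denotes.mul {M : Matrix (Fin a → Fin 2) (Fin b → Fin 2) K}
    {N : Matrix (Fin b → Fin 2) (Fin c → Fin 2) K} (hM : Denotes E u D M)
    (hN : Denotes E v D N) : Denotes E (binaryCode .times u v) (D + 1) (M * N) := by
  obtain ⟨F, rfl, h2, h3, h4⟩ := hM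
  obtain ⟨G, rfl, k2, k3, k4⟩ := hN
  refine ⟨.mul F G, rfl, ⟨h2, k2⟩, Nat.succ_le_succ (max_le h3 k3), ?_⟩
  rw [TensorFormula.value, h4, k4, Matrix.submatrix_mul_equiv]

/-- The Kronecker product of matrices indexed by bit vectors. -/
def bitTensor (M : Matrix (Fin a → Fin 2) (Fin b → Fin 2) K)
    (N : Matrix (Fin c → Fin 2) (Fin d → Fin 2) K) :
    Matrix (Fin (a + c) → Fin 2) (Fin (b + d) → Fin 2) K := fun y z =>
  M (fun i => y (Fin.castAdd c i)) (fun i => z (Fin.castAdd d i)) *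
    N (fun i => y (Fin.natAdd a i)) (fun i => z (Fin.natAdd b i))

theorem finProdFinEquiv_symm_cast (i : Fin (2 ^ (a + c))) :
    finProdFinEquiv.symm (Fin.cast (pow_add 2 a c) i) =
      (bitIndex a fun j => (bitIndex (a + c)).symm i (Fin.castAdd c j),
        bitIndex c fun j => (bitIndex (a + c)).symm i (Fin.natAdd a j)) := by
  rw [Equiv.symm_apply_eq]
  apply Fin.ext
  rw [finProdFinEquiv_apply_val]
  have := bitIndex_append_val ((bitIndex (a + c)).symm i)
  rw [Equiv.apply_symm_apply] at this
  simpa using this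

theorem Denotes.tensor {M : Matrix (Fin a → Fin 2) (Fin b → Fin 2) K}
    {N : Matrix (Fin c → Fin 2) (Fin d → Fin 2) K} (hM : Denotes E u D M)
    (hN : Denotes E v D N) : Denotes E (binaryCode .otimes u v) (D + 1) (bitTensor M N) := by
  obtain ⟨F, rfl, h2, h3, h4⟩ := hM
  obtain ⟨G, rfl, k2, k3, k4⟩ := hN
  have : DenotesFin E (binaryCode .otimes (F.code E.encode) (G.code E.encode)) (D + 1)
      (F.tensor G).value :=
    ⟨.tensor F G, rfl, ⟨h2, k2⟩, Nat.succ_le_succ (max_le h3 k3), rfl⟩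
  have := this.cast (pow_add 2 a c) (pow_add 2 b d)
  unfold Denotes
  convert this using 1
  ext i j
  simp only [TensorFormula.value, Matrix.submatrix_apply, h4, k4, finProdFinEquiv_symm_cast,
    Matrix.kroneckerMap_apply, Equiv.symm_apply_apply, bitTensor]

theorem denotes_atom (M : Matrix (Fin a → Fin 2) (Fin b → Fin 2) K)
    (hM : ∀ y z, M y z ∈ E.carrier) : Denotes E
      (matrixCode E.encode (M.submatrix (bitIndex a).symm (bitIndex b).symm)) 0 M :=
  ⟨.atom (by positivity) (by positivity) (M.submatrix (bitIndex a).symm (bitIndex b).symm), rfl,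
    by rw [TensorFormula.EntriesIn]; exact fun _ _ => hM _ _, le_rfl, by rw [TensorFormula.value]⟩

end Denotes

/-! ### Trees of formulas -/

section Trees

variable {Γ : Type*} {op : Delimiter} {h : ℕ} {f : ℕ → List (FormulaSymbol Γ)}

open TensorFormula (binaryCode)

/-- The definition merges neighbouring leaves, as suits the writing of the word; formulas are built
by splitting at the root. -/
theorem treeWord_succ (op : Delimiter) (h : ℕ) (f : ℕ → List (FormulaSymbol Γ)) :
    treeWord op (h + 1) f =
      binaryCode op (treeWord op h f) (treeWord op h fun i => f (2 ^ h + i)) := by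
  induction h generalizing f with
  | zero => simp [treeWord]
  | succ h ih =>
    rw [treeWord, ih]
    congr 1
    rw [treeWord]
    congr 1
    funext i
    congr 2 <;> ring

theorem treeWord_congr {g : ℕ → List (FormulaSymbol Γ)} (hfg : ∀ i < 2 ^ h, f i = g i) :
    treeWord op h f = treeWord op h g := by
  induction h generalizing f g with
  | zero => exact hfg 0 (by simp)
  | succ h ih =>
    rw [treeWord_succ, treeWord_succ, ih fun i hi => hfg i (by rw [pow_succ]; omega),
      ih fun i hi => hfg _ (by rw [pow_succ]; omega)]

variable {K : Type*} [Semiring K] {E : ElementEncoding K Γ} {D N : ℕ}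

theorem denotes_treeWord_times {M : ℕ → Matrix (Fin N → Fin 2) (Fin N → Fin 2) K}
    (hM : ∀ i < 2 ^ h, Denotes E (f i) D (M i)) :
    Denotes E (treeWord .times h f) (D + h) ((List.range (2 ^ h)).map M).prod := by
  induction h generalizing f M with
  | zero => simpa [treeWord] using hM 0 (by simp)
  | succ h ih =>
    have h1 := ih (f := f) (M := M) fun i hi => hM i (by rw [pow_succ]; omega)
    have h2 := ih (f := fun i => f (2 ^ h + i)) (M := fun i => M (2 ^ h + i)) fun i hi =>
      hM _ (by rw [pow_succ]; omega)
    have := h1.mul h2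
    rw [treeWord_succ, pow_succ, mul_two, List.range_add, List.map_append, List.prod_append,
      List.map_map]
    exact this

namespace Logspace.ArrayProgram

variable (A : Atoms Γ)

/-- The words of the tensor trees with the leaves `f k, …, f (k + s - 1)`. -/
theorem tensorWord_induction {S : ℕ} (Q : ℕ → ℕ → ℕ → List (FormulaSymbol Γ) → Prop)
    (hone : ∀ k, Q 0 k 0 A.one) (hleaf : ∀ k < S, Q 0 k 1 (f k))
    (hstep : ∀ h k s t u v, Q h k s u → Q h (k + s) t v →
      Q (h + 1) k (s + t) (binaryCode .otimes u v)) {h k s : ℕ} (hs : s ≤ 2 ^ h)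
    (hk : k + s ≤ S) : Q h k s (tensorWord A h s fun i => f (k + i)) := by
  induction h generalizing k s with
  | zero =>
    have : s = 0 ∨ s = 1 := by rw [pow_zero] at hs; omega
    rcases this with rfl | rfl
    · exact hone k
    · exact hleaf k (by omega)
  | succ h ih =>
    rw [pow_succ] at hs
    -- The left half takes as many leaves as fit. By truncated subtraction the right half gets none,
    -- only padding, if `s ≤ 2 ^ h`.
    have h1 := ih (k := k) (s := min s (2 ^ h)) (by omega) (by omega)
    have h2 := ih (k := k + min s (2 ^ h)) (s := s - 2 ^ h) (by omega) (by omega)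
    have := hstep _ _ _ _ _ _ h1 h2
    rw [show min s (2 ^ h) + (s - 2 ^ h) = s by omega] at this
    convert this using 1
    rw [tensorWord, treeWord_succ, tensorWord, tensorWord]
    congr 1
    · exact treeWord_congr fun i hi => by simp [hi]
    · refine treeWord_congr fun i hi => ?_
      by_cases his : 2 ^ h + i < s
      · rw [if_pos his, if_pos (by omega), min_eq_right (by omega), add_assoc]
      · rw [if_neg his, if_neg (by omega)]

end Logspace.ArrayProgram

end Trees

/-! ### The formula of a gate -/

section GateFormula

variable {K : Type*} [Semiring K] {Γ : Type*} (E : ElementEncoding K Γ)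

open TensorFormula (binaryCode)
open Logspace Logspace.ArrayProgram

def bitWord {a b : ℕ} (M : Matrix (Fin a → Fin 2) (Fin b → Fin 2) K) : List (FormulaSymbol Γ) :=
  matrixCode E.encode (M.submatrix (bitIndex a).symm (bitIndex b).symm)

open Classical in
/-- The matrix with entries `0` and `1` that belongs to a relation. -/
noncomputable def indicator {ι κ : Type*} (P : ι → κ → Prop) : Matrix ι κ K :=
  fun y z => if P y z then 1 else 0

def boolBit (b : Bool) : Fin 2 := if b then 1 else 0

variable {E} in
theorem denotes_indicator {a b : ℕ} (P : (Fin a → Fin 2) → (Fin b → Fin 2) → Prop) :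
    Denotes E (bitWord E (indicator P)) 0 (indicator P) :=
  denotes_atom _ fun y z => by
    rw [indicator]
    split
    exacts [E.one_mem, E.zero_mem]

theorem indicator_apply {ι κ : Type*} (P : ι → κ → Prop) (y : ι) (z : κ) [Decidable (P y z)] :
    indicator (K := K) P y z = if P y z then 1 else 0 := by
  unfold indicator
  congr

theorem indicator_congr {ι κ : Type*} {P Q : ι → κ → Prop} (h : ∀ y z, P y z ↔ Q y z) :
    indicator (K := K) P = indicator Q := by
  rw [show P = Q from funext fun y => funext fun z => propext (h y z)]

/-- From here on, 0/1 matrices are handled as relations: a tensor product is a conjunction on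
separate blocks of bits. -/
theorem bitTensor_indicator {a b c d : ℕ} (P : (Fin a → Fin 2) → (Fin b → Fin 2) → Prop)
    (Q : (Fin c → Fin 2) → (Fin d → Fin 2) → Prop) :
    bitTensor (indicator (K := K) P) (indicator Q) = indicator fun y z =>
      P (fun i => y (Fin.castAdd c i)) (fun i => z (Fin.castAdd d i)) ∧
        Q (fun i => y (Fin.natAdd a i)) (fun i => z (Fin.natAdd b i)) := by
  ext y z
  classical
  simp only [bitTensor, indicator_apply, ite_and, ite_mul, one_mul, zero_mul]

/-- The words of the atomic matrices. -/
noncomputable def atomWords : Atoms Γ where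
  one := bitWord E (indicator fun (_ _ : Fin 0 → Fin 2) => True)
  id := bitWord E (indicator fun (y z : Fin 1 → Fin 2) => y 0 = z 0)
  unit b := bitWord E (indicator fun (y z : Fin 1 → Fin 2) => y 0 = boolBit b ∧ z 0 = boolBit b)
  ones := bitWord E (indicator fun (_ _ : Fin 1 → Fin 2) => True)
  row := bitWord E (indicator fun (_ : Fin 0 → Fin 2) (_ : Fin 1 → Fin 2) => True)
  col := bitWord E (indicator fun (_ : Fin 1 → Fin 2) (_ : Fin 0 → Fin 2) => True)

variable {E} {h D : ℕ}

/-- The offset `k` in the induction predicate records which bits a subtree is responsible for, so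
that the relations `R i` may vary with the leaf. -/
theorem denotes_tensorWord {f : ℕ → List (FormulaSymbol Γ)} {s : ℕ} (hs : s ≤ 2 ^ h)
    (R : ℕ → Fin 2 → Fin 2 → Prop)
    (hf : ∀ i < s, Denotes E (f i) 0 (indicator fun y z : Fin 1 → Fin 2 => R i (y 0) (z 0))) :
    Denotes E (tensorWord (atomWords E) h s f) h
      (indicator fun y z : Fin s → Fin 2 => ∀ i : Fin s, R i (y i) (z i)) := by
  have := tensorWord_induction (atomWords E) (S := s) (f := f) (fun h k s u => Denotes E u h
    (indicator fun y z : Fin s → Fin 2 => ∀ i : Fin s, R (k + i) (y i) (z i))) ?_ ?_ ?_ hs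
    (k := 0) (by simp)
  · simpa using this
  · intro k
    rw [indicator_congr (Q := fun _ _ => True) (by simp)]
    exact denotes_indicator _
  · intro k hk
    have := hf k hk
    rwa [indicator_congr (Q := fun y z : Fin 1 → Fin 2 =>
      ∀ i : Fin 1, R (k + i) (y i) (z i)) (by simp)] at this
  · intro h k s t u v hu hv
    have := hu.tensor hv
    rw [bitTensor_indicator] at this
    rwa [indicator_congr] at this
    intro y z
    rw [Fin.forall_fin_add]
    simp [add_assoc]

theorem denotes_tensorWord_row {s : ℕ} (hs : s ≤ 2 ^ h) :
    Denotes E (tensorWord (atomWords E) h s fun _ => (atomWords E).row) h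
      (indicator fun (_ : Fin 0 → Fin 2) (_ : Fin s → Fin 2) => True) := by
  refine tensorWord_induction (atomWords E) (S := s) (f := fun _ => (atomWords E).row)
    (fun h k s u => Denotes E u h
      (indicator fun (_ : Fin 0 → Fin 2) (_ : Fin s → Fin 2) => True)) ?_ ?_ ?_ hs
    (k := 0) (by simp)
  · exact fun k => denotes_indicator (E := E) _
  · exact fun k _ => denotes_indicator (E := E) _
  · intro h k s t u v hu hv
    have := hu.tensor hv
    rw [bitTensor_indicator] at this
    simpa only [and_self] using this

theorem denotes_tensorWord_col {s : ℕ} (hs : s ≤ 2 ^ h) :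
    Denotes E (tensorWord (atomWords E) h s fun _ => (atomWords E).col) h
      (indicator fun (_ : Fin s → Fin 2) (_ : Fin 0 → Fin 2) => True) := by
  refine tensorWord_induction (atomWords E) (S := s) (f := fun _ => (atomWords E).col)
    (fun h k s u => Denotes E u h
      (indicator fun (_ : Fin s → Fin 2) (_ : Fin 0 → Fin 2) => True)) ?_ ?_ ?_ hs
    (k := 0) (by simp)
  · exact fun k => denotes_indicator (E := E) _
  · exact fun k _ => denotes_indicator (E := E) _
  · intro h k s t u v hu hv
    have := hu.tensor hv
    rw [bitTensor_indicator] at this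
    simpa only [and_self] using this

theorem denotes_identity {n : ℕ} (hn : n ≤ 2 ^ h) :
    Denotes E (tensorWord (atomWords E) h n fun _ => (atomWords E).id) h
      (indicator fun y z : Fin n → Fin 2 => y = z) := by
  have := denotes_tensorWord (E := E) hn (fun _ p q => p = q) (f := fun _ => (atomWords E).id)
    fun i _ => denotes_indicator _
  simpa only [funext_iff] using this

theorem denotes_spot {s j : ℕ} (hs : s ≤ 2 ^ h) (hj : j < s) (b : Bool) :
    Denotes E (spotWord (atomWords E) h s j b) h
      (indicator fun y z : Fin s → Fin 2 => y = z ∧ y ⟨j, hj⟩ = boolBit b) := by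
  have := denotes_tensorWord (E := E) hs
    (fun i p q => if i = j then p = boolBit b ∧ q = boolBit b else p = q)
    (f := fun i => if i = j then (atomWords E).unit b else (atomWords E).id) ?_
  · rw [indicator_congr (Q := fun y z : Fin s → Fin 2 => y = z ∧ y ⟨j, hj⟩ = boolBit b)] at this
    · exact this
    · intro y z
      constructor
      · intro hyz
        have h1 := hyz ⟨j, hj⟩
        simp only [if_true] at h1
        refine ⟨funext fun i => ?_, h1.1⟩
        by_cases hij : (i : ℕ) = j
        · have : i = ⟨j, hj⟩ := Fin.ext hij
          rw [this, h1.1, h1.2]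
        · simpa [hij] using hyz i
      · rintro ⟨rfl, h1⟩ i
        by_cases hij : (i : ℕ) = j
        · have : i = ⟨j, hj⟩ := Fin.ext hij
          rw [this, h1]; simp
        · simp [hij]
  · intro i _
    by_cases hij : i = j
    · simp only [hij, if_true]
      exact denotes_indicator _
    · simp only [hij, if_false]
      exact denotes_indicator _

/-- The two summands, for both bits equal to `0` and both equal to `1`, have disjoint supports; so
their sum is again a 0/1 matrix over any semiring. -/
theorem denotes_linkLeaf {k n j v : ℕ} (hk : k ≤ 2 ^ h) (hn : n ≤ 2 ^ h) (hj : j < k)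
    (hv : v < n) : Denotes E (linkLeafWord (atomWords E) h k n j v) (h + 2)
      (indicator fun y z : Fin (k + n) → Fin 2 =>
        y = z ∧ y (Fin.castAdd n ⟨j, hj⟩) = y (Fin.natAdd k ⟨v, hv⟩)) := by
  have key := fun b => (denotes_spot (E := E) hk hj b).tensor (denotes_spot hn hv b)
  refine ((key false).add (key true)).congr fun y z => ?_
  classical
  rw [bitTensor_indicator, bitTensor_indicator, Matrix.add_apply, indicator_apply, indicator_apply,
    indicator_apply]
  have hyz : ((fun i => y (Fin.castAdd n i)) = (fun i => z (Fin.castAdd n i)) ∧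
      (fun i => y (Fin.natAdd k i)) = fun i => z (Fin.natAdd k i)) ↔ y = z := by
    rw [funext_iff, funext_iff, funext_iff, Fin.forall_fin_add]
  by_cases hne : y = z
  · subst hne
    have h2 : ∀ p : Fin 2, p = 0 ∨ p = 1 := by decide
    rcases h2 (y (Fin.castAdd n ⟨j, hj⟩)) with h3 | h3 <;>
      rcases h2 (y (Fin.natAdd k ⟨v, hv⟩)) with h4 | h4 <;>
        simp only [h3, h4, boolBit] <;> simp
  · rw [if_neg, if_neg, if_neg]
    · simp
    · exact fun h => hne h.1
    · exact fun h => hne (hyz.1 ⟨h.1.1, h.2.1⟩)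
    · exact fun h => hne (hyz.1 ⟨h.1.1, h.2.1⟩)

theorem indicator_eq_one {ι : Type*} [DecidableEq ι] :
    indicator (K := K) (fun y z : ι => y = z) = 1 := by
  ext y z
  rw [indicator_apply, Matrix.one_apply]

theorem indicator_diagonal_mul {ι : Type*} [Fintype ι] [DecidableEq ι] (P Q : ι → Prop) :
    indicator (K := K) (fun y z : ι => y = z ∧ P y) * indicator (fun y z : ι => y = z ∧ Q y) =
      indicator fun y z : ι => y = z ∧ P y ∧ Q y := by
  classical
  ext y z
  simp only [Matrix.mul_apply, indicator_apply, ite_and, ite_mul, zero_mul, Finset.sum_ite_eq,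
    Finset.mem_univ, if_true, one_mul]
  by_cases h1 : P y <;> by_cases h2 : y = z <;> simp [h1, h2]

theorem prod_indicator_diagonal {ι : Type*} [Fintype ι] [DecidableEq ι] (P : ℕ → ι → Prop)
    (m : ℕ) :
    ((List.range m).map fun j => indicator (K := K) fun y z : ι => y = z ∧ P j y).prod =
      indicator fun y z : ι => y = z ∧ ∀ j < m, P j y := by
  induction m with
  | zero => simp [indicator_eq_one]
  | succ m ih =>
    rw [List.range_succ, List.map_append, List.prod_append, ih, List.map_singleton,
      List.prod_singleton, indicator_diagonal_mul]
    refine indicator_congr fun y z => ?_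
    simp only [Nat.lt_succ_iff_lt_or_eq, or_imp, forall_and, forall_eq]

theorem denotes_pair_identity {k n : ℕ} (hk : k ≤ 2 ^ h) (hn : n ≤ 2 ^ h) :
    Denotes E (pairWord (atomWords E) h k n (atomWords E).id) (h + 1)
      (indicator fun y z : Fin (k + n) → Fin 2 => y = z) := by
  have := (denotes_identity (E := E) hk).tensor (denotes_identity hn)
  rw [bitTensor_indicator] at this
  rwa [indicator_congr] at this
  intro y z
  rw [funext_iff, funext_iff, funext_iff, Fin.forall_fin_add]

/-- A product of diagonal 0/1 matrices intersects the conditions. The depth is that of a leaf, `h +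
2`, plus the height `h` of the tree of products. -/
theorem denotes_link {n : ℕ} {ms : List ℕ} (hk : ms.length ≤ 2 ^ h) (hn : n ≤ 2 ^ h)
    (hms : ∀ v ∈ ms, v < n) : Denotes E (linkWord (atomWords E) h n ms) (h + 2 + h)
      (indicator fun y z : Fin (ms.length + n) → Fin 2 => y = z ∧ ∀ j : Fin ms.length,
        y (Fin.castAdd n j) = y (Fin.natAdd ms.length ⟨ms[j], hms _ (by simp)⟩)) := by
  have key := denotes_treeWord_times (E := E) (h := h) (D := h + 2) (N := ms.length + n)
    (f := fun j => if j < ms.length then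
        linkLeafWord (atomWords E) h ms.length n j (ms.getD j 0)
      else pairWord (atomWords E) h ms.length n (atomWords E).id)
    (M := fun j => indicator fun y z : Fin (ms.length + n) → Fin 2 => y = z ∧
      ∀ hj : j < ms.length,
        y (Fin.castAdd n ⟨j, hj⟩) = y (Fin.natAdd ms.length ⟨ms[j], hms _ (by simp)⟩))
    fun j _ => ?_
  · rw [prod_indicator_diagonal] at key
    rw [linkWord]
    rwa [indicator_congr] at key
    intro y z
    refine and_congr_right fun _ => ⟨fun h j => h j (j.2.trans_le hk) j.2, fun h j _ hj => h ⟨j, hj⟩⟩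
  · by_cases hj : j < ms.length
    · have e : ms.getD j 0 = ms[j] := by simp [hj]
      simp only [hj, if_true, forall_true_left, e]
      exact denotes_linkLeaf hk hn hj _
    · simp only [hj, if_false, IsEmpty.forall_iff, and_true]
      exact (denotes_pair_identity hk hn).mono (by omega)

theorem denotes_fresh {n : ℕ} {ms : List ℕ} (hn : n ≤ 2 ^ h) :
    Denotes E (freshWord (atomWords E) h n ms) h
      (indicator fun y z : Fin n → Fin 2 => ∀ i : Fin n, (i : ℕ) ∉ ms → y i = z i) := by
  refine denotes_tensorWord hn (fun i p q => i ∉ ms → p = q) fun i _ => ?_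
  by_cases hi : i ∈ ms
  · simp only [hi, if_true, not_true_eq_false, IsEmpty.forall_iff]
    exact denotes_indicator _
  · simp only [hi, if_false, not_false_eq_true, forall_true_left]
    exact denotes_indicator _

theorem denotes_rowPair {k n : ℕ} (hk : k ≤ 2 ^ h) (hn : n ≤ 2 ^ h) :
    Denotes E (pairWord (atomWords E) h k n (atomWords E).row) (h + 1)
      (indicator fun (y : Fin n → Fin 2) (z : Fin (k + n) → Fin 2) =>
        y = fun i => z (Fin.natAdd k i)) := by
  have := ((denotes_tensorWord_row (E := E) hk).tensor (denotes_identity hn)).cast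
    (Nat.zero_add n) rfl
  refine this.congr fun y z => ?_
  classical
  rw [bitTensor_indicator, indicator_apply, indicator_apply]
  congr 1
  simp [funext_iff]

theorem denotes_colPair {k n : ℕ} (hk : k ≤ 2 ^ h) (hn : n ≤ 2 ^ h) :
    Denotes E (pairWord (atomWords E) h k n (atomWords E).col) (h + 1)
      (indicator fun (y : Fin (k + n) → Fin 2) (z : Fin n → Fin 2) =>
        (fun i => y (Fin.natAdd k i)) = z) := by
  have := ((denotes_tensorWord_col (E := E) hk).tensor (denotes_identity hn)).cast
    rfl (Nat.zero_add n)
  refine this.congr fun y z => ?_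
  classical
  rw [bitTensor_indicator, indicator_apply, indicator_apply]
  congr 1
  simp [funext_iff]

end GateFormula

/-! ### Gates and levels as matrices -/

section Gates

variable {K : Type*} [Semiring K] {Γ : Type*} {E : ElementEncoding K Γ} {h n : ℕ}

open TensorFormula (binaryCode)
open Logspace Logspace.ArrayProgram

theorem indicator_graph_mul {ι κ μ : Type*} [Fintype κ] (φ : ι → κ) (M : Matrix κ μ K) :
    (indicator (fun y u => u = φ y) : Matrix ι κ K) * M = M.submatrix φ id := by
  classical
  ext y z
  simp [Matrix.mul_apply, indicator_apply]

theorem mul_indicator_graph {ι κ μ : Type*} [Fintype κ] (φ : ι → κ) (M : Matrix μ κ K) :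
    M * (indicator (fun u z => u = φ z) : Matrix κ ι K) = M.submatrix id φ := by
  classical
  ext y z
  simp [Matrix.mul_apply, indicator_apply]

/-- The bits on the wires `w`, followed by all bits. -/
def linkedBits {k : ℕ} (w : Fin k → Fin n) (y : Fin n → Fin 2) : Fin (k + n) → Fin 2 :=
  Fin.append (y ∘ w) y

theorem eq_linkedBits_iff {k : ℕ} (w : Fin k → Fin n) (y : Fin n → Fin 2)
    (u : Fin (k + n) → Fin 2) : u = linkedBits w y ↔
      (y = fun i => u (Fin.natAdd k i)) ∧
        ∀ j, u (Fin.castAdd n j) = u (Fin.natAdd k (w j)) := by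
  constructor
  · rintro rfl
    exact ⟨funext fun i => by simp [linkedBits], fun j => by simp [linkedBits]⟩
  · rintro ⟨rfl, h⟩
    rw [funext_iff, Fin.forall_fin_add]
    exact ⟨fun j => by simp [linkedBits, h j], fun i => by simp [linkedBits]⟩

/-- The two factors on the left compose to the graph of `linkedBits w`, the two on the right to its
transpose. So the product is the entry of `G ⊗ fresh` at the linked vectors of `y` and `z`. The four
multiplications add `4` to the depth `2 * h + 2` of the links. -/
theorem denotes_gateWord {ms : List ℕ} {w : Fin ms.length → Fin n} (hw : ∀ j, (w j : ℕ) = ms[j])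
    (hk : ms.length ≤ 2 ^ h) (hn : n ≤ 2 ^ h) {mat : List (FormulaSymbol Γ)}
    {G : Matrix (Fin ms.length → Fin 2) (Fin ms.length → Fin 2) K} (hG : Denotes E mat 0 G) :
    Denotes E (gateWord (atomWords E) h n ms mat) (2 * h + 6)
      (fun y z => G (y ∘ w) (z ∘ w) *
        indicator (fun y z => ∀ i : Fin n, (i : ℕ) ∉ ms → y i = z i) y z) := by
  have hms : ∀ v ∈ ms, v < n := by
    intro v hv
    obtain ⟨j, hj, rfl⟩ := List.mem_iff_getElem.1 hv
    exact (hw ⟨j, hj⟩).symm.trans_lt (w _).2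
  have hwj : ∀ j : Fin ms.length, (⟨ms[j], hms _ (by simp)⟩ : Fin n) = w j := fun j =>
    Fin.ext (hw j).symm
  have h1 := denotes_rowPair (E := E) hk hn
  have h2 := denotes_link (E := E) hk hn hms
  have h3 := (hG.mono (Nat.zero_le h)).tensor (denotes_fresh (E := E) (ms := ms) hn)
  have h4 := denotes_colPair (E := E) hk hn
  simp only [hwj] at h2
  have h5 := ((((h1.mono (by omega : h + 1 ≤ 2 * h + 2)).mul
    (h2.mono (by omega : h + 2 + h ≤ 2 * h + 2))).mul (h3.mono (by omega))).mul
    (h2.mono (by omega))).mul (h4.mono (by omega))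
  rw [Matrix.mul_assoc] at h5
  -- The link is diagonal, so only the term with the index `u` remains; its two conditions are those
  -- of `eq_linkedBits_iff`.
  have e1 : (indicator (fun y u => y = fun i => u (Fin.natAdd ms.length i)) :
        Matrix (Fin n → Fin 2) (Fin (ms.length + n) → Fin 2) K) *
      (indicator (fun u v => u = v ∧
        ∀ j, u (Fin.castAdd n j) = u (Fin.natAdd ms.length (w j))) :
        Matrix (Fin (ms.length + n) → Fin 2) (Fin (ms.length + n) → Fin 2) K) =
      indicator fun y u => u = linkedBits w y := by
    classical
    ext y u
    simp only [Matrix.mul_apply, indicator_apply, eq_linkedBits_iff]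
    rw [Finset.sum_eq_single u]
    · by_cases hy : y = fun i => u (Fin.natAdd ms.length i) <;> simp [hy]
    · intro v _ hv
      simp [hv]
    · simp
  have e2 : (indicator (fun u v => u = v ∧
        ∀ j, u (Fin.castAdd n j) = u (Fin.natAdd ms.length (w j))) :
        Matrix (Fin (ms.length + n) → Fin 2) (Fin (ms.length + n) → Fin 2) K) *
      (indicator (fun u z => (fun i => u (Fin.natAdd ms.length i)) = z) :
        Matrix (Fin (ms.length + n) → Fin 2) (Fin n → Fin 2) K) =
      indicator fun u z => u = linkedBits w z := by
    classical
    ext u z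
    simp only [Matrix.mul_apply, indicator_apply, eq_linkedBits_iff]
    rw [Finset.sum_eq_single u]
    · by_cases hz : (fun i => u (Fin.natAdd ms.length i)) = z
      · simp [← hz]
      · simp [hz, Ne.symm hz]
    · intro v _ hv
      simp [hv.symm]
    · simp
  rw [e1, e2, Matrix.mul_assoc, indicator_graph_mul, mul_indicator_graph] at h5
  exact (h5.mono (by omega)).congr fun y z => by simp [bitTensor, linkedBits, Function.comp_def]

/-- A gate as it is written in the input. -/
def Gate.toInput (E : ElementEncoding K Γ) (g : Gate K n) : InputGate Γ where
  wires := g.wireList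
  body := (List.finRange (2 ^ g.arity)).flatMap fun i => bracket <|
    (List.finRange (2 ^ g.arity)).flatMap fun j => bracket <|
      (E.encode (g.matrix i j)).map Sum.inl
  balanced := bracketBalanced_rows E.encode g.matrix
  noParen x hx := by
    rintro rfl
    simp [bracket] at hx

theorem Gate.toInput_code (g : Gate K n) : (g.toInput E).code = g.code E.encode :=
  (g.code_eq E.encode).symm

theorem Gate.length_wireList (g : Gate K n) : g.wireList.length = g.arity := by
  simp [Gate.wireList]

theorem Gate.getElem_wireList (g : Gate K n) (j : ℕ) (hj : j < g.wireList.length) :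
    g.wireList[j] = g.wires ⟨j, g.length_wireList ▸ hj⟩ := by
  simp [Gate.wireList]

theorem Gate.arity_le (g : Gate K n) : g.arity ≤ n := by
  simpa using Fintype.card_le_of_embedding g.wires

theorem Gate.mem_wireList (g : Gate K n) (i : Fin n) :
    (i : ℕ) ∈ g.wireList ↔ i ∈ Set.range g.wires := by
  simp [Gate.wireList, Fin.ext_iff]

theorem denotes_gate (g : Gate K n) (hg : ∀ i j, g.matrix i j ∈ E.carrier) (hn : n ≤ 2 ^ h) :
    Denotes E (inputGateWord (atomWords E) h n (g.toInput E)) (2 * h + 6) (levelMatrix [g]) := by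
  have hG : Denotes E (g.toInput E).matrix 0
      (g.matrix.submatrix (bitIndex g.arity) (bitIndex g.arity)) := by
    have := denotes_atom (E := E) (g.matrix.submatrix (bitIndex g.arity) (bitIndex g.arity))
      fun _ _ => hg _ _
    rwa [Matrix.submatrix_submatrix, Equiv.self_comp_symm, Matrix.submatrix_id_id] at this
  have hlen := g.length_wireList
  have := denotes_gateWord (E := E) (w := fun j => g.wires (Fin.cast hlen j))
    (ms := g.wireList) (fun j => (g.getElem_wireList j j.2).symm)
    (by rw [hlen]; exact g.arity_le.trans hn) hn
    (hG.cast hlen.symm hlen.symm)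
  refine this.congr fun y z => ?_
  classical
  rw [indicator_apply, levelMatrix]
  simp only [g.mem_wireList, List.mem_singleton, forall_eq, List.map_singleton,
    List.prod_singleton, mul_ite, mul_one, mul_zero]
  congr 1

theorem levelMatrix_nil : levelMatrix (K := K) ([] : List (Gate K n)) = 1 := by
  ext y z
  simp [levelMatrix, Matrix.one_apply, funext_iff]

/-- Of all intermediate vectors one contributes: the gate `g` has already changed its own wires, and
the other wires are still as in `y`. The remaining gates then see `y` and `z` as before, and the
entries are multiplied in the listed order, so commutativity plays no role. -/
theorem levelMatrix_cons (g : Gate K n) (L : List (Gate K n))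
    (hL : ∀ g' ∈ L, Disjoint (Set.range g.wires) (Set.range g'.wires)) :
    levelMatrix (g :: L) = levelMatrix [g] * levelMatrix L := by
  classical
  ext y z
  have hdis : ∀ g' ∈ L, ∀ j, g'.wires j ∉ Set.range g.wires := fun g' hg' j hj =>
    Set.disjoint_left.1 (hL g' hg') hj ⟨j, rfl⟩
  rw [Matrix.mul_apply, Finset.sum_eq_single fun i => if i ∈ Set.range g.wires then z i else y i]
  · set u : Fin n → Fin 2 := fun i => if i ∈ Set.range g.wires then z i else y i with hu
    have hug : u ∘ g.wires = z ∘ g.wires := funext fun j => by simp [hu]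
    have huL : ∀ g' ∈ L, u ∘ g'.wires = y ∘ g'.wires := fun g' hg' => funext fun j => by
      simp only [hu, Function.comp]; rw [if_neg (hdis g' hg' j)]
    have h1 : ∀ i, (∀ g' ∈ [g], i ∉ Set.range g'.wires) → y i = u i := by
      intro i hi
      have := hi g (by simp)
      simp only [hu]; rw [if_neg this]
    have h2 : (∀ i, (∀ g' ∈ L, i ∉ Set.range g'.wires) → u i = z i) ↔
        ∀ i, (∀ g' ∈ g :: L, i ∉ Set.range g'.wires) → y i = z i := by
      constructor
      · intro h i hi
        rw [List.forall_mem_cons] at hi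
        have := h i hi.2
        simp only [hu] at this
        rwa [if_neg hi.1] at this
      · intro h i hi
        by_cases hg : i ∈ Set.range g.wires
        · simp only [hu]; rw [if_pos hg]
        · simp only [hu]; rw [if_neg hg]
          exact h i (List.forall_mem_cons.2 ⟨hg, hi⟩)
    have h3 : (L.map fun g' => g'.matrix (bitIndex _ (u ∘ g'.wires)) (bitIndex _ (z ∘ g'.wires))) =
        L.map fun g' => g'.matrix (bitIndex _ (y ∘ g'.wires)) (bitIndex _ (z ∘ g'.wires)) :=
      List.map_congr_left fun g' hg' => by rw [huL g' hg']
    simp only [levelMatrix, if_pos h1, h2, h3, List.map_cons, List.prod_cons, List.map_nil,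
      List.prod_nil, mul_one, hug]
    split <;> simp
  · intro v _ hv
    by_cases h1 : ∀ i, (∀ g' ∈ [g], i ∉ Set.range g'.wires) → y i = v i
    · have h2 : ¬ ∀ i, (∀ g' ∈ L, i ∉ Set.range g'.wires) → v i = z i := by
        intro h2
        refine hv (funext fun i => ?_)
        by_cases hg : i ∈ Set.range g.wires
        · rw [if_pos hg]
          exact h2 i fun g' hg' hi => Set.disjoint_left.1 (hL g' hg') hg hi
        · rw [if_neg hg]
          exact (h1 i (by simpa using hg)).symm
      rw [levelMatrix, levelMatrix, if_neg h2, mul_zero]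
    · rw [levelMatrix, if_neg h1, zero_mul]
  · simp

theorem levelMatrix_eq_prod {L : List (Gate K n)}
    (hL : L.Pairwise fun g g' => Disjoint (Set.range g.wires) (Set.range g'.wires)) :
    levelMatrix L = (L.map fun g => levelMatrix [g]).prod := by
  induction L with
  | nil => rw [levelMatrix_nil]; rfl
  | cons g L ih =>
    rw [List.pairwise_cons] at hL
    rw [levelMatrix_cons g L hL.1, ih hL.2, List.map_cons, List.prod_cons]

/-- Gates have positive arity and disjoint wires, so their first wires are distinct. -/
theorem length_level_le {L : List (Gate K n)}
    (hL : L.Pairwise fun g g' => Disjoint (Set.range g.wires) (Set.range g'.wires)) :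
    L.length ≤ n := by
  have hnd : (L.map fun g => g.wires ⟨0, g.arity_pos⟩).Nodup := by
    rw [List.Nodup, List.pairwise_map]
    refine hL.imp ?_
    intro g g' h e
    exact Set.disjoint_left.1 h (Set.mem_range_self ⟨0, g.arity_pos⟩)
      ⟨⟨0, g'.arity_pos⟩, e.symm⟩
  simpa using hnd.length_le_card

end Gates

/-! ### The formula of the array -/

section Array

variable {K : Type*} [Semiring K] {Γ : Type*} {E : ElementEncoding K Γ} {h n : ℕ}

open TensorFormula (binaryCode)
open Logspace Logspace.ArrayProgram

theorem GateArray.amplitude_eq (C : GateArray K n) (x y : Fin n → Fin 2) :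
    C.amplitude x y = (C.levels.reverse.map levelMatrix).prod y x := by
  have key : ∀ (Ls : List (List (Gate K n))) (v : (Fin n → Fin 2) → K),
      Ls.foldl (fun v L => levelMatrix L *ᵥ v) v = (Ls.reverse.map levelMatrix).prod *ᵥ v := by
    intro Ls
    induction Ls with
    | nil => intro v; simp
    | cons L Ls ih =>
      intro v
      rw [List.foldl_cons, ih, List.reverse_cons, List.map_append, List.prod_append,
        Matrix.mulVec_mulVec]
      simp
  rw [GateArray.amplitude, key, Matrix.mulVec_single_one]
  rfl

theorem GateArray.prod_levels (C : GateArray K n) :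
    (C.levels.reverse.map levelMatrix).prod =
      (C.levels.reverse.flatten.map fun g => levelMatrix [g]).prod := by
  rw [List.map_flatten, List.prod_flatten, List.map_map]
  congr 1
  refine List.map_congr_left fun L hL => ?_
  exact levelMatrix_eq_prod (C.disjoint L (List.mem_reverse.1 hL))

theorem GateArray.length_gates_le (C : GateArray K n) : C.levels.flatten.length ≤ C.size := by
  rw [List.length_flatten, GateArray.size, mul_comm]
  refine (List.sum_le_card_nsmul _ n ?_).trans_eq (by simp)
  intro m hm
  obtain ⟨L, hL, rfl⟩ := List.mem_map.1 hm
  exact length_level_le (C.disjoint L hL)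

theorem GateArray.code_eq (C : GateArray K n) : C.code E.encode = unary n ++
    (C.levels.map fun L => L.map (Gate.toInput E)).flatMap InputGate.levelCode := by
  rw [GateArray.code, List.flatMap_map]
  congr 1
  refine List.flatMap_congr fun L _ => ?_
  rw [InputGate.levelCode, List.flatMap_map]
  congr 2
  exact List.flatMap_congr fun g _ => (g.toInput_code).symm

/-- The gates, of depth `2 * h + 6`, are the leaves of a tree of height `h`; identities fill it up.
-/
theorem denotes_productWord (G : List (Gate K n)) (hG : ∀ g ∈ G, ∀ i j, g.matrix i j ∈ E.carrier)
    (hn : n + G.length ≤ 2 ^ h) :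
    Denotes E (productWord (atomWords E) h n (G.map (Gate.toInput E))) (3 * h + 6)
      (G.map fun g => levelMatrix [g]).prod := by
  have key := denotes_treeWord_times (E := E) (h := h) (D := 2 * h + 6) (N := n)
    (f := fun i => if i < (G.map (Gate.toInput E)).length then
        ((G.map (Gate.toInput E)).map (inputGateWord (atomWords E) h n)).getD i []
      else tensorWord (atomWords E) h n fun _ => (atomWords E).id)
    (M := fun i => if hi : i < G.length then levelMatrix [G[i]] else 1) fun i _ => ?_
  · have e : ((List.range (2 ^ h)).map fun i =>
        if hi : i < G.length then levelMatrix [G[i]] else 1).prod =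
        (G.map fun g => levelMatrix [g]).prod := by
      rw [range_append_range' (by omega : G.length ≤ 2 ^ h), List.map_append, List.prod_append]
      have e1 : (List.range G.length).map (fun i =>
          if hi : i < G.length then levelMatrix [G[i]] else 1) =
          G.map fun g => levelMatrix [g] := by
        refine List.ext_getElem (by simp) fun i h1 h2 => ?_
        have : i < G.length := by simpa using h2
        simp [this]
      have e2 : ((List.range' G.length (2 ^ h - G.length)).map (fun i =>
          if hi : i < G.length then levelMatrix [G[i]] else 1)).prod = 1 := by
        refine List.prod_eq_one fun M hM => ?_
        obtain ⟨i, hi, rfl⟩ := List.mem_map.1 hM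
        have := (List.mem_range'_1.1 hi).1
        rw [dif_neg (by omega)]
      rw [e1, e2, mul_one]
    rw [e] at key
    exact key.mono (by omega)
  · by_cases hi : i < G.length
    · have e : ((G.map (Gate.toInput E)).map (inputGateWord (atomWords E) h n)).getD i [] =
          inputGateWord (atomWords E) h n (G[i].toInput E) := by simp [hi]
      simp only [List.length_map, hi, if_true, dif_pos, e]
      exact denotes_gate _ (hG _ (by simp)) (by omega)
    · simp only [List.length_map, hi, if_false, dif_neg, not_false_eq_true]
      rw [← indicator_eq_one]
      exact (denotes_identity (by omega)).mono (by omega)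

theorem TensorFormula.value_tensor {k l m p : ℕ} (F : TensorFormula K k l)
    (G : TensorFormula K m p) (i : Fin k × Fin m) (j : Fin l × Fin p) :
    (F.tensor G).value (finProdFinEquiv i) (finProdFinEquiv j) =
      F.value i.1 j.1 * G.value i.2 j.2 := by
  simp [TensorFormula.value]

theorem basisVector_value (x : Fin n → Fin 2) (y : Fin n → Fin 2) (j : Fin 1) :
    (TensorFormula.basisVector (K := K) n x).value (bitIndex n y) j = if y = x then 1 else 0 := by
  induction n generalizing j with
  | zero =>
    have h2 : bitIndex 0 y = j := Subsingleton.elim (α := Fin 1) _ _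
    rw [if_pos (Subsingleton.elim _ _), TensorFormula.basisVector, TensorFormula.value, h2]
    exact Matrix.one_apply_eq _
  | succ n ih =>
    -- `basisVector` splits off the last bit, which is the least significant one.
    have hi : bitIndex (n + 1) y = (finProdFinEquiv (bitIndex n fun i => y i.castSucc,
        y (Fin.last n)) : Fin (2 ^ n * 2)) := by
      apply Fin.ext
      rw [finProdFinEquiv_apply_val]
      have h1 := bitIndex_append_val (a := n) (c := 1) y
      have h2 := bitIndex_val (k := 1) fun i => y (Fin.natAdd n i)
      rw [h2] at h1
      simp at h1
      exact h1
    have hj : j = (finProdFinEquiv ((0 : Fin 1), (0 : Fin 1)) : Fin (1 * 1)) :=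
      Subsingleton.elim (α := Fin 1) _ _
    have key := TensorFormula.value_tensor
      (TensorFormula.basisVector (K := K) n fun i => x i.castSucc)
      (TensorFormula.bitVector (x (Fin.last n)))
      (bitIndex n fun i => y i.castSucc, y (Fin.last n)) ((0 : Fin 1), (0 : Fin 1))
    dsimp only at key
    rw [ih, TensorFormula.bitVector] at key
    refine (congrArg₂ (TensorFormula.basisVector (K := K) (n + 1) x).value hi hj).trans
      (key.trans ?_)
    simp only [TensorFormula.value, ite_mul, one_mul, zero_mul, ← ite_and]
    congr 1
    rw [funext_iff, funext_iff, Fin.forall_fin_succ', eq_iff_iff]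

end Array

theorem mainTheorem5 {K : Type*} [Semiring K] [InvolutiveStar K] {Γ : Type*} [Finite Γ]
    (E : ElementEncoding K Γ) :
    ∃ f : List (ArraySymbol Γ) → List (FormulaSymbol Γ), Logspace.LogspaceComputable f ∧
      ∃ c : ℕ, ∀ (n : ℕ) (C : GateArray K n), C.IsOrthogonal → C.EntriesIn E.carrier →
        ∃ F : TensorFormula K (2 ^ n) (2 ^ n),
          f (C.code E.encode) = F.code E.encode ∧
          F.EntriesIn E.carrier ∧
          F.depth ≤ c * (Nat.log 2 C.size + 1) ∧
          ∀ x : Fin n → Fin 2, C.output x = (F.mul (TensorFormula.basisVector n x)).value := by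
  obtain ⟨f, hf, hrun⟩ := Logspace.Program.logspaceComputable _
    (Logspace.ArrayProgram.main_wellFormed (atomWords E))
  -- The height satisfies `h ≤ log + 3`, so the depth is at most `3 * (log + 3) + 6 = 3 * log + 15`.
  refine ⟨f, hf, 15, fun n C _ hC => ?_⟩
  obtain ⟨ℓ, hℓ, hout⟩ := hrun (C.code E.encode)
  have hlen : 1 ≤ C.levels.length := List.length_pos_iff.2 C.levels_ne_nil
  have hflat : ((C.levels.map fun L => L.map (Gate.toInput E)).flatten).length =
      C.levels.flatten.length := by
    rw [← List.map_flatten, List.length_map]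
  obtain ⟨h, h1, h2, h3⟩ := Logspace.ArrayProgram.exec_main (atomWords E) (n := n)
    (Ls := C.levels.map fun L => L.map (Gate.toInput E)) (GateArray.code_eq C)
    (by simpa using C.levels_ne_nil) hℓ (by
      simp only [List.mem_map, forall_exists_index, and_imp, forall_apply_eq_imp_iff₂]
      intro L _ g _
      exact (g.length_wireList).trans_le g.arity_le)
  rw [hflat] at h1 h2
  have hrev : (C.levels.map fun L => L.map (Gate.toInput E)).reverse.flatten =
      C.levels.reverse.flatten.map (Gate.toInput E) := by
    rw [← List.map_reverse, ← List.map_flatten]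
  rw [hrev] at h3
  have hlr : C.levels.reverse.flatten.length = C.levels.flatten.length := by
    rw [List.length_flatten, List.length_flatten, List.map_reverse, List.sum_reverse]
  obtain ⟨F, f1, f2, f3, f4⟩ := denotes_productWord (E := E) (h := h) C.levels.reverse.flatten
    (fun g hg => by
      obtain ⟨L, hL, hgL⟩ := List.mem_flatten.1 hg
      exact hC L (List.mem_reverse.1 hL) g hgL) (by rw [hlr]; exact h1)
  refine ⟨F, by rw [f1, hout, h3], f2, f3.trans ?_, fun x => ?_⟩
  · have hm := C.length_gates_le
    have hn := C.width_pos
    have hsize : n ≤ C.size := Nat.le_mul_of_pos_right n hlen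
    have hlog := Nat.lt_pow_succ_log_self one_lt_two C.size
    -- Wires and gates number at most `C.size` each, whence `2 ^ h ≤ 4 * C.size + 1`.
    have hpow : 2 ^ h < 2 ^ (Nat.log 2 C.size + 1 + 3) := by
      rw [pow_add _ _ 3]; omega
    have := (Nat.pow_lt_pow_iff_right one_lt_two).1 hpow
    omega
  · ext i j
    rw [TensorFormula.value, Matrix.mul_apply, ← Equiv.sum_comp (bitIndex n)]
    simp only [basisVector_value, mul_ite, mul_one, mul_zero, Finset.sum_ite_eq', 
      Finset.mem_univ, if_true, f4, Matrix.submatrix_apply, Equiv.symm_apply_apply]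
    rw [GateArray.output, C.amplitude_eq, C.prod_levels]
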